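/- **Conventions.** $X$ is a simplicial graph; a subgraph always means an induced subgraph, and it is identified with its vertex set. For $Y\subseteq X$, the link $lk(Y)$ is the set of vertices adjacent to every vertex of $Y$. Connected graphs are regarded as geodesic metric spaces (edges of length one) with their path metrics. For a subset $A$ of a metric space, $N_r(A)$ is its $r$-neighbourhood. A geodesic space is $\delta$-hyperbolic if $d(x,z)+d(y,w)\le\max\{d(x,y)+d(z,w),\,d(y,z)+d(x,w)\}+2\delta$ for all points $x,y,z,w$. **Graph factor systems.** A graph factor system of $X$ with complexity constant $n$ is a set $\mathfrak F$ of non-empty subgraphs of $X$ (the domains) such that $X\in\mathfrak F$; $lk(v)\in\mathfrak F$ for every vertex $v$ with $lk(v)\neq\emptyset$; $F_1\cap F_2\in\mathfrak F$ whenever $F_1,F_2\in\mathfrak F$ and $F_1\cap F_2\ne\emptyset$; and $k<n$ for every chain $F_1\subsetneq\dots\subsetneq F_k$ in $\mathfrak F$. An $F$-graph is a graph whose vertices are the maximal cliques of $F$. Let $W$ be an $X$-graph. **Augmented graphs.** Introduce a new vertex $b_F$ for each domain $F\ne X$. The augmented graph $CX$ has vertex set $V(X)\cup\{b_F\mid F\in\mathfrak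 F,\ F\neq X\}$. Two distinct vertices $v,w$ of $X$ are adjacent in $CX$ if they are adjacent in $X$ or if there are $W$-adjacent maximal cliques $x\ni v$, $y\ni w$; and $b_F$ is adjacent exactly to the vertices of $F$. For $F\in\mathfrak F$, $CF$ is the subgraph of $CX$ induced on $V(F)\cup\{b_H\mid H\in\mathfrak F,\ H\subsetneq F\}$. Put $$PF=lk(F)\cup\{b_H\mid H\subseteq lk(F)\}\cup\{b_H\mid F\subseteq H\ne X\}\qquad(H\in\mathfrak F),$$ and let $Y_F$ be the subgraph of $CX$ induced on $V(CX)\setminus PF$; it contains $CF$. The same construction applied to a domain $F$ with the system $\{F'\in\mathfrak F\mid F'\subseteq F\}$ and an $F$-graph $W^F$ gives augmented graphs $C_FF'$ for the domains $F'\subseteq F$. **CHHF.** $(X,W,\mathfrak F)$ is a CHHF triple with constants $n,\delta$ if $\mathfrak F$ is a graph factor system of $X$ with complexity constant $n$ and the following hold. * ($\delta$-hyperbolicity condition) $\delta>0$, and for each $F\in\mathfrak F$ the graph $CF$ is $\delta$-hyperbolic and the inclusion $CF\to Y_F$ is a $(\delta,\delta)$-quasi-isometric embedding. * (Hierarchy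 condition) There are $F$-graphs $W^F$ ($F\in\mathfrak F$), with $W^X=W$, such that for all domains $F'\subseteq F$: $C_FF'=CF'$; and for each (possibly empty) maximal clique $x$ of $lk(F')\cap F$ there is a graph homomorphism $W^{F'}\to W^F$ sending each maximal clique $w$ of $F'$ to a maximal clique of $F$ that contains $x\cup w$. **Proto-hierarchy structures.** Let $E>0$ and let $\mathcal X$ be a quasi-geodesic space. An $E$-proto-hierarchy structure on $\mathcal X$ consists of an index set $\mathfrak S$, geodesic spaces $CU$ ($U\in\mathfrak S$), and the following. 1. (Projections) Maps $\pi_U$ from $\mathcal X$ to the non-empty subsets of $CU$ of diameter at most $E$, with $d(a,b)\le E\,d(x,y)+E$ for $a\in\pi_U(x)$, $b\in\pi_U(y)$, and $CU\subseteq N_E\big(\bigcup_x\pi_U(x)\big)$. 2. (Nesting) A partial order $\sqsubseteq$ on $\mathfrak S$ which, unless $\mathfrak S=\emptyset$, has a unique maximal element. For $U\sqsubsetneq V$, a non-empty set $\rho^U_V\subseteq CV$ of diameter at most $E$, and a map $\rho^V_U$ from $CV\setminus N_E(\rho^U_V)$ to non-empty subsets of $CU$. 3. (Orthogonality) A symmetric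 irreflexive relation $\perp$ on $\mathfrak S$ such that $U\sqsubseteq V$ and $V\perp W$ imply $U\perp W$, and such that orthogonal elements are not $\sqsubseteq$-comparable. 4. (Transversality) If $U,V$ are neither orthogonal nor $\sqsubseteq$-comparable, non-empty sets $\rho^U_V\subseteq CV$ and $\rho^V_U\subseteq CU$, each of diameter at most $E$. **Lemma 3.17.** For all $n$ and $\delta$ there is a constant $E=E(n,\delta)>0$ such that for every CHHF triple $(X,W,\mathfrak F)$ with constants $n,\delta$ the following data form an $E$-proto-hierarchy structure on the graph $W$ (in particular, $W$ is connected). The index set is $\mathfrak F$, and the space of $F\in\mathfrak F$ is the augmented graph $CF$. For $F\in\mathfrak F$ and points $x$ of $Y_F$, let $$p_F(x)=\{y\in CF\mid d_{Y_F}(x,y)\le d_{Y_F}(x,CF)+1\}$$ be the coarse closest-point projection; for a set $A$ of points of $Y_F$, $p_F(A)=\bigcup_{a\in A}p_F(a)$. * For a vertex $w$ of $W$, i.e. a maximal clique of $X$, $\pi_X(w)=w\subseteq CX$, and $\pi_F(w)=p_F(w\cap Y_F)$ for $F\neq X$ (with $w$ regarded as a set of vertices); for an interior point $e$ of an edge of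 $W$ with endpoints $w,w'$, $\pi_F(e)=\pi_F(w)\cup\pi_F(w')$. * $F\sqsubseteq F'$ if and only if $F\subseteq F'$. * $F\perp F'$ if and only if $F'\subseteq lk(F)$. * If $F\sqsubsetneq F'$, or if $F,F'$ are transverse, $\rho^F_{F'}=p_{F'}(PF\cap Y_{F'})$, where $PF$ is regarded as a set of vertices. * If $F\sqsubsetneq F'$, $\rho^{F'}_F(x)=p_F(x)$ for $x\in CF'\cap Y_F$, and $\rho^{F'}_F(x)=\emptyset$ for all other $x\in CF'$. -/

import Mathlib

namespace CHHF

/-! ## Metric notions, for an explicitly given real-valued distance function -/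

/-- `d` is a metric on `C`. -/
structure IsMetric {C : Type*} (d : C → C → ℝ) : Prop where
  eq_zero_iff : ∀ x y, d x y = 0 ↔ x = y
  symm : ∀ x y, d x y = d y x
  triangle : ∀ x y z, d x z ≤ d x y + d y z

/-- `(C, d)` is a geodesic metric space: any two points are joined by an isometrically
embedded interval of length equal to their distance. -/
structure IsGeodesicSpace {C : Type*} (d : C → C → ℝ) : Prop where
  isMetric : IsMetric d
  exists_geodesic : ∀ x y, ∃ γ : ℝ → C, γ 0 = x ∧ γ (d x y) = y ∧
    ∀ s ∈ Set.Icc 0 (d x y), ∀ t ∈ Set.Icc 0 (d x y), d (γ s) (γ t) = |s - t|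

/-- `(C, d)` is a quasi-geodesic metric space: for some `K ≥ 1` any two points are joined by a
`(K, K)`-quasi-geodesic. -/
structure IsQuasiGeodesicSpace {C : Type*} (d : C → C → ℝ) : Prop where
  isMetric : IsMetric d
  exists_quasigeodesic : ∃ K : ℝ, 1 ≤ K ∧ ∀ x y, ∃ (L : ℝ) (γ : ℝ → C),
    0 ≤ L ∧ γ 0 = x ∧ γ L = y ∧
      ∀ s ∈ Set.Icc 0 L, ∀ t ∈ Set.Icc 0 L,
        |s - t| / K - K ≤ d (γ s) (γ t) ∧ d (γ s) (γ t) ≤ K * |s - t| + K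

/-- `(C, d)` is a `δ`-hyperbolic geodesic metric space (Gromov's four-point condition). -/
structure IsHyperbolic {C : Type*} (δ : ℝ) (d : C → C → ℝ) : Prop where
  isGeodesicSpace : IsGeodesicSpace d
  four_point : ∀ x y z w, d x z + d y w ≤ max (d x y + d z w) (d y z + d x w) + 2 * δ

/-- The set `s` has diameter at most `r`. -/
def DiamLE {C : Type*} (d : C → C → ℝ) (s : Set C) (r : ℝ) : Prop :=
  ∀ x ∈ s, ∀ y ∈ s, d x y ≤ r

/-- The `r`-neighbourhood `N_r(s)`. -/
def nbhd {C : Type*} (d : C → C → ℝ) (r : ℝ) (s : Set C) : Set C :=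
  {x | ∃ a ∈ s, d x a ≤ r}

/-! ## Proto-hierarchy structures -/

/-- The data of a proto-hierarchy structure on `X`: an index set `S` with spaces `C U`, projections
`π_U`, relations `⊑` and `⊥`, sets `ρ^U_V ⊆ C V` (meaningful if `U ⊏ V` or `U ⋔ V`) and, for
`U ⊏ V`, maps `ρ^V_U` from `C V` to subsets of `C U` (meaningful away from a neighbourhood of
`ρ^U_V`). -/
structure ProtoData (X : Type*) (S : Type*) (C : S → Type*) where
  /-- the distance of `X` -/
  dX : X → X → ℝ
  /-- the distance of `C U` -/
  dC : ∀ U, C U → C U → ℝ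
  /-- the projection `π_U` -/
  proj : ∀ U, X → Set (C U)
  /-- `nest U V` is `U ⊑ V` -/
  nest : S → S → Prop
  /-- `orth U V` is `U ⊥ V` -/
  orth : S → S → Prop
  /-- `rel U V` is the set `ρ^U_V ⊆ C V`, for `U ⊏ V` or `U ⋔ V` -/
  rel : ∀ _ V : S, Set (C V)
  /-- `relMap V U` is the map `ρ^V_U`, for `U ⊏ V` -/
  relMap : ∀ V U : S, C V → Set (C U)

/-- Proper nesting `U ⊏ V`. -/
def ProtoData.pnest {X S : Type*} {C : S → Type*} (P : ProtoData X S C) (U V : S) : Prop :=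
  P.nest U V ∧ U ≠ V

/-- Transversality `U ⋔ V`: not orthogonal, and neither is nested in the other. -/
def ProtoData.trans {X S : Type*} {C : S → Type*} (P : ProtoData X S C) (U V : S) : Prop :=
  ¬ P.orth U V ∧ ¬ P.nest U V ∧ ¬ P.nest V U

/-- The data `P` form an `E`-proto-hierarchy structure. -/
structure IsProtoHierarchy {X S : Type*} {C : S → Type*} (E : ℝ) (P : ProtoData X S C) : Prop where
  E_pos : 0 < E
  quasiGeodesic : IsQuasiGeodesicSpace P.dX
  geodesic : ∀ U, IsGeodesicSpace (P.dC U)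
  -- projections
  proj_nonempty : ∀ U x, (P.proj U x).Nonempty
  proj_diam : ∀ U x, DiamLE (P.dC U) (P.proj U x) E
  proj_lipschitz : ∀ U x y, ∀ a ∈ P.proj U x, ∀ b ∈ P.proj U y, P.dC U a b ≤ E * P.dX x y + E
  proj_coarsely_onto : ∀ U c, c ∈ nbhd (P.dC U) E (⋃ x, P.proj U x)
  -- nesting
  nest_refl : ∀ U, P.nest U U
  nest_trans : ∀ U V W, P.nest U V → P.nest V W → P.nest U W
  nest_antisymm : ∀ U V, P.nest U V → P.nest V U → U = V
  maximal : IsEmpty S ∨ ∃! M : S, ∀ U, P.nest M U → U = M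
  rel_nest_nonempty : ∀ U V, P.pnest U V → (P.rel U V).Nonempty
  rel_nest_diam : ∀ U V, P.pnest U V → DiamLE (P.dC V) (P.rel U V) E
  relMap_nonempty : ∀ U V, P.pnest U V → ∀ x, x ∉ nbhd (P.dC V) E (P.rel U V) →
    (P.relMap V U x).Nonempty
  -- orthogonality
  orth_symm : ∀ U V, P.orth U V → P.orth V U
  orth_irrefl : ∀ U, ¬ P.orth U U
  orth_of_nest : ∀ U V W, P.nest U V → P.orth V W → P.orth U W
  orth_not_comparable : ∀ U V, P.orth U V → ¬ P.nest U V ∧ ¬ P.nest V U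
  -- transversality
  rel_trans : ∀ U V, P.trans U V →
    ((P.rel U V).Nonempty ∧ DiamLE (P.dC V) (P.rel U V) E) ∧
    ((P.rel V U).Nonempty ∧ DiamLE (P.dC U) (P.rel V U) E)

/-! ## Geometric realizations of graphs

The realization of a graph on `U` consists of the functions `U → ℝ` that are barycentric
coordinates of a point of a vertex or an edge. Thus the realization of an induced subgraph is a
subset of the realization of the whole graph, but carries its own path metric. -/

/-- The vertex `u`, as a point of a realization. -/
noncomputable def vertexPoint {U : Type*} (u : U) : U → ℝ :=
  open Classical in Pi.single u 1

/-- The realization of the subgraph of `H` induced on the vertex set `S`, all edges having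
length one. -/
def realization {U : Type*} (H : SimpleGraph U) (S : Set U) : Set (U → ℝ) :=
  {p | ∃ u ∈ S, ∃ v ∈ S, (u = v ∨ H.Adj u v) ∧
    ∃ t ∈ Set.Icc (0 : ℝ) 1, p = (1 - t) • vertexPoint u + t • vertexPoint v}

/-- The path metric of the realization of the subgraph of `H` induced on `S`, when that subgraph is
connected. Two points of one closed edge are at their distance along this edge; otherwise a
shortest path leaves `p` through a vertex `u` of the support of `p` (which is at distance `1 - p u`
from `p`), runs along edges, and reaches `q` through a vertex of the support of `q`. -/
noncomputable def realizationDist {U : Type*} (H : SimpleGraph U) (S : Set U) (p q : U → ℝ) : ℝ :=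
  open Classical in
  if ∃ u v, (u = v ∨ H.Adj u v) ∧ Function.support p ⊆ {u, v} ∧ Function.support q ⊆ {u, v} then
    ⨆ u, |p u - q u|
  else
    ⨅ a : Function.support p × Function.support q,
      (1 - p a.1) + ((H.induce S).spanningCoe.dist (a.1 : U) (a.2 : U) : ℝ) + (1 - q a.2)

/-! ## Graph factor systems and `X`-graphs

`X` is a simplicial graph `G` on the vertex type `V`; an induced subgraph is given by its set of
vertices, and `X` itself by `Set.univ`. -/

variable {V : Type*}

/-- The vertices of the link `lk(Y)`: those adjacent to all vertices of `Y`. -/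
def link (G : SimpleGraph V) (Y : Set V) : Set V := {v | ∀ y ∈ Y, G.Adj y v}

/-- `𝔉` is a graph factor system of `G` whose chains of domains all have length less than `n`.
Domains are non-empty. -/
structure IsFactorSystem (n : ℕ) (G : SimpleGraph V) (𝔉 : Set (Set V)) : Prop where
  nonempty : ∀ F ∈ 𝔉, F.Nonempty
  univ_mem : Set.univ ∈ 𝔉
  link_mem : ∀ v, (link G {v}).Nonempty → link G {v} ∈ 𝔉
  inter_mem : ∀ F₁ ∈ 𝔉, ∀ F₂ ∈ 𝔉, (F₁ ∩ F₂).Nonempty → F₁ ∩ F₂ ∈ 𝔉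
  complexity : ∀ (k : ℕ) (c : Fin k → Set V), StrictMono c → (∀ i, c i ∈ 𝔉) → k < n

/-- The maximal cliques of the subgraph of `G` induced on `A` (if `A` is empty, the only one is the
empty clique). An `A`-graph is a `SimpleGraph (MaxClique G A)`. -/
def MaxClique (G : SimpleGraph V) (A : Set V) : Type _ :=
  {w : Set V // Maximal (fun s => s ⊆ A ∧ G.IsClique s) w}

/-- Vertices of augmented graphs: vertices of `X` and projection vertices `b_F`. -/
inductive AugVertex (V : Type*) : Type _
  | vert : V → AugVertex V
  | proj : Set V → AugVertex V

/-- The vertices of `CF`: those of `F`, and `b_H` for the domains `H` properly contained in `F`. -/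
def augVerts (𝔉 : Set (Set V)) (F : Set V) : Set (AugVertex V) :=
  {a | match a with
    | .vert v => v ∈ F
    | .proj H => H ∈ 𝔉 ∧ H ⊂ F}

/-- The adjacency of the augmented graph of the subgraph of `G` induced on `A` that carries the
`A`-graph `WA`: edges of `G`, additional edges between vertices of `WA`-adjacent maximal cliques of
`A`, and edges from `b_H` to the vertices of `H`. The augmented graph of `A`, and those of the
domains contained in `A`, are induced subgraphs of this graph on sets `augVerts 𝔉 F`. -/
def augGraph (G : SimpleGraph V) {A : Set V} (WA : SimpleGraph (MaxClique G A)) :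
    SimpleGraph (AugVertex V) :=
  SimpleGraph.fromRel fun a b =>
    match a, b with
    | .vert v, .vert w => G.Adj v w ∨ ∃ x y : MaxClique G A, WA.Adj x y ∧ v ∈ x.1 ∧ w ∈ y.1
    | .vert v, .proj H => v ∈ H
    | _, _ => False

/-- The projection part `PF`: the vertices of `F^⊥ = lk(F)`, the `b_H` with `H ⊆ F^⊥`, and
the `b_H` with `F ⊆ H ≠ X`. -/
def projPart (G : SimpleGraph V) (𝔉 : Set (Set V)) (F : Set V) : Set (AugVertex V) :=
  {a | match a with
    | .vert v => v ∈ link G F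
    | .proj H => H ∈ 𝔉 ∧ (H ⊆ link G F ∨ (F ⊆ H ∧ H ≠ Set.univ))}

/-- The vertices of the complement graph `Y_F`: those of `CX` outside `PF`. -/
def compVerts (G : SimpleGraph V) (𝔉 : Set (Set V)) (F : Set V) : Set (AugVertex V) :=
  augVerts 𝔉 Set.univ \ projPart G 𝔉 F

section Triple

variable (G : SimpleGraph V) (W : SimpleGraph (MaxClique G Set.univ)) (𝔉 : Set (Set V))

/-- The augmented graph `CF` of a domain, as a space. -/
abbrev AugSpace (F : Set V) : Type _ := ↥(realization (augGraph G W) (augVerts 𝔉 F))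

/-- The path metric of `CF`. -/
noncomputable def augDist (F : Set V) (x y : AugSpace G W 𝔉 F) : ℝ :=
  realizationDist (augGraph G W) (augVerts 𝔉 F) x.1 y.1

/-- The path metric of `Y_F`. -/
noncomputable def compDist (F : Set V) (x y : AugVertex V → ℝ) : ℝ :=
  realizationDist (augGraph G W) (compVerts G 𝔉 F) x y

/-- The `δ`-hyperbolicity condition: each `CF` is `δ`-hyperbolic, and its inclusion into `Y_F`
is a `(δ, δ)`-quasi-isometric embedding. -/
structure HyperbolicityCondition (δ : ℝ) : Prop where
  pos : 0 < δ
  hyperbolic : ∀ F ∈ 𝔉, IsHyperbolic δ (augDist G W 𝔉 F)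
  qi_embedded : ∀ F ∈ 𝔉, ∀ x y : AugSpace G W 𝔉 F,
    augDist G W 𝔉 F x y / δ - δ ≤ compDist G W 𝔉 F x.1 y.1 ∧
      compDist G W 𝔉 F x.1 y.1 ≤ δ * augDist G W 𝔉 F x y + δ

/-- The hierarchy condition. The domains carry graphs `W^F`, with `W^X = W`, such that for domains
`F' ⊆ F` the augmented graphs of `F'` computed in `F` and in `X` coincide, and for each maximal
clique `x` of `lk(F') ∩ F` some choice of maximal cliques of `F` containing `x * w`, for the maximal
cliques `w` of `F'`, is a graph map from `W^F'` to `W^F`. -/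
def HierarchyCondition : Prop :=
  ∃ Wf : ∀ F : Set V, SimpleGraph (MaxClique G F), Wf Set.univ = W ∧
    ∀ F ∈ 𝔉, ∀ F' ∈ 𝔉, F' ⊆ F →
      (augGraph G (Wf F)).induce (augVerts 𝔉 F') = (augGraph G W).induce (augVerts 𝔉 F') ∧
      ∀ x : MaxClique G (link G F' ∩ F), ∃ f : Wf F' →g Wf F,
        ∀ w : MaxClique G F', x.1 ∪ w.1 ⊆ (f w).1

/-- `(X, W, 𝔉)` is a combinatorial HHS with factor system, with constants `n` and `δ`. -/
structure IsCHHF (n : ℕ) (δ : ℝ) : Prop where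
  factorSystem : IsFactorSystem n G 𝔉
  hyperbolicity : HyperbolicityCondition G W 𝔉 δ
  hierarchy : HierarchyCondition G W 𝔉

/-- The coarse closest point projection `p_F` from `Y_F` to `CF`,
`p_F(x) = {y ∈ CF | d_{Y_F}(x, y) ≤ d_{Y_F}(x, CF) + 1}`. -/
def closestPoint (F : Set V) (x : AugVertex V → ℝ) : Set (AugSpace G W 𝔉 F) :=
  {y | compDist G W 𝔉 F x y.1 ≤ (⨅ z : AugSpace G W 𝔉 F, compDist G W 𝔉 F x z.1) + 1}

/-- `p_F` of a set of vertices. -/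
def closestPointVerts (F : Set V) (A : Set (AugVertex V)) : Set (AugSpace G W 𝔉 F) :=
  ⋃ a ∈ A, closestPoint G W 𝔉 F (vertexPoint a)

/-- The projection `π_F` of a maximal clique `w`: the vertices of `w` if `F = X`, and
`p_F(w ∩ Y_F)` otherwise. -/
def cliqueProj (F : Set V) (w : MaxClique G Set.univ) : Set (AugSpace G W 𝔉 F) :=
  {y | (F = Set.univ ∧ ∃ v ∈ w.1, y.1 = vertexPoint (AugVertex.vert v)) ∨
    (F ≠ Set.univ ∧
      y ∈ closestPointVerts G W 𝔉 F (AugVertex.vert '' w.1 ∩ compVerts G 𝔉 F))}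

/-- The proto-hierarchy data of `(W, 𝔉)`. The space is the realization of `W`; the projection of an
interior point of an edge is the union of the projections of the endpoints. -/
noncomputable def protoData : ProtoData ↥(realization W Set.univ) ↥𝔉 (fun F => AugSpace G W 𝔉 F.1) where
  dX p q := realizationDist W Set.univ p.1 q.1
  dC F := augDist G W 𝔉 F.1
  proj F p := ⋃ w ∈ Function.support p.1, cliqueProj G W 𝔉 F.1 w
  nest F F' := F.1 ⊆ F'.1
  orth F F' := F'.1 ⊆ link G F.1
  rel F F' := closestPointVerts G W 𝔉 F'.1 (projPart G 𝔉 F.1 ∩ compVerts G 𝔉 F'.1)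
  relMap _ F x := {y | x.1 ∈ realization (augGraph G W) (compVerts G 𝔉 F.1) ∧
    y ∈ closestPoint G W 𝔉 F.1 x.1}

end Triple

end CHHF

/-! The heart of the matter is one estimate: the coarse closest-point projection from Y_F to CF is
coarsely Lipschitz, with constants depending on n and δ only (`exists_almostClosest_lipschitz`).
Granted this, the bounds on π and ρ are short. No maximal clique of X lies in lk(F), so a path in W
can be followed by vertices of Y_F, and π_F is Lipschitz (`cliqueProj_lipschitz`). The part of PF
lying in Y_F' is within distance 2 of any vertex of F outside lk(F'), so its projection is bounded
(`rel_bound`). A point of CF' outside Y_F is close to a vertex of PF, hence to ρ^F_F'. Connectedness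
of W comes from the hierarchy condition by induction on the length of chains of domains
(`preconnected_of_hierarchy`).

For F = X the estimate is immediate, as Y_X = CX. Otherwise Y_F is reached from CX by deleting
vertices while keeping hyperbolicity. Deleting lk(F) and the b_L with L ⊆ lk(F) changes distances by
a bounded amount only, since all neighbours of the deleted part are close to one fixed vertex of F
(`reachLE_of_adj_link`). Then the b_L with F ⊆ L ≠ X are deleted, those of largest rank first. When
b_L is deleted, the larger domains are already gone, so the graph without b_L lies in Y_L and the
trimmed CL is quasi-isometrically embedded in it. Thus each stage removes cone points over
hyperbolic, undistorted subgraphs, and at most n stages are needed (`isConed_layer`,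
`exists_hypOn_layer`). The process stops with b_F still present. In that hyperbolic graph the
projection to CF agrees, up to bounded error, with the last vertex before b_F on a geodesic to b_F,
and the entry points of adjacent vertices are close (`HypOn.entry_lipschitz`).

Removing cone points preserves hyperbolicity (`exists_hypOn_of_isConed`) by guessing geodesics: in a
geodesic of the coned graph each passage through a cone point b is replaced by a geodesic of the
subgraph under b. The resulting sets form slim triangles (`exists_deElectrified_slim`), and a
coarsely connected family with slim triangles forces hyperbolicity (`exists_hypOn_of_isGuess`). -/

namespace CHHF

universe u

/-! ### Distances, geodesics and hyperbolicity of induced subgraphs. -/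

section InducedDistance

variable {U : Type u} {H : SimpleGraph U} {S T : Set U}

/-- The path distance of the subgraph of `H` induced on `S`. -/
noncomputable def sd (H : SimpleGraph U) (S : Set U) (x y : U) : ℕ :=
  (H.induce S).spanningCoe.dist x y

/-- The subgraph of `H` induced on `S` is connected (or empty). -/
def ConnOn (H : SimpleGraph U) (S : Set U) : Prop :=
  ∀ x ∈ S, ∀ y ∈ S, (H.induce S).spanningCoe.Reachable x y

/-- `m` lies on a geodesic from `x` to `y` in the subgraph induced on `S`. -/
def Btw (H : SimpleGraph U) (S : Set U) (x m y : U) : Prop :=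
  m ∈ S ∧ sd H S x m + sd H S m y = sd H S x y

theorem adj_induce_iff {x y : U} :
    (H.induce S).spanningCoe.Adj x y ↔ x ∈ S ∧ y ∈ S ∧ H.Adj x y := by
  simp only [SimpleGraph.spanningCoe, SimpleGraph.map_adj, SimpleGraph.comap_adj,
    Function.Embedding.subtype_apply]
  constructor
  · rintro ⟨a, b, h, rfl, rfl⟩
    exact ⟨a.2, b.2, h⟩
  · rintro ⟨hx, hy, h⟩
    exact ⟨⟨x, hx⟩, ⟨y, hy⟩, h, rfl, rfl⟩

@[simp] theorem sd_self (x : U) : sd H S x x = 0 := SimpleGraph.dist_self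

theorem sd_comm (x y : U) : sd H S x y = sd H S y x := SimpleGraph.dist_comm

theorem sd_triangle (hc : ConnOn H S) {x y : U} (hx : x ∈ S) (hy : y ∈ S) (z : U) :
    sd H S x z ≤ sd H S x y + sd H S y z :=
  (hc x hx y hy).dist_triangle_left z

theorem eq_of_sd_eq_zero (hc : ConnOn H S) {x y : U} (hx : x ∈ S) (hy : y ∈ S)
    (h : sd H S x y = 0) : x = y :=
  (hc x hx y hy).dist_eq_zero_iff.1 h

theorem sd_eq_one {x y : U} (hx : x ∈ S) (hy : y ∈ S) (h : H.Adj x y) : sd H S x y = 1 :=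
  SimpleGraph.dist_eq_one_iff_adj.2 (adj_induce_iff.2 ⟨hx, hy, h⟩)

theorem adj_of_sd_eq_one {x y : U} (h : sd H S x y = 1) : x ∈ S ∧ y ∈ S ∧ H.Adj x y :=
  adj_induce_iff.1 (SimpleGraph.dist_eq_one_iff_adj.1 h)

theorem sd_le_one {x y : U} (hx : x ∈ S) (hy : y ∈ S) (h : x = y ∨ H.Adj x y) :
    sd H S x y ≤ 1 := by
  rcases h with rfl | h
  · simp
  · exact (sd_eq_one hx hy h).le

theorem induce_mono (h : S ⊆ T) : (H.induce S).spanningCoe ≤ (H.induce T).spanningCoe := by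
  intro x y hxy
  obtain ⟨hx, hy, hxy⟩ := adj_induce_iff.1 hxy
  exact adj_induce_iff.2 ⟨h hx, h hy, hxy⟩

theorem sd_anti (h : S ⊆ T) (hc : ConnOn H S) {x y : U} (hx : x ∈ S) (hy : y ∈ S) :
    sd H T x y ≤ sd H S x y :=
  SimpleGraph.Reachable.dist_anti (induce_mono h) (hc x hx y hy)

/-- A sequence of vertices of `S` with consecutive ones adjacent or equal bounds distances. -/
theorem sd_le_of_path {γ : ℕ → U} {n : ℕ} (hS : ∀ i ≤ n, γ i ∈ S)
    (hadj : ∀ i < n, γ i = γ (i + 1) ∨ H.Adj (γ i) (γ (i + 1))) :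
    (H.induce S).spanningCoe.Reachable (γ 0) (γ n) ∧ sd H S (γ 0) (γ n) ≤ n := by
  induction n with
  | zero => exact ⟨SimpleGraph.Reachable.refl _, by simp⟩
  | succ n ih =>
    obtain ⟨h1, h2⟩ := ih (fun i hi => hS i (by omega)) (fun i hi => hadj i (by omega))
    rcases hadj n (by omega) with h | h
    · rw [← h]; exact ⟨h1, by omega⟩
    · have h' := adj_induce_iff.2 ⟨hS n (by omega), hS (n + 1) le_rfl, h⟩
      refine ⟨h1.trans h'.reachable, ?_⟩
      have := h1.dist_triangle_left (γ (n + 1))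
      have h3 := sd_eq_one (hS n (by omega)) (hS (n + 1) le_rfl) h
      unfold sd at *
      omega

theorem exists_geodesic (hc : ConnOn H S) {x y : U} (hx : x ∈ S) (hy : y ∈ S) :
    ∃ γ : ℕ → U, γ 0 = x ∧ γ (sd H S x y) = y ∧ (∀ i, γ i ∈ S) ∧
      (∀ i j, i ≤ j → j ≤ sd H S x y → sd H S (γ i) (γ j) = j - i) ∧
      ∀ i < sd H S x y, H.Adj (γ i) (γ (i + 1)) := by
  obtain ⟨p, hp⟩ := (hc x hx y hy).exists_walk_length_eq_dist
  change p.length = sd H S x y at hp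
  have hadj : ∀ i < sd H S x y, (H.induce S).spanningCoe.Adj (p.getVert i) (p.getVert (i + 1)) :=
    fun i hi => p.adj_getVert_succ (by omega)
  have hS : ∀ i, p.getVert i ∈ S := by
    intro i
    rcases lt_or_ge i (sd H S x y) with h | h
    · exact (adj_induce_iff.1 (hadj i h)).1
    · rw [p.getVert_of_length_le (by omega)]; exact hy
  have hle : ∀ i j, i ≤ j → j ≤ sd H S x y → sd H S (p.getVert i) (p.getVert j) ≤ j - i := by
    intro i j hij hj
    have := (sd_le_of_path (H := H) (S := S) (γ := fun k => p.getVert (i + k)) (n := j - i)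
      (fun k _ => hS _)
      (fun k hk => Or.inr (adj_induce_iff.1 (hadj (i + k) (by omega))).2.2)).2
    simpa [Nat.add_sub_cancel' hij] using this
  have hend : p.getVert (sd H S x y) = y := by rw [← hp]; exact p.getVert_length
  refine ⟨p.getVert, p.getVert_zero, hend, hS, fun i j hij hj => le_antisymm (hle i j hij hj) ?_,
    fun i hi => (adj_induce_iff.1 (hadj i hi)).2.2⟩
  have h1 := hle 0 i (by omega) (by omega)
  have h2 := hle j _ hj le_rfl
  rw [p.getVert_zero] at h1
  rw [hend] at h2
  have h3 := sd_triangle hc hx (hS i) y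
  have h4 := sd_triangle hc (hS i) (hS j) y
  omega

theorem exists_btw (hc : ConnOn H S) {x y : U} (hx : x ∈ S) (hy : y ∈ S) {k : ℕ}
    (hk : k ≤ sd H S x y) :
    ∃ m ∈ S, sd H S x m = k ∧ sd H S m y = sd H S x y - k := by
  obtain ⟨γ, h0, h1, hS, hd, -⟩ := exists_geodesic hc hx hy
  refine ⟨γ k, hS k, ?_, ?_⟩
  · rw [← h0, hd 0 k (by omega) hk]; omega
  · conv_lhs => rw [← h1]
    rw [hd k _ hk le_rfl]

/-- A property that changes along `0, …, n` changes at some step. -/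
theorem exists_step {P : ℕ → Prop} {n : ℕ} (h0 : P 0) (hn : ¬ P n) :
    ∃ i < n, P i ∧ ¬ P (i + 1) := by
  by_contra! h
  have : ∀ i ≤ n, P i := by
    intro i
    induction i with
    | zero => exact fun _ => h0
    | succ i ih => exact fun hi => h i (by omega) (ih (by omega))
  exact hn (this n le_rfl)

/-- A geodesic that avoids `b` is a path in the subgraph without `b`. -/
theorem sd_diff_singleton_le (hc : ConnOn H S) {x y b : U} (hx : x ∈ S) (hy : y ∈ S) (hb : b ∈ S)
    (h : sd H S x y < sd H S x b + sd H S b y) : sd H (S \ {b}) x y ≤ sd H S x y := by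
  obtain ⟨γ, h0, h1, hS, hd, hadj⟩ := exists_geodesic hc hx hy
  have hne : ∀ i ≤ sd H S x y, γ i ≠ b := by
    rintro i hi rfl
    have e1 := hd 0 i (by omega) hi
    have e2 := hd i _ hi le_rfl
    rw [h0] at e1
    rw [h1] at e2
    omega
  have := (sd_le_of_path (H := H) (S := S \ {b}) (γ := γ) (n := sd H S x y)
    (fun i hi => ⟨hS i, hne i hi⟩) (fun i hi => Or.inr (hadj i hi))).2
  rwa [h0, h1] at this

/-- A subset through which distances are at most those of `S`, up to a constant, is Lipschitz. -/
theorem lipschitz_of_adj (hc : ConnOn H S) {f : U → U → ℕ} {K : ℕ}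
    (htri : ∀ x ∈ S, ∀ y ∈ S, ∀ z ∈ S, f x z ≤ f x y + f y z)
    (hself : ∀ x ∈ S, f x x = 0)
    (hadj : ∀ x ∈ S, ∀ y ∈ S, H.Adj x y → f x y ≤ K) {x y : U} (hx : x ∈ S) (hy : y ∈ S) :
    f x y ≤ K * sd H S x y := by
  obtain ⟨γ, h0, h1, hS, -, hγ⟩ := exists_geodesic hc hx hy
  have : ∀ i ≤ sd H S x y, f x (γ i) ≤ K * i := by
    intro i
    induction i with
    | zero => intro _; rw [h0, hself x hx]; omega
    | succ i ih =>
      intro hi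
      have e1 := ih (by omega)
      have e2 := hadj _ (hS i) _ (hS (i + 1)) (hγ i (by omega))
      have e3 := htri x hx _ (hS i) _ (hS (i + 1))
      rw [Nat.mul_succ]
      omega
  simpa [h1] using this _ le_rfl

/-- Gromov's four-point condition for the vertices of the connected induced subgraph on `S`. -/
structure HypOn (H : SimpleGraph U) (S : Set U) (δ : ℕ) : Prop where
  conn : ConnOn H S
  four_point : ∀ x ∈ S, ∀ y ∈ S, ∀ z ∈ S, ∀ w ∈ S,
    sd H S x z + sd H S y w ≤ max (sd H S x y + sd H S z w) (sd H S y z + sd H S x w) + δ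

theorem Btw.symm {x m y : U} (h : Btw H S x m y) : Btw H S y m x :=
  ⟨h.1, by rw [sd_comm y m, sd_comm m x, sd_comm y x]; have := h.2; omega⟩

theorem btw_left {x : U} (hx : x ∈ S) (y : U) : Btw H S x x y := ⟨hx, by simp⟩

theorem btw_right (x : U) {y : U} (hy : y ∈ S) : Btw H S x y y := ⟨hy, by simp⟩

theorem Btw.trans_left (hc : ConnOn H S) {x m y a : U} (hx : x ∈ S)
    (h : Btw H S x m y) (h' : Btw H S x a m) : Btw H S x a y := by
  refine ⟨h'.1, ?_⟩
  have h1 := h.2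
  have h2 := h'.2
  have h3 := sd_triangle hc hx h'.1 y
  have h4 := sd_triangle hc h'.1 h.1 y
  omega

theorem Btw.trans_right (hc : ConnOn H S) {x m y a : U} (hx : x ∈ S)
    (h : Btw H S x m y) (h' : Btw H S m a y) : Btw H S x a y := by
  refine ⟨h'.1, ?_⟩
  have h1 := h.2
  have h2 := h'.2
  have h3 := sd_triangle hc hx h'.1 y
  have h4 := sd_triangle hc hx h.1 a
  omega

/-- Triangles in hyperbolic graphs are slim. -/
theorem HypOn.slim {δ : ℕ} (h : HypOn H S δ) {x y z p : U} (hx : x ∈ S) (hy : y ∈ S) (hz : z ∈ S)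
    (hp : Btw H S x p y) : ∃ q, (Btw H S x q z ∨ Btw H S z q y) ∧ sd H S p q ≤ 2 * δ := by
  obtain ⟨hpS, hp⟩ := hp
  -- The four-point condition makes the detour from an endpoint to z through p short for one of the
  -- two endpoints. The comparison point then lies on that side, as far from the endpoint as p.
  have key : ∀ x ∈ S, ∀ y ∈ S, sd H S x p + sd H S p y = sd H S x y →
      sd H S p z + sd H S x p ≤ sd H S x z + δ →
      ∃ q, Btw H S x q z ∧ sd H S p q ≤ 2 * δ := by
    intro x hx y hy hp hle
    obtain ⟨q, hq, h1, h2⟩ := exists_btw h.conn hx hz (k := min (sd H S x p) (sd H S x z))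
      (min_le_right _ _)
    refine ⟨q, ⟨hq, by omega⟩, ?_⟩
    have h3 := h.four_point p hpS x hx q hq z hz
    rw [sd_comm p x] at h3
    omega
  have h1 := h.four_point p hpS x hx z hz y hy
  rw [sd_comm p x] at h1
  rcases le_total (sd H S x p + sd H S z y) (sd H S x z + sd H S p y) with h2 | h2
  · obtain ⟨q, hq, hd⟩ := key x hx y hy hp (by omega)
    exact ⟨q, Or.inl hq, hd⟩
  · have e1 := sd_comm (H := H) (S := S) y p
    have e2 := sd_comm (H := H) (S := S) x p
    have e3 := sd_comm (H := H) (S := S) x y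
    have e4 := sd_comm (H := H) (S := S) z y
    obtain ⟨q, hq, hd⟩ := key y hy x hx (by rw [sd_comm p x]; omega) (by omega)
    exact ⟨q, Or.inr hq.symm, hd⟩

/-- Slim triangles imply the four-point condition. -/
theorem hypOn_of_slim (hc : ConnOn H S) {δ : ℕ}
    (h : ∀ x ∈ S, ∀ y ∈ S, ∀ z ∈ S, ∀ p, Btw H S x p y →
      ∃ q, (Btw H S x q z ∨ Btw H S z q y) ∧ sd H S p q ≤ δ) : HypOn H S (4 * δ + 4) := by
  refine ⟨hc, fun x hx y hy z hz w hw => ?_⟩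
  obtain ⟨γ, h0, h1, hS, hd, -⟩ := exists_geodesic hc hx hz
  have hbtw : ∀ i ≤ sd H S x z, Btw H S x (γ i) z := by
    intro i hi
    have e1 := hd 0 i (by omega) hi
    have e2 := hd i _ hi le_rfl
    rw [h0] at e1
    rw [h1] at e2
    exact ⟨hS i, by omega⟩
  -- Some point of the chosen geodesic is within δ + 1 of both other sides of the triangle x, z, v:
  -- the last one before the points stop being close to the side x, v.
  have key : ∀ v ∈ S, ∃ i ≤ sd H S x z,
      sd H S x (γ i) + sd H S (γ i) v ≤ sd H S x v + 2 * (δ + 1) ∧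
      sd H S v (γ i) + sd H S (γ i) z ≤ sd H S v z + 2 * (δ + 1) := by
    intro v hv
    have near : ∀ a ∈ S, ∀ b ∈ S, ∀ p ∈ S, ∀ q, Btw H S a q b → sd H S p q ≤ δ + 1 →
        sd H S a p + sd H S p b ≤ sd H S a b + 2 * (δ + 1) := by
      intro a ha b hb p hp q hq hpq
      have e1 := sd_triangle hc ha hq.1 p
      have e2 := sd_triangle hc hp hq.1 b
      have e3 := hq.2
      rw [sd_comm q p] at e1
      omega
    by_cases hall : ∀ i ≤ sd H S x z, ∃ q, Btw H S x q v ∧ sd H S (γ i) q ≤ δ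
    · obtain ⟨q, hq, hle⟩ := hall _ le_rfl
      refine ⟨sd H S x z, le_rfl, near x hx v hv _ (hS _) q hq (by omega), ?_⟩
      rw [h1]; simp
    · have hx0 : ∃ q, Btw H S x q v ∧ sd H S (γ 0) q ≤ δ :=
        ⟨x, btw_left hx v, by rw [h0]; simp⟩
      push Not at hall
      obtain ⟨j, hj, hjn⟩ := hall
      obtain ⟨i, hi, ⟨q, hq, hqd⟩, hn⟩ := exists_step
        (P := fun i => ∃ q, Btw H S x q v ∧ sd H S (γ i) q ≤ δ) (n := j) hx0
        (by rintro ⟨q, hq, hqd⟩; exact absurd (hjn q hq) (by omega))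
      refine ⟨i, by omega, near x hx v hv _ (hS _) q hq (by omega), ?_⟩
      obtain ⟨q', hq', hqd'⟩ := h x hx z hz v hv _ (hbtw (i + 1) (by omega))
      rcases hq' with hq' | hq'
      · exact absurd ⟨q', hq', hqd'⟩ hn
      · refine near v hv z hz _ (hS _) q' hq' ?_
        have e1 := sd_triangle hc (hS i) (hS (i + 1)) q'
        have e2 := hd i (i + 1) (by omega) (by omega)
        omega
  obtain ⟨i, hi, a1, a2⟩ := key y hy
  obtain ⟨j, hj, b1, b2⟩ := key w hw
  have ei := (hbtw i hi).2
  have ej := (hbtw j hj).2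
  have xi := hd 0 i (by omega) hi
  have xj := hd 0 j (by omega) hj
  rw [h0] at xi xj
  have t1 := sd_triangle hc hy (hS i) w
  have t2 := sd_triangle hc (hS i) (hS j) w
  have c1 := sd_comm (H := H) (S := S) (γ i) y
  have c2 := sd_comm (H := H) (S := S) (γ j) w
  have c3 := sd_comm (H := H) (S := S) z w
  -- The order of the two points on the geodesic decides which of the two sums in the maximum is the
  -- bound. Each point contributes an error of 2(δ + 1).
  rcases le_total i j with hij | hij
  · have := hd i j hij hj
    omega
  · have := hd j i hij hi
    rw [sd_comm] at this
    omega

end InducedDistance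

/-! ### The criterion of guessing geodesics. -/

theorem mul_succ_le_two_pow {C k : ℕ} (hk : 2 * C ≤ k) : C * (k + 1) ≤ 2 ^ k := by
  have base : C * (2 * C + 1) ≤ 2 ^ (2 * C) := by
    induction C with
    | zero => simp
    | succ C ih =>
      rcases Nat.eq_zero_or_pos C with rfl | hC
      · norm_num
      · have := ih (by omega)
        rw [show 2 * (C + 1) = 2 * C + 2 by ring, pow_add]
        nlinarith
  induction k, hk using Nat.le_induction with
  | base => exact base
  | succ k hk ih =>
    rw [pow_succ]
    nlinarith

/-- Logarithms grow slower than linear functions. -/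
theorem exists_log_bound (h : ℕ) :
    ∃ T, 2 * h ≤ T ∧ ∀ t > T, ∃ k, 2 * (T + 2 * h + t + 1) ≤ 2 ^ k ∧ 2 * h + h * (k + 1) < t := by
  -- For t > T the left side 2(T + 2h + t + 1) is at most 6t, and t < 2(h + 1)(k + 1) for the chosen
  -- k, so it is at most C(k + 1). The summand 6h of T serves the second inequality, where hk is at
  -- most t / 2.
  set C := 12 * (h + 1) with hC
  refine ⟨2 * (h + 1) * (2 * C) + 6 * h, by omega, fun t ht => ⟨t / (2 * (h + 1)), ?_, ?_⟩⟩
  · set k := t / (2 * (h + 1)) with hk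
    have h1 : 2 * C ≤ k := by
      rw [hk, Nat.le_div_iff_mul_le (by omega)]
      nlinarith
    have h2 := mul_succ_le_two_pow h1
    have h3 : t < 2 * (h + 1) * (k + 1) := by
      rw [hk]; exact Nat.lt_mul_div_succ t (by omega)
    have h4 : C * (k + 1) = 6 * (2 * (h + 1) * (k + 1)) := by rw [hC]; ring
    omega
  · have h1 : 2 * (h + 1) * (t / (2 * (h + 1))) ≤ t := Nat.mul_div_le _ _
    have h2 : 2 * (h * (t / (2 * (h + 1)))) ≤ 2 * (h + 1) * (t / (2 * (h + 1))) := by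
      rw [← mul_assoc]; exact Nat.mul_le_mul_right _ (by omega)
    rw [mul_add]
    omega

section Guessing

variable {U : Type u} {H : SimpleGraph U} {S : Set U}

/-- A family of coarsely connected sets `L x y` forming slim triangles. -/
structure IsGuess (H : SimpleGraph U) (S : Set U) (L : U → U → Set U) (h : ℕ) : Prop where
  subset : ∀ x ∈ S, ∀ y ∈ S, L x y ⊆ S
  right_mem : ∀ x ∈ S, ∀ y ∈ S, y ∈ L x y
  slim : ∀ x ∈ S, ∀ y ∈ S, ∀ z ∈ S, ∀ p ∈ L x y, ∃ q, (q ∈ L x z ∨ q ∈ L z y) ∧ sd H S p q ≤ h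
  near : ∀ x ∈ S, ∀ y ∈ S, sd H S x y ≤ 1 → ∀ p ∈ L x y, sd H S x p ≤ h
  conn : ∀ x ∈ S, ∀ y ∈ S, ∀ A : Set U, x ∈ A → y ∉ A →
    ∃ p ∈ L x y, ∃ q ∈ L x y, p ∈ A ∧ q ∉ A ∧ sd H S p q ≤ 1

/-- Bisecting a geodesic and applying slimness costs h per halving, so the error is logarithmic in
the distance. -/
theorem IsGuess.log_close {L : U → U → Set U} {h : ℕ} (hL : IsGuess H S L h) (hc : ConnOn H S)
    (k : ℕ) : ∀ x ∈ S, ∀ y ∈ S, sd H S x y ≤ 2 ^ k → ∀ p ∈ L x y,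
      ∃ q, Btw H S x q y ∧ sd H S p q ≤ h * (k + 1) := by
  induction k with
  | zero =>
    intro x hx y hy hd p hp
    refine ⟨x, btw_left hx y, ?_⟩
    rw [sd_comm]
    simpa using hL.near x hx y hy (by simpa using hd) p hp
  | succ k ih =>
    intro x hx y hy hd p hp
    obtain ⟨m, hm, h1, h2⟩ := exists_btw hc hx hy (k := min (2 ^ k) (sd H S x y))
      (min_le_right _ _)
    rw [pow_succ] at hd
    have hxm : Btw H S x m y := ⟨hm, by omega⟩
    have hpS := hL.subset x hx y hy hp
    obtain ⟨p', hp', hpp⟩ := hL.slim x hx y hy m hm p hp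
    rcases hp' with hp' | hp'
    · obtain ⟨q, hq, hqd⟩ := ih x hx m hm (by omega) p' hp'
      refine ⟨q, hxm.trans_left hc hx hq, ?_⟩
      have := sd_triangle hc hpS (hL.subset x hx m hm hp') q
      rw [Nat.mul_succ h (k + 1)]
      omega
    · obtain ⟨q, hq, hqd⟩ := ih m hm y hy (by omega) p' hp'
      refine ⟨q, hxm.trans_right hc hx hq, ?_⟩
      have := sd_triangle hc hpS (hL.subset m hm y hy hp') q
      rw [Nat.mul_succ h (k + 1)]
      omega

/-- Removes the logarithm. If p is at distance t > T from the geodesics, cut out a window x', y'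
around a nearest point q. By slimness p is within 2h of the guess for the window or for an outer
piece. An outer piece is shorter, so by induction p would be close to a geodesic point too far from
q; the window has length linear in t, so the logarithmic bound contradicts the choice of t. -/
theorem IsGuess.close {L : U → U → Set U} {h T : ℕ} (hL : IsGuess H S L h) (hc : ConnOn H S)
    (hT : 2 * h ≤ T)
    (hT' : ∀ t > T, ∃ k, 2 * (T + 2 * h + t + 1) ≤ 2 ^ k ∧ 2 * h + h * (k + 1) < t) (N : ℕ) :
    ∀ x ∈ S, ∀ y ∈ S, sd H S x y = N → ∀ p ∈ L x y,
      ∃ q, Btw H S x q y ∧ sd H S p q ≤ T := by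
  classical
  induction N using Nat.strong_induction_on with
  | _ N ih =>
  intro x hx y hy hN p hp
  have hpS := hL.subset x hx y hy hp
  have hex : ∃ t, ∃ q, Btw H S x q y ∧ sd H S p q = t := ⟨_, x, btw_left hx y, rfl⟩
  obtain ⟨q, hq, hqt⟩ := Nat.find_spec hex
  have hmin : ∀ q, Btw H S x q y → Nat.find hex ≤ sd H S p q :=
    fun q hq => Nat.find_min' hex ⟨q, hq, rfl⟩
  set t := Nat.find hex with ht
  by_contra! hcon
  have htT : T < t := by rw [← hqt]; exact hcon q hq
  obtain ⟨k, hk1, hk2⟩ := hT' t htT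
  obtain ⟨hqS, hqd⟩ := hq
  -- The window radius T + 2h + t + 1 just exceeds t + 2h + T, the largest distance from q of a
  -- geodesic point that is T-close to a point within 2h of p.
  obtain ⟨x', hx', hx1, hx2⟩ := exists_btw hc hx hqS
    (k := sd H S x q - min (T + 2 * h + t + 1) (sd H S x q)) (by omega)
  obtain ⟨y', hy', hy1, hy2⟩ := exists_btw hc hqS hy
    (k := min (T + 2 * h + t + 1) (sd H S q y)) (by omega)
  have bx : Btw H S x x' q := ⟨hx', by omega⟩
  have bq : Btw H S x q y := ⟨hqS, hqd⟩
  have by' : Btw H S q y' y := ⟨hy', by omega⟩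
  have bx' := bq.trans_left hc hx bx
  have byy := bq.trans_right hc hx by'
  have hx'y' := sd_triangle hc hx' hqS y'
  have b2 : Btw H S x' y' y := by
    refine ⟨hy', ?_⟩
    have e1 := sd_triangle hc hx' hy' y
    have e2 := byy.2
    have e3 := bx'.2
    have e4 := sd_triangle hc hx hx' y'
    omega
  have qq := sd_comm (H := H) (S := S) q
  have left : ∀ p' ∈ L x x', sd H S p p' ≤ 2 * h → False := by
    intro p' hp' hd
    have hpS' := hL.subset x hx x' hx' hp'
    by_cases hR : T + 2 * h + t + 1 < sd H S x q
    · obtain ⟨q', hq', hqd'⟩ := ih (sd H S x x') (by omega) x hx x' hx' rfl p' hp'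
      have e1 := sd_triangle hc hpS hpS' q'
      have hle := hmin q' (bx'.trans_left hc hx hq')
      have e2 := sd_triangle hc hx hq'.1 q
      have e3 := hq'.2
      have e4 := sd_triangle hc hq'.1 hpS q
      rw [sd_comm q' p] at e4
      have : sd H S p p' ≤ h ∨ h < sd H S p p' := le_or_gt _ _
      omega
    -- The window is cut off at the endpoint, so x' = x and the outer guess stays within h of x.
    · have e0 := hL.near x hx x' hx' (by omega) p' hp'
      have e1 := sd_triangle hc hpS hpS' x
      rw [sd_comm p' x] at e1
      have e2 := hmin x (btw_left hx y)
      have : x = x' := eq_of_sd_eq_zero hc hx hx' (by omega)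
      have := hk2
      have : h ≤ h * (k + 1) := Nat.le_mul_of_pos_right _ (by omega)
      omega
  have right : ∀ p' ∈ L y' y, sd H S p p' ≤ 2 * h → False := by
    intro p' hp' hd
    have hpS' := hL.subset y' hy' y hy hp'
    by_cases hR : T + 2 * h + t + 1 < sd H S q y
    · obtain ⟨q', hq', hqd'⟩ := ih (sd H S y' y) (by omega) y' hy' y hy rfl p' hp'
      have e1 := sd_triangle hc hpS hpS' q'
      have e2 := sd_triangle hc hqS hq'.1 y
      have e3 := hq'.2
      have e4 := sd_triangle hc hqS hpS q'
      rw [sd_comm q p] at e4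
      omega
    · have e0 := hL.near y' hy' y hy (by omega) p' hp'
      have e1 := sd_triangle hc hpS hpS' y
      have e2 := hmin y (btw_right x hy)
      have : y' = y := eq_of_sd_eq_zero hc hy' hy (by omega)
      subst this
      rw [sd_comm p' y'] at e1
      have : h ≤ h * (k + 1) := Nat.le_mul_of_pos_right _ (by omega)
      omega
  obtain ⟨p1, hp1, hd1⟩ := hL.slim x hx y hy x' hx' p hp
  rcases hp1 with hp1 | hp1
  · exact left p1 hp1 (by omega)
  · obtain ⟨p2, hp2, hd2⟩ := hL.slim x' hx' y hy y' hy' p1 hp1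
    have hp1S := hL.subset x' hx' y hy hp1
    have e1 := sd_triangle hc hpS hp1S p2
    rcases hp2 with hp2 | hp2
    · obtain ⟨q', hq', hqd'⟩ := hL.log_close hc k x' hx' y' hy' (by omega) p2 hp2
      have e2 := sd_triangle hc hpS (hL.subset x' hx' y' hy' hp2) q'
      have e3 := hmin q' (bx'.trans_right hc hx (b2.trans_left hc hx' hq'))
      omega
    · exact right p2 hp2 (by omega)

/-- A graph with a family of coarsely connected sets forming slim triangles is hyperbolic. -/
theorem exists_hypOn_of_isGuess (h : ℕ) : ∃ δ, ∀ {U : Type u} {H : SimpleGraph U} {S : Set U}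
    {L : U → U → Set U}, ConnOn H S → IsGuess H S L h → HypOn H S δ := by
  obtain ⟨T, hT, hT'⟩ := exists_log_bound h
  refine ⟨4 * (3 * (T + h) + 1 + h + T) + 4, fun {U H S L} hc hL => hypOn_of_slim hc ?_⟩
  have close : ∀ x ∈ S, ∀ y ∈ S, ∀ p ∈ L x y, ∃ q, Btw H S x q y ∧ sd H S p q ≤ T :=
    fun x hx y hy => hL.close hc hT hT' _ x hx y hy rfl
  intro x hx y hy z hz m hm
  have hmS := hm.1
  have hmd := hm.2
  have step : ∀ p ∈ L x y, (∃ a, Btw H S x a m ∧ sd H S p a ≤ T + h) ∨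
      (∃ a, Btw H S m a y ∧ sd H S p a ≤ T + h) := by
    intro p hp
    obtain ⟨q, hq, hd⟩ := hL.slim x hx y hy m hmS p hp
    have hpS := hL.subset x hx y hy hp
    rcases hq with hq | hq
    · obtain ⟨a, ha, had⟩ := close x hx m hmS q hq
      have := sd_triangle hc hpS (hL.subset x hx m hmS hq) a
      exact Or.inl ⟨a, ha, by omega⟩
    · obtain ⟨a, ha, had⟩ := close m hmS y hy q hq
      have := sd_triangle hc hpS (hL.subset m hmS y hy hq) a
      exact Or.inr ⟨a, ha, by omega⟩
  -- The converse inclusion: a point m of a geodesic is close to the guess. Each point of the guess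
  -- is near the part of a geodesic before m or after m, and where coarse connectedness forces a
  -- switch it is near both, hence near m.
  have hnear : ∃ p ∈ L x y, sd H S m p ≤ 3 * (T + h) + 1 := by
    have fin : ∀ p ∈ L x y, ∀ p' ∈ L x y, sd H S p p' ≤ 1 →
        ∀ a, Btw H S x a m → sd H S p a ≤ T + h → ∀ a', Btw H S m a' y → sd H S p' a' ≤ T + h →
        sd H S m p ≤ 3 * (T + h) + 1 := by
      intro p hp p' hp' hpp a ha had a' ha' had'
      have hpS := hL.subset x hx y hy hp
      have hpS' := hL.subset x hx y hy hp'
      have e1 := sd_triangle hc ha.1 hpS a'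
      have e2 := sd_triangle hc hpS hpS' a'
      have e3 := sd_triangle hc hx ha.1 y
      have e4 := sd_triangle hc ha.1 ha'.1 y
      have e5 := ha.2
      have e6 := ha'.2
      have e7 := sd_triangle hc hmS ha.1 p
      rw [sd_comm a p] at e1 e7
      rw [sd_comm m a] at e7
      omega
    by_cases hy' : ∃ a, Btw H S x a m ∧ sd H S y a ≤ T + h
    · obtain ⟨a, ha, had⟩ := hy'
      refine ⟨y, hL.right_mem x hx y hy, ?_⟩
      have e1 := sd_triangle hc hx ha.1 y
      have e2 := ha.2
      rw [sd_comm y a] at had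
      omega
    · obtain ⟨p, hp, p', hp', hpA, hpA', hpp⟩ := hL.conn x hx y hy
        {p | ∃ a, Btw H S x a m ∧ sd H S p a ≤ T + h} ⟨x, btw_left hx m, by simp⟩ hy'
      obtain ⟨a, ha, had⟩ := hpA
      rcases step p' hp' with h1 | ⟨a', ha', had'⟩
      · exact absurd h1 hpA'
      · exact ⟨p, hp, fin p hp p' hp' hpp a ha had a' ha' had'⟩
  obtain ⟨p, hp, hmp⟩ := hnear
  have hpS := hL.subset x hx y hy hp
  obtain ⟨q, hq, hpq⟩ := hL.slim x hx y hy z hz p hp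
  have e1 := sd_triangle hc hmS hpS q
  rcases hq with hq | hq
  · obtain ⟨a, ha, had⟩ := close x hx z hz q hq
    have e2 := sd_triangle hc hmS (hL.subset x hx z hz hq) a
    exact ⟨a, Or.inl ha, by omega⟩
  · obtain ⟨a, ha, had⟩ := close z hz y hy q hq
    have e2 := sd_triangle hc hmS (hL.subset z hz y hy hq) a
    exact ⟨a, Or.inr ha, by omega⟩

end Guessing

/-! ### Entry points of geodesics at a cone vertex. -/

section Entry

variable {U : Type u} {H : SimpleGraph U} {S : Set U} {b : U}

/-- `u` is the last vertex before `b` on a geodesic from `x` to `b`. -/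
def IsEntry (H : SimpleGraph U) (S : Set U) (b x u : U) : Prop :=
  u ∈ S ∧ H.Adj u b ∧ sd H S x u + 1 = sd H S x b

theorem exists_isEntry (hc : ConnOn H S) (hb : b ∈ S) {x : U} (hx : x ∈ S) (hxb : x ≠ b) :
    ∃ u, IsEntry H S b x u := by
  have h0 : sd H S x b ≠ 0 := fun h => hxb (eq_of_sd_eq_zero hc hx hb h)
  obtain ⟨u, hu, h1, h2⟩ := exists_btw hc hx hb (k := sd H S x b - 1) (by omega)
  exact ⟨u, hu, (adj_of_sd_eq_one (show sd H S u b = 1 by omega)).2.2, by omega⟩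

theorem IsEntry.mem_diff {x u : U} (h : IsEntry H S b x u) : u ∈ S \ {b} :=
  ⟨h.1, fun e => h.2.1.ne e⟩

theorem IsEntry.sd_le (hc : ConnOn H S) (hb : b ∈ S) {x u : U} (hx : x ∈ S)
    (h : IsEntry H S b x u) : sd H (S \ {b}) x u + 1 ≤ sd H S x b := by
  have h1 := sd_eq_one hb h.1 h.2.1.symm
  have h2 := h.2.2
  have := sd_diff_singleton_le hc hx h.1 hb (by omega)
  omega

/-- Points with large Gromov product with respect to `b` have close entry points. -/
theorem HypOn.entry_close_of_product {δ R : ℕ} (h : HypOn H S δ) (hb : b ∈ S)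
    (hc : ConnOn H (S \ {b})) {x y u v : U} (hx : x ∈ S) (hy : y ∈ S)
    (hR : δ < R) (hxy : 2 * R + sd H S x y ≤ sd H S x b + sd H S y b)
    (hu : IsEntry H S b x u) (hv : IsEntry H S b y v) :
    sd H (S \ {b}) u v ≤ 2 * R + 2 * δ := by
  have point : ∀ x u, x ∈ S → IsEntry H S b x u → R ≤ sd H S x b → ∃ p ∈ S \ {b},
      sd H S x p + R = sd H S x b ∧ sd H S p b = R ∧ sd H (S \ {b}) u p + 1 ≤ R := by
    intro x u hx hu hxR
    obtain ⟨huS, hub, hud⟩ := hu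
    obtain ⟨p, hp, h1, h2⟩ := exists_btw h.conn hx huS (k := sd H S x b - R) (by omega)
    have e1 := sd_triangle h.conn hp huS b
    have e2 := sd_triangle h.conn hx hp b
    have e3 := sd_eq_one huS hb hub
    have e4 : IsEntry H S b p u := ⟨huS, hub, by omega⟩
    have e5 := e4.sd_le h.conn hb hp
    rw [sd_comm] at e5
    refine ⟨p, ⟨hp, ?_⟩, by omega, by omega, by omega⟩
    rintro rfl
    have := sd_self (H := H) (S := S) p
    omega
  have t1 := sd_triangle h.conn hx hy b
  have t2 := sd_triangle h.conn hy hx b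
  have c1 := sd_comm (H := H) (S := S) y x
  obtain ⟨p, hp, p1, p2, p3⟩ := point x u hx hu (by omega)
  obtain ⟨q, hq, q1, q2, q3⟩ := point y v hy hv (by omega)
  have f1 := h.four_point p hp.1 x hx y hy b hb
  -- The points p and q at distance R from b are within 2δ < 2R of each other, so a geodesic between
  -- them misses b, and so do the pieces from p and q to the entry points.
  have f2 := h.four_point p hp.1 y hy q hq.1 b hb
  have c2 := sd_comm (H := H) (S := S) p x
  have c3 := sd_comm (H := H) (S := S) b q
  have pq : sd H S p q ≤ 2 * δ := by omega
  have := sd_diff_singleton_le h.conn hp.1 hq.1 hb (by omega)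
  have t3 := sd_triangle hc hu.mem_diff hp v
  have t4 := sd_triangle hc hp hq v
  rw [sd_comm q v] at t4
  omega

/-- On the geodesic avoiding b, stop δ + 1 + M before m. Since b is within M of m, that point and x
satisfy the Gromov product condition with R = δ + 1; the remaining way through m to v is short and
avoids b. -/
theorem HypOn.entry_close_of_near {δ M : ℕ} (h : HypOn H S δ) (hb : b ∈ S)
    (hc : ConnOn H (S \ {b})) {x m u v : U} (hx : x ∈ S \ {b}) (hm : m ∈ S \ {b})
    (hxm : sd H (S \ {b}) x m ≤ sd H S x m) (hM : sd H S m b ≤ M)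
    (hu : IsEntry H S b x u) (hv : IsEntry H S b m v) :
    sd H (S \ {b}) u v ≤ 6 * δ + 4 * M + 6 := by
  have hvm := hv.sd_le h.conn hb hm.1
  have hux := hu.sd_le h.conn hb hx.1
  have anti : ∀ a ∈ S \ {b}, ∀ c ∈ S \ {b}, sd H S a c ≤ sd H (S \ {b}) a c :=
    fun a ha c hc' => sd_anti Set.sdiff_subset hc ha hc'
  have t1 := sd_triangle hc hu.mem_diff hx v
  have t2 := sd_triangle hc hx hm v
  have c1 := sd_comm (H := H) (S := S \ {b}) u x
  have t3 := sd_triangle h.conn hx.1 hm.1 b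
  by_cases hk : sd H S x m ≤ δ + 1 + M
  · omega
  · obtain ⟨y, hy, y1, y2⟩ := exists_btw hc hx hm (k := sd H (S \ {b}) x m - (δ + 1 + M))
      (by omega)
    obtain ⟨w, hw⟩ := exists_isEntry h.conn hb hy.1 hy.2
    have hwy := hw.sd_le h.conn hb hy.1
    have a1 := anti x hx y hy
    have a2 := anti y hy m hm
    have a3 := anti x hx m hm
    have t4 := sd_triangle h.conn hx.1 hy.1 m
    have t5 := sd_triangle h.conn hy.1 hm.1 b
    have t6 := sd_triangle h.conn hx.1 hb m
    have t7 := sd_triangle h.conn hy.1 hb m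
    have c2 := sd_comm (H := H) (S := S) b m
    have := h.entry_close_of_product hb hc hx.1 hy.1 (R := δ + 1) (by omega) (by omega) hu hw
    have t8 := sd_triangle hc hu.mem_diff hw.mem_diff v
    have t9 := sd_triangle hc hw.mem_diff hy v
    have t10 := sd_triangle hc hy hm v
    have c3 := sd_comm (H := H) (S := S \ {b}) w y
    omega

/-- The endpoints of a geodesic avoiding `b` have close entry points. -/
theorem HypOn.entry_close {δ : ℕ} (h : HypOn H S δ) (hb : b ∈ S)
    (hc : ConnOn H (S \ {b})) {x y u v : U} (hx : x ∈ S \ {b}) (hy : y ∈ S \ {b})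
    (hxy : sd H (S \ {b}) x y ≤ sd H S x y)
    (hu : IsEntry H S b x u) (hv : IsEntry H S b y v) :
    sd H (S \ {b}) u v ≤ 36 * δ + 28 := by
  by_cases hp : 2 * (δ + 1) + sd H S x y ≤ sd H S x b + sd H S y b
  · have := h.entry_close_of_product hb hc hx.1 hy.1 (by omega) hp hu hv
    omega
  · have anti : ∀ a ∈ S \ {b}, ∀ c ∈ S \ {b}, sd H S a c ≤ sd H (S \ {b}) a c :=
      fun a ha c hc' => sd_anti Set.sdiff_subset hc ha hc'
    -- With a small product the geodesic passes near b. The point m at the same distance from x as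
    -- b, or else the end y, is within 3δ + 2 of b, and each half contributes 18δ + 14.
    obtain ⟨m, hm, m1, m2⟩ := exists_btw hc hx hy (k := min (sd H S x b) (sd H (S \ {b}) x y))
      (min_le_right _ _)
    have a1 := anti x hx m hm
    have a2 := anti m hm y hy
    have a3 := anti x hx y hy
    have t1 := sd_triangle h.conn hx.1 hm.1 y
    have f := h.four_point m hm.1 x hx.1 b hb y hy.1
    have c1 := sd_comm (H := H) (S := S) m x
    have c2 := sd_comm (H := H) (S := S) b y
    obtain ⟨w, hw⟩ := exists_isEntry h.conn hb hm.1 hm.2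
    have n1 := h.entry_close_of_near hb hc hx hm (M := 3 * δ + 2) (by omega) (by omega) hu hw
    have c3 := sd_comm (H := H) (S := S) m y
    have c4 := sd_comm (H := H) (S := S \ {b}) m y
    have n2 := h.entry_close_of_near hb hc hy hm (M := 3 * δ + 2) (by omega) (by omega) hv hw
    have t2 := sd_triangle hc hu.mem_diff hw.mem_diff v
    rw [sd_comm w v] at t2
    omega

/-- A chosen entry point. -/
noncomputable def entry (H : SimpleGraph U) (S : Set U) (b x : U) : U :=
  open Classical in if h : ∃ u, IsEntry H S b x u then h.choose else x

theorem isEntry_entry (hc : ConnOn H S) (hb : b ∈ S) {x : U} (hx : x ∈ S) (hxb : x ≠ b) :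
    IsEntry H S b x (entry H S b x) := by
  have h := exists_isEntry hc hb hx hxb
  rw [entry, dif_pos h]
  exact h.choose_spec

end Entry

/-! ### Removing cone vertices from a hyperbolic graph. -/

section Decone

variable {U : Type u} {H : SimpleGraph U} {S B : Set U} {C : U → Set U} {δ K : ℕ}

/-- A hyperbolic graph with a set `B` of cone vertices, the neighbours of `b ∈ B` lying in a
hyperbolic subgraph `C b` that is quasi-isometrically embedded in the complement of `b`. -/
structure IsConed (H : SimpleGraph U) (S B : Set U) (C : U → Set U) (δ K : ℕ) : Prop where
  hyp : HypOn H S δ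
  subset : B ⊆ S
  indep : ∀ b ∈ B, ∀ b' ∈ B, ¬ H.Adj b b'
  conn : ConnOn H (S \ B)
  conn_diff : ∀ b ∈ B, ConnOn H (S \ {b})
  link_subset : ∀ b ∈ B, C b ⊆ S \ B
  nbr : ∀ b ∈ B, ∀ u ∈ S, H.Adj u b → u ∈ C b
  link_hyp : ∀ b ∈ B, HypOn H (C b) δ
  qi : ∀ b ∈ B, ∀ u ∈ C b, ∀ v ∈ C b, sd H (C b) u v ≤ K * sd H (S \ {b}) u v + K

/-- The bound for distances of entry points in a coned graph. -/
def entryBound (δ K : ℕ) : ℕ := K * (36 * δ + 28) + K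

namespace IsConed

theorem mem_link (h : IsConed H S B C δ K) {b x u : U} (hb : b ∈ B) (hu : IsEntry H S b x u) :
    u ∈ C b :=
  h.nbr b hb u hu.1 hu.2.1

theorem link_le (h : IsConed H S B C δ K) {b x y : U} (hb : b ∈ B) (hx : x ∈ C b) (hy : y ∈ C b) :
    sd H (S \ B) x y ≤ sd H (C b) x y :=
  sd_anti (h.link_subset b hb) (h.link_hyp b hb).conn hx hy

theorem mem_diff (_ : IsConed H S B C δ K) {b x : U} (hb : b ∈ B) (hx : x ∈ S \ B) :
    x ∈ S \ {b} :=
  ⟨hx.1, fun e => hx.2 (e ▸ hb)⟩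

theorem isEntry (h : IsConed H S B C δ K) {b x : U} (hb : b ∈ B) (hx : x ∈ S \ B) :
    IsEntry H S b x (entry H S b x) :=
  isEntry_entry h.hyp.conn (h.subset hb) hx.1 fun e => hx.2 (e ▸ hb)

theorem entry_mem (h : IsConed H S B C δ K) {b x : U} (hb : b ∈ B) (hx : x ∈ S \ B) :
    entry H S b x ∈ C b :=
  h.mem_link hb (h.isEntry hb hx)

theorem entry_close (h : IsConed H S B C δ K) {b x y u v : U} (hb : b ∈ B) (hx : x ∈ S \ B)
    (hy : y ∈ S \ B) (hxy : sd H (S \ {b}) x y ≤ sd H S x y)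
    (hu : IsEntry H S b x u) (hv : IsEntry H S b y v) :
    sd H (C b) u v ≤ entryBound δ K := by
  have h1 := h.hyp.entry_close (h.subset hb) (h.conn_diff b hb) (h.mem_diff hb hx)
    (h.mem_diff hb hy) hxy hu hv
  have h2 := h.qi b hb u (h.mem_link hb hu) v (h.mem_link hb hv)
  exact h2.trans (Nat.add_le_add_right (Nat.mul_le_mul_left _ h1) _)

theorem entry_close_self (h : IsConed H S B C δ K) {b x u v : U} (hb : b ∈ B) (hx : x ∈ S \ B)
    (hu : IsEntry H S b x u) (hv : IsEntry H S b x v) :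
    sd H (C b) u v ≤ entryBound δ K :=
  h.entry_close hb hx hx (by simp) hu hv

/-- If `b` is not on a geodesic from `x` to `y`, then the entry points are close. -/
theorem entry_close_of_not_btw (h : IsConed H S B C δ K) {b x y u v : U} (hb : b ∈ B)
    (hx : x ∈ S \ B) (hy : y ∈ S \ B) (hxy : ¬ Btw H S x b y)
    (hu : IsEntry H S b x u) (hv : IsEntry H S b y v) :
    sd H (C b) u v ≤ entryBound δ K := by
  have hbS := h.subset hb
  have hlt : sd H S x y < sd H S x b + sd H S b y := by
    have := sd_triangle h.hyp.conn hx.1 hbS y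
    by_contra hcon
    exact hxy ⟨hbS, by omega⟩
  exact h.entry_close hb hx hy (sd_diff_singleton_le h.hyp.conn hx.1 hy.1 hbS hlt) hu hv

/-- An edge outside B is a geodesic avoiding b, so the entry points move by a bounded amount in `C
b` along each edge. -/
theorem entry_lipschitz (h : IsConed H S B C δ K) {b x y : U} (hb : b ∈ B)
    (hx : x ∈ S \ B) (hy : y ∈ S \ B) :
    sd H (C b) (entry H S b x) (entry H S b y) ≤ entryBound δ K * sd H (S \ B) x y := by
  refine lipschitz_of_adj (f := fun x y => sd H (C b) (entry H S b x) (entry H S b y)) h.conn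
    ?_ ?_ ?_ hx hy
  · exact fun x hx y hy z hz =>
      sd_triangle (h.link_hyp b hb).conn (h.entry_mem hb hx) (h.entry_mem hb hy) _
  · exact fun x hx => sd_self _
  · intro x hx y hy hxy
    refine h.entry_close hb hx hy ?_ (h.isEntry hb hx) (h.isEntry hb hy)
    rw [sd_eq_one (h.mem_diff hb hx) (h.mem_diff hb hy) hxy, sd_eq_one hx.1 hy.1 hxy]

end IsConed

/-- Points close in a coned graph are close outside the cone vertices, unless they have distant
entry points for a cone vertex close to one of them. -/
theorem exists_bad_cone (δ K k : ℕ) : ∀ M, ∃ g, ∀ {U : Type u} {H : SimpleGraph U} {S B : Set U}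
    {C : U → Set U}, IsConed H S B C δ K → ∀ p ∈ S \ B, ∀ q ∈ S \ B, sd H S p q ≤ k →
      sd H (S \ B) p q ≤ g ∨ ∃ b ∈ B, M < sd H (C b) (entry H S b p) (entry H S b q) ∧
        sd H (S \ B) p (entry H S b p) ≤ g := by
  induction k with
  | zero =>
    intro M
    refine ⟨0, fun {U H S B C} h p hp q hq hd => Or.inl ?_⟩
    rw [eq_of_sd_eq_zero h.hyp.conn hp.1 hq.1 (by omega)]
    simp
  | succ k ih =>
    intro M
    set E := entryBound δ K with hE
    -- The raised threshold pays for transferring a bad cone vertex from the next vertex back to p,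
    -- which moves the entry point by at most E(M + 2E + 1).
    obtain ⟨g, hg⟩ := ih (M + E * (M + 2 * E + 1))
    refine ⟨g + (M + 2 * E + 1) + E * (M + 2 * E + 1) + E, fun {U H S B C} h p hp q hq hd => ?_⟩
    by_cases hpq : sd H S p q = 0
    · rw [eq_of_sd_eq_zero h.hyp.conn hp.1 hq.1 hpq]
      simp
    have next : (∃ m ∈ S \ B, sd H (S \ B) p m ≤ M + 2 * E + 1 ∧ sd H S m q ≤ k) ∨
        ∃ b ∈ B, M < sd H (C b) (entry H S b p) (entry H S b q) ∧
          sd H (S \ B) p (entry H S b p) ≤ E := by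
      obtain ⟨m, hm, m1, m2⟩ := exists_btw h.hyp.conn hp.1 hq.1 (k := 1) (by omega)
      have hpm := (adj_of_sd_eq_one m1).2.2
      -- If the first step is a cone vertex, then p and the vertex after it are entry points for p
      -- and q there. Either this cone vertex is itself bad, or its passage can be replaced by a
      -- bounded path in `C m`.
      by_cases hmB : m ∈ B
      · have hmq : sd H S m q ≠ 0 := fun e =>
          hq.2 (eq_of_sd_eq_zero h.hyp.conn hm hq.1 e ▸ hmB)
        obtain ⟨w, hw, w1, w2⟩ := exists_btw h.hyp.conn hm hq.1 (k := 1) (by omega)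
        have hmw := (adj_of_sd_eq_one w1).2.2
        have hwB : w ∈ S \ B := ⟨hw, fun e => h.indep m hmB w e hmw⟩
        have ep : IsEntry H S m p p := ⟨hp.1, hpm, by simp [m1]⟩
        have eq : IsEntry H S m q w := ⟨hw, hmw.symm, by rw [sd_comm q w, sd_comm q m]; omega⟩
        have b1 := h.entry_close_self hmB hp ep (h.isEntry hmB hp)
        have b2 := h.entry_close_self hmB hq (h.isEntry hmB hq) eq
        by_cases hbad : M < sd H (C m) (entry H S m p) (entry H S m q)
        · exact Or.inr ⟨m, hmB, hbad,
            (h.link_le hmB (h.mem_link hmB ep) (h.entry_mem hmB hp)).trans b1⟩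
        · refine Or.inl ⟨w, hwB, ?_, by omega⟩
          have hC := (h.link_hyp m hmB).conn
          have t0 := h.link_le hmB (h.mem_link hmB ep) (h.mem_link hmB eq)
          have t1 := sd_triangle hC (h.mem_link hmB ep) (h.entry_mem hmB hp) w
          have t2 := sd_triangle hC (h.entry_mem hmB hp) (h.entry_mem hmB hq) w
          omega
      · refine Or.inl ⟨m, ⟨hm, hmB⟩, ?_, by omega⟩
        rw [sd_eq_one hp ⟨hm, hmB⟩ hpm]
        omega
    rcases next with ⟨m, hm, m1, m2⟩ | ⟨b, hb, b1, b2⟩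
    · rcases hg h m hm q hq m2 with h1 | ⟨b, hb, b1, b2⟩
      · left
        have := sd_triangle h.conn hp hm q
        omega
      · right
        have hC := (h.link_hyp b hb).conn
        have l1 := h.entry_lipschitz hb hp hm
        rw [← hE] at l1
        have l2 : E * sd H (S \ B) p m ≤ E * (M + 2 * E + 1) := Nat.mul_le_mul_left _ m1
        have t1 := sd_triangle hC (h.entry_mem hb hm) (h.entry_mem hb hp) (entry H S b q)
        have c1 := sd_comm (H := H) (S := C b) (entry H S b m) (entry H S b p)
        have t2 := sd_triangle h.conn hp hm (entry H S b p)
        have t3 := sd_triangle h.conn hm (h.link_subset b hb (h.entry_mem hb hm))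
          (entry H S b p)
        have t4 := h.link_le hb (h.entry_mem hb hm) (h.entry_mem hb hp)
        exact ⟨b, hb, by omega, by omega⟩
    · exact Or.inr ⟨b, hb, b1, by omega⟩

/-- Geodesics of a coned graph, with passages through cone vertices replaced by geodesics of
the coned subgraphs. -/
def deElectrified (H : SimpleGraph U) (S B : Set U) (C : U → Set U) (x y : U) : Set U :=
  {p | (p ∉ B ∧ Btw H S x p y) ∨ ∃ b ∈ B, Btw H S x b y ∧
    ∃ u v, IsEntry H S b x u ∧ IsEntry H S b y v ∧ Btw H (C b) u p v}

theorem deElectrified_symm {x y p : U} (h : p ∈ deElectrified H S B C x y) :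
    p ∈ deElectrified H S B C y x := by
  rcases h with ⟨h1, h2⟩ | ⟨b, hb, h1, u, v, hu, hv, h2⟩
  · exact Or.inl ⟨h1, h2.symm⟩
  · exact Or.inr ⟨b, hb, h1.symm, v, u, hv, hu, h2.symm⟩

namespace IsConed

theorem deElectrified_subset (h : IsConed H S B C δ K) (x y : U) :
    deElectrified H S B C x y ⊆ S \ B := by
  rintro p (⟨h1, h2⟩ | ⟨b, hb, h1, u, v, hu, hv, h2⟩)
  · exact ⟨h2.1, h1⟩
  · exact h.link_subset b hb h2.1

theorem deElectrified_near (h : IsConed H S B C δ K) {x y p : U} (hx : x ∈ S \ B) (hy : y ∈ S \ B)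
    (hxy : sd H (S \ B) x y ≤ 1) (hp : p ∈ deElectrified H S B C x y) :
    sd H (S \ B) x p ≤ 1 := by
  have h1 := sd_anti Set.sdiff_subset h.conn hx hy
  have ends : ∀ q, Btw H S x q y → q = x ∨ q = y := by
    intro q hq
    have h2 := hq.2
    rcases Nat.eq_zero_or_pos (sd H S x q) with h0 | h0
    · exact Or.inl (eq_of_sd_eq_zero h.hyp.conn hx.1 hq.1 h0).symm
    · exact Or.inr (eq_of_sd_eq_zero h.hyp.conn hq.1 hy.1 (by omega))
  rcases hp with ⟨-, hp⟩ | ⟨b, hb, hp, -⟩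
  · rcases ends p hp with rfl | rfl
    · simp
    · exact hxy
  · rcases ends b hp with rfl | rfl
    · exact absurd hb hx.2
    · exact absurd hb hy.2

/-- Along a single geodesic with its cone passages filled in, consecutive vertices are adjacent
outside B; a set containing x but not y is left somewhere on it. -/
theorem deElectrified_conn (h : IsConed H S B C δ K) {x y : U} (hx : x ∈ S \ B) (hy : y ∈ S \ B)
    {A : Set U} (hxA : x ∈ A) (hyA : y ∉ A) :
    ∃ p ∈ deElectrified H S B C x y, ∃ q ∈ deElectrified H S B C x y,
      p ∈ A ∧ q ∉ A ∧ sd H (S \ B) p q ≤ 1 := by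
  obtain ⟨γ, h0, h1, hS, hd, hadj⟩ := exists_geodesic h.hyp.conn hx.1 hy.1
  have dl : ∀ i ≤ sd H S x y, sd H S x (γ i) = i := by
    intro i hi
    have := hd 0 i (by omega) hi
    rw [h0] at this
    omega
  have dr : ∀ i ≤ sd H S x y, sd H S (γ i) y = sd H S x y - i := by
    intro i hi
    have := hd i _ hi le_rfl
    rwa [h1] at this
  have hb : ∀ i ≤ sd H S x y, Btw H S x (γ i) y := fun i hi =>
    ⟨hS i, by rw [dl i hi, dr i hi]; omega⟩
  have hB : ∀ i < sd H S x y, γ i ∈ B → γ (i + 1) ∉ B := fun i hi hi' hi'' =>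
    h.indep _ hi' _ hi'' (hadj i hi)
  obtain ⟨i, hi, hiA, hiA'⟩ := exists_step (n := sd H S x y)
    -- A cone vertex inherits its membership from its predecessor, so that leaving A at a cone
    -- vertex is detected after the passage. The truncated `i - 1` at 0 is harmless since x is not a
    -- cone vertex.
    (P := fun i => (γ i ∈ A ∧ γ i ∉ B) ∨ (γ i ∈ B ∧ γ (i - 1) ∈ A))
    (Or.inl (h0.symm ▸ And.intro hxA hx.2))
    (by rw [h1]; rintro (e | e); exacts [hyA e.1, hy.2 e.1])
  have hiA'' : (γ (i + 1) ∈ A → γ (i + 1) ∈ B) ∧ (γ (i + 1) ∈ B → γ i ∉ A) := by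
    constructor
    · intro e
      by_contra e'
      exact hiA' (Or.inl ⟨e, e'⟩)
    · intro e e'
      exact hiA' (Or.inr ⟨e, e'⟩)
  rcases hiA with ⟨hA, hiB⟩ | ⟨hiB, hA⟩
  · have hsB : γ (i + 1) ∉ B := fun e => hiA''.2 e hA
    refine ⟨γ i, Or.inl ⟨hiB, hb i hi.le⟩, γ (i + 1), Or.inl ⟨hsB, hb _ hi⟩, hA,
      fun e => hsB (hiA''.1 e), ?_⟩
    exact (sd_eq_one (S := S \ B) ⟨hS i, hiB⟩ ⟨hS _, hsB⟩ (hadj i hi)).le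
  · have hsB := hB i hi hiB
    have hi0 : i ≠ 0 := by
      rintro rfl
      rw [h0] at hiB
      exact hx.2 hiB
    obtain ⟨j, rfl⟩ := Nat.exists_eq_succ_of_ne_zero hi0
    simp only [Nat.succ_eq_add_one, Nat.add_sub_cancel] at *
    set b := γ (j + 1) with hbdef
    have eu : IsEntry H S b x (γ j) :=
      ⟨hS j, hadj j (by omega), by rw [dl j (by omega), dl (j + 1) (by omega)]⟩
    have ev : IsEntry H S b y (γ (j + 1 + 1)) := by
      refine ⟨hS _, (hadj _ hi).symm, ?_⟩
      rw [sd_comm y, sd_comm y b, dr _ hi, dr _ hi.le]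
      omega
    have hC := (h.link_hyp b hiB).conn
    have mu := h.mem_link hiB eu
    have mv := h.mem_link hiB ev
    obtain ⟨η, e0, e1, eS, ed, eadj⟩ := exists_geodesic hC mu mv
    have eb : ∀ k ≤ sd H (C b) (γ j) (γ (j + 1 + 1)), η k ∈ deElectrified H S B C x y := by
      intro k hk
      refine Or.inr ⟨b, hiB, hb _ hi.le, _, _, eu, ev, eS k, ?_⟩
      have d1 := ed 0 k (by omega) hk
      have d2 := ed k _ hk le_rfl
      rw [e0] at d1
      rw [e1] at d2
      omega
    obtain ⟨k, hk, kA, kA'⟩ := exists_step (P := fun k => η k ∈ A)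
      (n := sd H (C b) (γ j) (γ (j + 1 + 1))) (by rw [e0]; exact hA)
      (by rw [e1]; exact fun e => hsB (hiA''.1 e))
    refine ⟨η k, eb k hk.le, η (k + 1), eb _ hk, kA, kA', ?_⟩
    exact (sd_eq_one (h.link_subset b hiB (eS k)) (h.link_subset b hiB (eS _)) (eadj k hk)).le

/-- A bad cone vertex b must lie on a geodesic of one of the other two sides. If neither side passed
through b, the entry points of x, y, z would be close to each other, and so would those of p and q,
against the bound 4 · `entryBound`. On a side through b, the entry point of y or of z belongs to the
guess and is close to p. -/
theorem exists_deElectrified_near (h : IsConed H S B C δ K) {g : ℕ} {x y z p q b : U} (hb : b ∈ B)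
    (hx : x ∈ S \ B) (hy : y ∈ S \ B) (hz : z ∈ S \ B) (hp : p ∈ S \ B)
    (hpb : sd H (S \ B) p (entry H S b p) ≤ g)
    (hpy : sd H (C b) (entry H S b p) (entry H S b y) ≤ entryBound δ K)
    (hpq : 4 * entryBound δ K < sd H (C b) (entry H S b p) (entry H S b q))
    (hq' : sd H (C b) (entry H S b x) (entry H S b q) ≤ entryBound δ K ∨
      sd H (C b) (entry H S b y) (entry H S b q) ≤ entryBound δ K ∨
      sd H (C b) (entry H S b z) (entry H S b q) ≤ entryBound δ K) :
    ∃ r, (r ∈ deElectrified H S B C x z ∨ r ∈ deElectrified H S B C z y) ∧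
      sd H (S \ B) p r ≤ g + 2 * entryBound δ K := by
  have hC := (h.link_hyp b hb).conn
  have mp := h.entry_mem hb hp
  have mx := h.entry_mem hb hx
  have my := h.entry_mem hb hy
  have mz := h.entry_mem hb hz
  have ex := h.isEntry hb hx
  have ey := h.isEntry hb hy
  have ez := h.isEntry hb hz
  have mpS := h.link_subset b hb mp
  by_cases hzy : Btw H S z b y
  · refine ⟨entry H S b y, Or.inr (Or.inr ⟨b, hb, hzy, _, _, ez, ey, btw_right _ my⟩), ?_⟩
    have t1 := sd_triangle h.conn hp mpS (entry H S b y)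
    have t2 := h.link_le hb mp my
    omega
  · have dzy := h.entry_close_of_not_btw hb hz hy hzy ez ey
    rw [sd_comm] at dzy
    have t0 := sd_triangle hC mp my (entry H S b z)
    have hxz : Btw H S x b z := by
      by_contra hxz
      have dxz := h.entry_close_of_not_btw hb hx hz hxz ex ez
      rw [sd_comm] at dxz
      have t1 := sd_triangle hC mp my (entry H S b q)
      have t2 := sd_triangle hC my mz (entry H S b q)
      have t3 := sd_triangle hC mz mx (entry H S b q)
      omega
    refine ⟨entry H S b z, Or.inl (Or.inr ⟨b, hb, hxz, _, _, ex, ez, btw_right _ mz⟩), ?_⟩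
    have t1 := sd_triangle h.conn hp mpS (entry H S b z)
    have t2 := h.link_le hb mp mz
    omega

/-- A point of a geodesic has its entry point close to that of one of the endpoints. -/
theorem entry_near_endpoint (h : IsConed H S B C δ K) {x y p b : U} (hb : b ∈ B)
    (hx : x ∈ S \ B) (hy : y ∈ S \ B) (hp : p ∈ S \ B) (hxy : Btw H S x p y) :
    sd H (C b) (entry H S b x) (entry H S b p) ≤ entryBound δ K ∨
      sd H (C b) (entry H S b y) (entry H S b p) ≤ entryBound δ K := by
  by_cases h1 : Btw H S x b p
  · by_cases h2 : Btw H S y b p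
    · exfalso
      have e1 := h1.2
      have e2 := h2.2
      have e3 := hxy.2
      have t := sd_triangle h.hyp.conn hx.1 (h.subset hb) y
      have c1 := sd_comm (H := H) (S := S) b y
      have c2 := sd_comm (H := H) (S := S) p y
      have : b = p := eq_of_sd_eq_zero h.hyp.conn h1.1 hp.1 (by omega)
      exact hp.2 (this ▸ hb)
    · exact Or.inr (h.entry_close_of_not_btw hb hy hp h2 (h.isEntry hb hy) (h.isEntry hb hp))
  · exact Or.inl (h.entry_close_of_not_btw hb hx hp h1 (h.isEntry hb hx) (h.isEntry hb hp))

end IsConed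

/-- For p on a geodesic, slimness of the coned graph gives q on another side, and either q is close
without the cones or a bad cone vertex supplies a replacement. For p inside a passage through b,
slimness of `C b` for the entry points of x, y, z applies; if the side so found misses b, then p is
near an end of its passage, which is a geodesic point. -/
theorem exists_deElectrified_slim (δ K : ℕ) : ∃ h, ∀ {U : Type u} {H : SimpleGraph U} {S B : Set U}
    {C : U → Set U}, IsConed H S B C δ K → ∀ x ∈ S \ B, ∀ y ∈ S \ B, ∀ z ∈ S \ B,
      ∀ p ∈ deElectrified H S B C x y, ∃ q,
        (q ∈ deElectrified H S B C x z ∨ q ∈ deElectrified H S B C z y) ∧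
        sd H (S \ B) p q ≤ h := by
  obtain ⟨g, hg⟩ := exists_bad_cone δ K (2 * δ + 1) (4 * entryBound δ K)
  set E := entryBound δ K with hE
  refine ⟨g + 2 * E + (2 * δ + 2 * E), fun {U H S B C} h x hx y hy z hz p hp => ?_⟩
  have on_geodesic : ∀ p, p ∉ B → Btw H S x p y → ∃ q,
      (q ∈ deElectrified H S B C x z ∨ q ∈ deElectrified H S B C z y) ∧
      sd H (S \ B) p q ≤ g + 2 * E := by
    intro p hpB hp
    have hpS : p ∈ S \ B := ⟨hp.1, hpB⟩
    have hq : ∃ q, q ∉ B ∧ (Btw H S x q z ∨ Btw H S z q y) ∧ sd H S p q ≤ 2 * δ + 1 := by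
      obtain ⟨q, hq, hd⟩ := h.hyp.slim hx.1 hy.1 hz.1 hp
      by_cases hqB : q ∈ B
      -- A cone vertex is traded for the neighbouring entry point on the geodesic, at the cost of 1.
      · have shift : ∀ x z, x ∈ S \ B → z ∈ S \ B → Btw H S x q z →
            ∃ u, u ∉ B ∧ Btw H S x u z ∧ sd H S p u ≤ 2 * δ + 1 := by
          intro x z hx hz hq
          have hu := h.isEntry hqB hx
          have e1 := sd_eq_one hu.1 hq.1 hu.2.1
          refine ⟨entry H S q x, fun hu' => h.indep _ hu' _ hqB hu.2.1,
            hq.trans_left h.hyp.conn hx.1 ⟨hu.1, by rw [e1]; exact hu.2.2⟩, ?_⟩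
          have := sd_triangle h.hyp.conn hp.1 hq.1 (entry H S q x)
          rw [sd_comm q] at this
          omega
        rcases hq with hq | hq
        · obtain ⟨u, h1, h2, h3⟩ := shift x z hx hz hq
          exact ⟨u, h1, Or.inl h2, h3⟩
        · obtain ⟨u, h1, h2, h3⟩ := shift z y hz hy hq
          exact ⟨u, h1, Or.inr h2, h3⟩
      · exact ⟨q, hqB, hq, by omega⟩
    obtain ⟨q, hqB, hq, hd⟩ := hq
    have hqS : q ∈ S \ B := ⟨by rcases hq with hq | hq <;> exact hq.1, hqB⟩
    rcases hg h p hpS q hqS hd with hd' | ⟨b, hb, hbad, hpb⟩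
    · exact ⟨q, hq.imp (fun e => Or.inl ⟨hqB, e⟩) (fun e => Or.inl ⟨hqB, e⟩), by omega⟩
    · have hq3 : sd H (C b) (entry H S b x) (entry H S b q) ≤ E ∨
          sd H (C b) (entry H S b y) (entry H S b q) ≤ E ∨
          sd H (C b) (entry H S b z) (entry H S b q) ≤ E := by
        rcases hq with hq | hq
        · have := h.entry_near_endpoint hb hx hz hqS hq
          tauto
        · have := h.entry_near_endpoint hb hz hy hqS hq
          tauto
      rcases h.entry_near_endpoint hb hx hy hpS hp with hpx | hpy
      · rw [sd_comm] at hpx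
        obtain ⟨r, hr, hd⟩ := h.exists_deElectrified_near hb hy hx hz hpS hpb hpx hbad
          (by tauto)
        exact ⟨r, hr.symm.imp deElectrified_symm deElectrified_symm, hd⟩
      · rw [sd_comm] at hpy
        exact h.exists_deElectrified_near hb hx hy hz hpS hpb hpy hbad hq3
  rcases hp with ⟨hpB, hp⟩ | ⟨b, hb, hxy, u, v, hu, hv, hp⟩
  · obtain ⟨q, hq, hd⟩ := on_geodesic p hpB hp
    exact ⟨q, hq, by omega⟩
  · have hC := (h.link_hyp b hb).conn
    have hw := h.isEntry hb hz
    have mu := h.mem_link hb hu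
    have mv := h.mem_link hb hv
    have mw := h.entry_mem hb hz
    have endpoint : ∀ u, IsEntry H S b x u ∨ IsEntry H S b y u → sd H (C b) p u ≤ 2 * δ + 2 * E →
        ∃ q, (q ∈ deElectrified H S B C x z ∨ q ∈ deElectrified H S B C z y) ∧
          sd H (S \ B) p q ≤ g + 2 * E + (2 * δ + 2 * E) := by
      intro u hu hd
      have mu : u ∈ C b := hu.elim (h.mem_link hb) (h.mem_link hb)
      have huB := h.link_subset b hb mu
      have hub : Btw H S x u y := by
        rcases hu with hu | hu
        · refine hxy.trans_left h.hyp.conn hx.1 ⟨hu.1, ?_⟩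
          rw [sd_eq_one hu.1 hxy.1 hu.2.1]; exact hu.2.2
        · refine (hxy.symm.trans_left h.hyp.conn hy.1 ⟨hu.1, ?_⟩).symm
          rw [sd_eq_one hu.1 hxy.1 hu.2.1]; exact hu.2.2
      obtain ⟨q, hq, hqd⟩ := on_geodesic u huB.2 hub
      have t1 := sd_triangle h.conn (h.link_subset b hb hp.1) huB q
      have t2 := h.link_le hb hp.1 mu
      exact ⟨q, hq, by omega⟩
    obtain ⟨q, hq, hd⟩ := (h.link_hyp b hb).slim mu mv mw hp
    rcases hq with hq | hq
    · by_cases hxz : Btw H S x b z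
      · refine ⟨q, Or.inl (Or.inr ⟨b, hb, hxz, _, _, hu, hw, hq⟩), ?_⟩
        have := h.link_le hb hp.1 hq.1
        omega
      · refine endpoint u (Or.inl hu) ?_
        have e1 := h.entry_close_of_not_btw hb hx hz hxz hu hw
        have e2 := hq.2
        have e3 := sd_triangle hC hp.1 hq.1 u
        rw [sd_comm q u] at e3
        omega
    · by_cases hzy : Btw H S z b y
      · refine ⟨q, Or.inr (Or.inr ⟨b, hb, hzy, _, _, hw, hv, hq⟩), ?_⟩
        have := h.link_le hb hp.1 hq.1
        omega
      · refine endpoint v (Or.inr hv) ?_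
        have e1 := h.entry_close_of_not_btw hb hz hy hzy hw hv
        have e2 := hq.2
        have e3 := sd_triangle hC hp.1 hq.1 v
        omega

/-- Removing cone vertices from a hyperbolic graph leaves a hyperbolic graph. -/
theorem exists_hypOn_of_isConed (δ K : ℕ) : ∃ δ', ∀ {U : Type u} {H : SimpleGraph U} {S B : Set U}
    {C : U → Set U}, IsConed H S B C δ K → HypOn H (S \ B) δ' := by
  obtain ⟨h, hh⟩ := exists_deElectrified_slim.{u} δ K
  obtain ⟨δ', hδ'⟩ := exists_hypOn_of_isGuess.{u} (h + 1)
  refine ⟨δ', fun {U H S B C} hC => hδ' (L := deElectrified H S B C) hC.conn ⟨?_, ?_, ?_, ?_, ?_⟩⟩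
  · exact fun x _ y _ => hC.deElectrified_subset x y
  · exact fun x _ y hy => Or.inl ⟨hy.2, btw_right x hy.1⟩
  · intro x hx y hy z hz p hp
    obtain ⟨q, hq, hd⟩ := hh hC x hx y hy z hz p hp
    exact ⟨q, hq, by omega⟩
  · intro x hx y hy hxy p hp
    have := hC.deElectrified_near hx hy hxy hp
    omega
  · exact fun x hx y hy A hxA hyA => hC.deElectrified_conn hx hy hxA hyA

end Decone

/-! ### Metric realizations of graphs. -/

section Realization

variable {U : Type u} {H : SimpleGraph U} {S : Set U}

theorem vertexPoint_self (u : U) : vertexPoint u u = 1 := by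
  simp [vertexPoint]

theorem vertexPoint_of_ne {u x : U} (h : x ≠ u) : vertexPoint u x = 0 := by
  simp [vertexPoint, h]

theorem support_vertexPoint (u : U) : Function.support (vertexPoint u) = {u} := by
  ext x
  by_cases h : x = u
  · simp [h, vertexPoint_self]
  · simp [h, vertexPoint_of_ne h]

/-- The properties of barycentric coordinates that are used below. -/
structure IsPoint (H : SimpleGraph U) (S : Set U) (p : U → ℝ) : Prop where
  nonneg : ∀ a, 0 ≤ p a
  mem : ∀ a, p a ≠ 0 → a ∈ S
  adj : ∀ a c, p a ≠ 0 → p c ≠ 0 → a = c ∨ H.Adj a c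
  sum_le : ∀ a c, a ≠ c → p a + p c ≤ 1
  total : ∀ a, p a ≠ 0 → p a = 1 ∨ ∃ c, c ≠ a ∧ p c ≠ 0 ∧ p a + p c = 1
  sum_eq : ∀ a c, p a ≠ 0 → p c ≠ 0 → a ≠ c → p a + p c = 1
  nonempty : ∃ a, p a ≠ 0
  edge : ∃ u v, (u = v ∨ H.Adj u v) ∧ Function.support p ⊆ {u, v}

theorem isPoint_of_mem {p : U → ℝ} (hp : p ∈ realization H S) : IsPoint H S p := by
  classical
  obtain ⟨u, hu, v, hv, huv, t, ⟨ht0, ht1⟩, hp⟩ := hp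
  have hpx : ∀ x, p x = (1 - t) * vertexPoint u x + t * vertexPoint v x := by
    intro x; rw [hp]; simp
  have hvp : ∀ u x : U, vertexPoint u x = if x = u then (1 : ℝ) else 0 := by
    intro u x
    split_ifs with h
    · rw [h, vertexPoint_self]
    · exact vertexPoint_of_ne h
  by_cases huv' : u = v
  · subst huv'
    have hq : ∀ x, p x = if x = u then 1 else 0 := by
      intro x; rw [hpx, hvp]; ring
    refine ⟨?_, ?_, ?_, ?_, ?_, ?_, ⟨u, by simp [hq]⟩, ⟨u, u, Or.inl rfl, ?_⟩⟩
    · intro a; rw [hq]; split_ifs <;> norm_num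
    · intro a ha; rw [hq] at ha; grind
    · intro a c ha hc; rw [hq] at ha hc; grind
    · intro a c hac; rw [hq, hq]; split_ifs <;> grind
    · intro a ha; rw [hq] at ha ⊢; grind
    · intro a c ha hc; rw [hq] at ha hc; grind
    · intro x hx; rw [Function.mem_support, hq] at hx; grind
  · have hadj : H.Adj u v := huv.resolve_left huv'
    have hq : ∀ x, p x = if x = u then 1 - t else if x = v then t else 0 := by
      intro x; rw [hpx, hvp, hvp]; split_ifs <;> grind
    have hpu : p u = 1 - t := by rw [hq]; simp
    have hpv : p v = t := by rw [hq]; grind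
    have hcase : ∀ x, p x ≠ 0 → x = u ∨ x = v := by intro x hx; rw [hq] at hx; grind
    have hz : ∀ x, x ≠ u → x ≠ v → p x = 0 := by intro x h1 h2; rw [hq]; simp [h1, h2]
    refine ⟨?_, ?_, ?_, ?_, ?_, ?_, ?_, ⟨u, v, huv, ?_⟩⟩
    · intro a; rw [hq]; split_ifs <;> linarith
    · intro a ha; rcases hcase a ha with rfl | rfl <;> assumption
    · intro a c ha hc
      rcases hcase a ha with rfl | rfl <;> rcases hcase c hc with rfl | rfl <;>
        simp [hadj, hadj.symm]
    · intro a c hac; rw [hq, hq]; split_ifs <;> grind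
    · intro a ha
      rcases hcase a ha with rfl | rfl
      · by_cases ht : t = 0
        · left; rw [hpu, ht]; ring
        · right; exact ⟨v, Ne.symm huv', by rw [hpv]; exact ht, by rw [hpu, hpv]; ring⟩
      · by_cases ht : 1 - t = 0
        · left; rw [hpv]; linarith
        · right; exact ⟨u, huv', by rw [hpu]; exact ht, by rw [hpu, hpv]; ring⟩
    · intro a c ha hc hac
      rcases hcase a ha with rfl | rfl <;> rcases hcase c hc with rfl | rfl <;> grind
    · by_cases ht : t = 0
      · exact ⟨u, by rw [hpu, ht]; norm_num⟩
      · exact ⟨v, by rw [hpv]; exact ht⟩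
    · intro x hx; exact hcase x hx

theorem vertexPoint_mem {u : U} (hu : u ∈ S) : vertexPoint u ∈ realization H S :=
  ⟨u, hu, u, hu, Or.inl rfl, 0, by simp, by simp⟩

theorem realization_mono {T : Set U} (h : S ⊆ T) : realization H S ⊆ realization H T := by
  rintro p ⟨u, hu, v, hv, huv⟩
  exact ⟨u, h hu, v, h hv, huv⟩

theorem IsPoint.le_one {p : U → ℝ} (hp : IsPoint H S p) (a : U) : p a ≤ 1 := by
  by_cases h : p a = 0
  · rw [h]; norm_num
  · rcases hp.total a h with h | ⟨c, -, -, h⟩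
    · exact h.le
    · have := hp.nonneg c; linarith

theorem IsPoint.eq_vertexPoint {p : U → ℝ} (hp : IsPoint H S p) {a : U} (h : p a = 1) :
    p = vertexPoint a := by
  funext x
  by_cases hx : x = a
  · rw [hx, h, vertexPoint_self]
  · rw [vertexPoint_of_ne hx]
    have := hp.sum_le x a hx
    have := hp.nonneg x
    linarith

theorem IsPoint.finite_support {p : U → ℝ} (hp : IsPoint H S p) : (Function.support p).Finite := by
  obtain ⟨u, v, -, h⟩ := hp.edge
  exact (Set.toFinite {u, v}).subset h

/-- `p` and `q` lie on a common closed edge. -/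
def CommonEdge (H : SimpleGraph U) (p q : U → ℝ) : Prop :=
  ∃ u v, (u = v ∨ H.Adj u v) ∧ Function.support p ⊆ {u, v} ∧ Function.support q ⊆ {u, v}

theorem realizationDist_of_commonEdge {p q : U → ℝ} (h : CommonEdge H p q) :
    realizationDist H S p q = ⨆ u, |p u - q u| := if_pos h

theorem realizationDist_of_not {p q : U → ℝ} (h : ¬ CommonEdge H p q) :
    realizationDist H S p q = ⨅ a : Function.support p × Function.support q,
      (1 - p a.1) + (sd H S a.1 a.2 : ℝ) + (1 - q a.2) := if_neg h

variable {p q r : U → ℝ}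

theorem CommonEdge.symm (h : CommonEdge H p q) : CommonEdge H q p := by
  obtain ⟨u, v, h1, h2, h3⟩ := h
  exact ⟨u, v, h1, h3, h2⟩

theorem IsPoint.abs_sub_le_one (hp : IsPoint H S p) (hq : IsPoint H S q) (x : U) :
    |p x - q x| ≤ 1 := by
  have := hp.le_one x
  have := hq.le_one x
  have := hp.nonneg x
  have := hq.nonneg x
  rw [abs_le]
  constructor <;> linarith

theorem IsPoint.abs_sub_le_iSup (hp : IsPoint H S p) (hq : IsPoint H S q) (x : U) :
    |p x - q x| ≤ ⨆ u, |p u - q u| :=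
  le_ciSup (f := fun u => |p u - q u|) ⟨1, by rintro _ ⟨x, rfl⟩; exact hp.abs_sub_le_one hq x⟩ x

theorem IsPoint.iSup_le (hp : IsPoint H S p) {c : ℝ} (h : ∀ x, |p x - q x| ≤ c) :
    ⨆ u, |p u - q u| ≤ c := by
  obtain ⟨a, -⟩ := hp.nonempty
  have : Nonempty U := ⟨a⟩
  exact ciSup_le h

/-- The distance is realized along an edge or by a path through vertices. -/
theorem IsPoint.dist_cases (hp : IsPoint H S p) (hq : IsPoint H S q) :
    (CommonEdge H p q ∧ realizationDist H S p q = ⨆ u, |p u - q u|) ∨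
    ∃ a c, p a ≠ 0 ∧ q c ≠ 0 ∧
      realizationDist H S p q = (1 - p a) + (sd H S a c : ℝ) + (1 - q c) := by
  by_cases h : CommonEdge H p q
  · exact Or.inl ⟨h, realizationDist_of_commonEdge h⟩
  · right
    have := hp.finite_support.to_subtype
    have := hq.finite_support.to_subtype
    obtain ⟨a, ha⟩ := hp.nonempty
    obtain ⟨c, hc⟩ := hq.nonempty
    have : Nonempty (Function.support p × Function.support q) := ⟨(⟨a, ha⟩, ⟨c, hc⟩)⟩
    obtain ⟨⟨a, c⟩, h'⟩ := exists_eq_ciInf_of_finite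
      (f := fun a : Function.support p × Function.support q =>
        (1 - p a.1) + (sd H S a.1 a.2 : ℝ) + (1 - q a.2))
    exact ⟨a, c, a.2, c.2, by rw [realizationDist_of_not h, ← h']⟩

theorem IsPoint.dist_le (hc : ConnOn H S) (hp : IsPoint H S p) (hq : IsPoint H S q) {a c : U}
    (ha : p a ≠ 0) (hqc : q c ≠ 0) :
    realizationDist H S p q ≤ (1 - p a) + (sd H S a c : ℝ) + (1 - q c) := by
  by_cases h : CommonEdge H p q
  · rw [realizationDist_of_commonEdge h]
    refine hp.iSup_le fun x => ?_
    have h1 := hp.le_one a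
    have h2 := hq.le_one c
    by_cases hac : a = c
    · subst hac
      simp only [sd_self, Nat.cast_zero]
      by_cases hx : x = a
      · subst hx
        rw [abs_le]; constructor <;> linarith
      · have := hp.sum_le x a hx
        have := hq.sum_le x a hx
        have := hp.nonneg x
        have := hq.nonneg x
        rw [abs_le]; constructor <;> linarith
    · have h3 : (1 : ℝ) ≤ sd H S a c := by
        have : sd H S a c ≠ 0 := fun e => hac (eq_of_sd_eq_zero hc (hp.mem a ha) (hq.mem c hqc) e)
        exact_mod_cast Nat.one_le_iff_ne_zero.2 this
      have := hp.abs_sub_le_one hq x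
      linarith
  · rw [realizationDist_of_not h]
    exact ciInf_le (f := fun a : Function.support p × Function.support q =>
        (1 - p a.1) + (sd H S a.1 a.2 : ℝ) + (1 - q a.2))
      ⟨0, by
        rintro _ ⟨⟨a, c⟩, rfl⟩
        have := hp.le_one a
        have := hq.le_one c
        have : (0 : ℝ) ≤ sd H S a c := Nat.cast_nonneg _
        dsimp only
        linarith⟩ (⟨a, ha⟩, ⟨c, hqc⟩)

theorem IsPoint.dist_nonneg (hp : IsPoint H S p) (hq : IsPoint H S q) :
    0 ≤ realizationDist H S p q := by
  rcases hp.dist_cases hq with ⟨-, h⟩ | ⟨a, c, ha, hc, h⟩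
  · rw [h]
    obtain ⟨a, -⟩ := hp.nonempty
    exact (abs_nonneg _).trans (hp.abs_sub_le_iSup hq a)
  · rw [h]
    have := hp.le_one a
    have := hq.le_one c
    have : (0 : ℝ) ≤ sd H S a c := Nat.cast_nonneg _
    linarith

/-- Distances in a realization agree with those of the graph up to an additive error. -/
theorem IsPoint.dist_le_sd (hc : ConnOn H S) (hp : IsPoint H S p) (hq : IsPoint H S q) {a c : U}
    (ha : p a ≠ 0) (hqc : q c ≠ 0) : realizationDist H S p q ≤ sd H S a c + 2 := by
  have := hp.dist_le hc hq ha hqc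
  have := hp.nonneg a
  have := hq.nonneg c
  linarith

theorem IsPoint.sd_le_dist (hc : ConnOn H S) (hp : IsPoint H S p) (hq : IsPoint H S q) {a c : U}
    (ha : p a ≠ 0) (hqc : q c ≠ 0) : (sd H S a c : ℝ) ≤ realizationDist H S p q + 2 := by
  have hnn := hp.dist_nonneg hq
  rcases hp.dist_cases hq with ⟨⟨u, v, huv, hpu, hqu⟩, -⟩ | ⟨a', c', ha', hc', h⟩
  · have hac : a = c ∨ H.Adj a c := by
      have h1 : a = u ∨ a = v := hpu ha
      have h2 : c = u ∨ c = v := hqu hqc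
      rcases h1 with rfl | rfl <;> rcases h2 with rfl | rfl
      · exact Or.inl rfl
      · exact huv
      · exact huv.imp Eq.symm SimpleGraph.Adj.symm
      · exact Or.inl rfl
    have : (sd H S a c : ℝ) ≤ 1 := by
      exact_mod_cast sd_le_one (hp.mem a ha) (hq.mem c hqc) hac
    linarith
  · have h1 := sd_le_one (hp.mem a ha) (hp.mem a' ha') (hp.adj a a' ha ha')
    have h2 := sd_le_one (hq.mem c' hc') (hq.mem c hqc) (hq.adj c' c hc' hqc)
    have h3 := sd_triangle hc (hp.mem a ha) (hp.mem a' ha') c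
    have h4 := sd_triangle hc (hp.mem a' ha') (hq.mem c' hc') c
    have h5 : (sd H S a c : ℝ) ≤ sd H S a' c' + 2 := by
      have : sd H S a c ≤ sd H S a' c' + 2 := by omega
      exact_mod_cast this
    have := hp.le_one a'
    have := hq.le_one c'
    linarith

theorem realizationDist_vertexPoint {u v : U} (hu : u ∈ S) (hv : v ∈ S) :
    realizationDist H S (vertexPoint u) (vertexPoint v) = sd H S u v := by
  have hpu := isPoint_of_mem (vertexPoint_mem (H := H) hu)
  have hpv := isPoint_of_mem (vertexPoint_mem (H := H) hv)
  rcases hpu.dist_cases hpv with ⟨⟨a, b, hab, hsu, hsv⟩, h⟩ | ⟨a, c, ha, hc, h⟩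
  · rw [h]
    rw [support_vertexPoint, Set.singleton_subset_iff] at hsu hsv
    by_cases huv : u = v
    · subst huv
      obtain ⟨a, -⟩ := hpu.nonempty
      have : Nonempty U := ⟨a⟩
      simp
    · have hadj : H.Adj u v := by
        rcases hsu with rfl | rfl <;> rcases hsv with rfl | rfl
        · exact absurd rfl huv
        · exact hab.resolve_left huv
        · exact (hab.resolve_left (Ne.symm huv)).symm
        · exact absurd rfl huv
      rw [sd_eq_one hu hv hadj, Nat.cast_one]
      refine le_antisymm (hpu.iSup_le (hpu.abs_sub_le_one hpv)) ?_
      have := hpu.abs_sub_le_iSup hpv u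
      rw [vertexPoint_self, vertexPoint_of_ne huv] at this
      simpa using this
  · have ha' : a = u := by
      by_contra e; exact ha (vertexPoint_of_ne e)
    have hc' : c = v := by
      by_contra e; exact hc (vertexPoint_of_ne e)
    rw [h, ha', hc', vertexPoint_self, vertexPoint_self]
    ring

theorem IsPoint.dist_symm (hc : ConnOn H S) (hp : IsPoint H S p) (hq : IsPoint H S q) :
    realizationDist H S p q ≤ realizationDist H S q p := by
  rcases hq.dist_cases hp with ⟨h, h'⟩ | ⟨a, c, ha, hca, h⟩
  · rw [h', realizationDist_of_commonEdge h.symm]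
    simp_rw [abs_sub_comm]
    exact le_rfl
  · rw [h]
    have := hp.dist_le hc hq hca ha
    rw [sd_comm] at this
    linarith

/-- Used in the triangle inequality: going from p along the common edge to q and on to its vertex c
is at least as long as some path from p to c that leaves through a vertex of the support of p. If c
is not in that support, p is itself the other endpoint. -/
theorem IsPoint.exists_switch (hp : IsPoint H S p) (hq : IsPoint H S q)
    (h : CommonEdge H p q) {c : U} (hqc : q c ≠ 0) :
    ∃ a, p a ≠ 0 ∧ (1 - p a) + (sd H S a c : ℝ) ≤ (⨆ u, |p u - q u|) + (1 - q c) := by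
  have hE := hp.abs_sub_le_iSup hq c
  by_cases hpc : p c = 0
  · obtain ⟨u, v, huv, hpu, hqu⟩ := h
    obtain ⟨a, ha⟩ := hp.nonempty
    have hac : a ≠ c := by rintro rfl; exact ha hpc
    have h1 : a = u ∨ a = v := hpu ha
    have h2 : c = u ∨ c = v := hqu hqc
    have hpa : p a = 1 := by
      rcases hp.total a ha with h | ⟨d, hda, hd, -⟩
      · exact h
      · have h3 : d = u ∨ d = v := hpu hd
        have : d = c := by
          rcases h1 with rfl | rfl <;> rcases h2 with rfl | rfl <;> rcases h3 with rfl | rfl <;>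
            first | rfl | exact absurd rfl hda | exact absurd rfl hac
        exact absurd hpc (this ▸ hd)
    have hadj : a = c ∨ H.Adj a c := by
      rcases h1 with rfl | rfl <;> rcases h2 with rfl | rfl
      · exact Or.inl rfl
      · exact huv
      · exact huv.imp Eq.symm SimpleGraph.Adj.symm
      · exact Or.inl rfl
    have h4 : (sd H S a c : ℝ) ≤ 1 := by
      exact_mod_cast sd_le_one (hp.mem a ha) (hq.mem c hqc) hadj
    refine ⟨a, ha, ?_⟩
    rw [hpc, zero_sub, abs_neg, abs_of_nonneg (hq.nonneg c)] at hE
    rw [hpa]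
    linarith
  · refine ⟨c, hpc, ?_⟩
    rw [sd_self]
    have := neg_le_of_abs_le hE
    push_cast
    linarith

theorem IsPoint.dist_triangle (hc : ConnOn H S) (hp : IsPoint H S p) (hq : IsPoint H S q)
    (hr : IsPoint H S r) :
    realizationDist H S p r ≤ realizationDist H S p q + realizationDist H S q r := by
  have tri : ∀ a c e, p a ≠ 0 → q c ≠ 0 → (sd H S a e : ℝ) ≤ sd H S a c + sd H S c e := by
    intro a c e ha hqc
    exact_mod_cast sd_triangle hc (hp.mem a ha) (hq.mem c hqc) e
  rcases hp.dist_cases hq with ⟨h1, h1'⟩ | ⟨a, c, ha, hca, h1'⟩ <;>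
    rcases hq.dist_cases hr with ⟨h2, h2'⟩ | ⟨c', e, hc', he, h2'⟩
  · by_cases hv : ∃ c, q c = 1
    · obtain ⟨c, hqc⟩ := hv
      have hqc' : q c ≠ 0 := by rw [hqc]; norm_num
      obtain ⟨a, ha, ha'⟩ := hp.exists_switch hq h1 hqc'
      obtain ⟨e, he, he'⟩ := hr.exists_switch hq h2.symm hqc'
      have h3 := hp.dist_le hc hr ha he
      have h4 := tri a c e ha hqc'
      simp_rw [abs_sub_comm (r _)] at he'
      rw [sd_comm e c] at he'
      rw [h1', h2']
      rw [hqc] at ha' he'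
      linarith
    -- Here q is interior to an edge and determines it, so all three points lie on that edge.
    · push Not at hv
      have hpr : CommonEdge H p r := by
        obtain ⟨a, ha⟩ := hq.nonempty
        obtain ⟨c, hca, hqc, -⟩ := (hq.total a ha).resolve_left (hv a)
        obtain ⟨u, v, huv, hpu, hqu⟩ := h1
        obtain ⟨u', v', huv', hqu', hru'⟩ := h2
        have ea : a = u ∨ a = v := hqu ha
        have ec : c = u ∨ c = v := hqu hqc
        have ea' : a = u' ∨ a = v' := hqu' ha
        have ec' : c = u' ∨ c = v' := hqu' hqc
        have : ({u', v'} : Set U) ⊆ {u, v} := by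
          intro x hx
          have hx' : x = u' ∨ x = v' := hx
          change x = u ∨ x = v
          clear huv huv' hpu hqu hqu' hru' hx
          grind
        exact ⟨u, v, huv, hpu, hru'.trans this⟩
      rw [h1', h2', realizationDist_of_commonEdge hpr]
      refine hp.iSup_le fun x => (abs_sub_le _ (q x) _).trans ?_
      exact add_le_add (hp.abs_sub_le_iSup hq x) (hq.abs_sub_le_iSup hr x)
  · obtain ⟨a, ha, ha'⟩ := hp.exists_switch hq h1 hc'
    have h3 := hp.dist_le hc hr ha he
    have h4 := tri a c' e ha hc'
    rw [h1', h2']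
    linarith
  · obtain ⟨e, he, he'⟩ := hr.exists_switch hq h2.symm hca
    have h3 := hp.dist_le hc hr ha he
    have h4 := tri a c e ha hca
    simp_rw [abs_sub_comm (r _)] at he'
    rw [sd_comm e c] at he'
    rw [h1', h2']
    linarith
  · have h3 := hp.dist_le hc hr ha he
    have h4 := tri a c e ha hca
    rw [h1', h2']
    by_cases hcc : c = c'
    -- Entering and leaving q through the same vertex c only wastes 2(1 - q c). Through different
    -- vertices the two parts add up to 1, the length of the edge between them.
    · subst hcc
      have := hq.le_one c
      linarith
    · have h5 := hq.sum_eq c c' hca hc' hcc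
      have h6 : (sd H S c e : ℝ) ≤ 1 + sd H S c' e := by
        have t1 := sd_triangle hc (hq.mem c hca) (hq.mem c' hc') e
        have t2 := sd_le_one (hq.mem c hca) (hq.mem c' hc') (hq.adj c c' hca hc')
        have : sd H S c e ≤ 1 + sd H S c' e := by omega
        exact_mod_cast this
      linarith

theorem isMetric_realization (hc : ConnOn H S) :
    IsMetric fun x y : realization H S => realizationDist H S x.1 y.1 := by
  refine ⟨?_, ?_, ?_⟩
  · rintro ⟨p, hp⟩ ⟨q, hq⟩
    have hp' := isPoint_of_mem hp
    have hq' := isPoint_of_mem hq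
    simp only [Subtype.mk.injEq]
    constructor
    · intro h0
      rcases hp'.dist_cases hq' with ⟨-, h⟩ | ⟨a, c, ha, hca, h⟩
      · funext x
        have := hp'.abs_sub_le_iSup hq' x
        rw [← h, h0] at this
        exact sub_eq_zero.1 (abs_nonpos_iff.1 this)
      · rw [h0] at h
        have h1 := hp'.le_one a
        have h2 := hq'.le_one c
        have h3 : (0 : ℝ) ≤ sd H S a c := Nat.cast_nonneg _
        have h4 : sd H S a c = 0 := by
          have : (sd H S a c : ℝ) = 0 := by linarith
          exact_mod_cast this
        have h5 := eq_of_sd_eq_zero hc (hp'.mem a ha) (hq'.mem c hca) h4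
        subst h5
        rw [hp'.eq_vertexPoint (a := a) (by linarith), hq'.eq_vertexPoint (a := a) (by linarith)]
    · rintro rfl
      obtain ⟨u, v, huv, hs⟩ := hp'.edge
      rw [realizationDist_of_commonEdge ⟨u, v, huv, hs, hs⟩]
      exact le_antisymm (hp'.iSup_le (by simp))
        (by
          obtain ⟨a, -⟩ := hp'.nonempty
          exact (abs_nonneg _).trans (hp'.abs_sub_le_iSup hp' a))
  · intro x y
    exact le_antisymm ((isPoint_of_mem x.2).dist_symm hc (isPoint_of_mem y.2))
      ((isPoint_of_mem y.2).dist_symm hc (isPoint_of_mem x.2))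
  · intro x y z
    exact (isPoint_of_mem x.2).dist_triangle hc (isPoint_of_mem y.2) (isPoint_of_mem z.2)

/-- The realization of a connected graph is a quasi-geodesic space. -/
theorem isQuasiGeodesicSpace_realization (hc : ConnOn H S) :
    IsQuasiGeodesicSpace fun x y : realization H S => realizationDist H S x.1 y.1 := by
  -- The error below is at most 3 on either side, so 7 is generous.
  refine ⟨isMetric_realization hc, 7, by norm_num, ?_⟩
  rintro ⟨p, hp⟩ ⟨q, hq⟩
  have hp' := isPoint_of_mem hp
  have hq' := isPoint_of_mem hq
  obtain ⟨a, ha⟩ := hp'.nonempty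
  obtain ⟨c, hqc⟩ := hq'.nonempty
  obtain ⟨γ, h0, h1, hS, hd, -⟩ := exists_geodesic hc (hp'.mem a ha) (hq'.mem c hqc)
  set n := sd H S a c with hn
  -- A discontinuous path suffices: it starts at p, jumps along the vertices of a geodesic, and is
  -- sent to q at the extra parameter n + 1.
  set η : ℝ → realization H S := fun s =>
    if s = 0 then ⟨p, hp⟩ else if s = n + 1 then ⟨q, hq⟩ else
      ⟨vertexPoint (γ (min ⌊s⌋₊ n)), vertexPoint_mem (hS _)⟩ with hη
  have near : ∀ s ∈ Set.Icc (0 : ℝ) (n + 1), ∃ i ≤ n, (η s).1 (γ i) ≠ 0 ∧ (i : ℝ) ≤ s ∧ s ≤ i + 1 := by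
    rintro s ⟨hs0, hs1⟩
    by_cases e0 : s = 0
    · refine ⟨0, Nat.zero_le _, ?_, by simp [e0], by simp [e0]⟩
      simp only [hη, e0, if_true, h0]
      exact ha
    · by_cases e1 : s = n + 1
      · refine ⟨n, le_rfl, ?_, by simp [e1], by simp [e1]⟩
        have : (n : ℝ) + 1 ≠ 0 := by positivity
        simp only [hη, e1, this, if_false, if_true, h1]
        exact hqc
      · refine ⟨min ⌊s⌋₊ n, min_le_right _ _, ?_, ?_, ?_⟩
        · simp only [hη, e0, e1, if_false, vertexPoint_self]
          norm_num
        · exact (Nat.cast_le.2 (min_le_left _ _)).trans (Nat.floor_le hs0)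
        · have h2 : ⌊s⌋₊ ≤ n := by
            have : s < ((n + 1 : ℕ) : ℝ) := by
              push_cast; exact lt_of_le_of_ne hs1 e1
            have := (Nat.floor_lt hs0).2 this
            omega
          rw [min_eq_left h2]
          exact (Nat.lt_floor_add_one s).le
  refine ⟨n + 1, η, by positivity, by simp [hη], ?_, ?_⟩
  · have : (n : ℝ) + 1 ≠ 0 := by positivity
    simp only [hη, this, if_false, if_true]
  · intro s hs t ht
    obtain ⟨i, hi, hi0, hi1, hi2⟩ := near s hs
    obtain ⟨j, hj, hj0, hj1, hj2⟩ := near t ht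
    have u1 := (isPoint_of_mem (η s).2).dist_le_sd hc (isPoint_of_mem (η t).2) hi0 hj0
    have u2 := (isPoint_of_mem (η s).2).sd_le_dist hc (isPoint_of_mem (η t).2) hi0 hj0
    have hij : (sd H S (γ i) (γ j) : ℝ) = |(i : ℝ) - j| := by
      rcases le_total i j with h | h
      · rw [hd i j h hj, Nat.cast_sub h, abs_sub_comm, abs_of_nonneg]
        have : (i : ℝ) ≤ j := Nat.cast_le.2 h
        linarith
      · rw [sd_comm, hd j i h hi, Nat.cast_sub h, abs_of_nonneg]
        have : (j : ℝ) ≤ i := Nat.cast_le.2 h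
        linarith
    have b1 : |(i : ℝ) - j| ≤ |s - t| + 1 := by
      rw [abs_le]
      have := le_abs_self (s - t)
      have := neg_le_abs (s - t)
      constructor <;> linarith
    have b2 : |s - t| ≤ |(i : ℝ) - j| + 1 := by
      rw [abs_le]
      have := le_abs_self ((i : ℝ) - j)
      have := neg_le_abs ((i : ℝ) - j)
      constructor <;> linarith
    have := abs_nonneg (s - t)
    constructor
    · linarith
    · linarith

end Realization

/-! ### Maximal cliques and links. -/

section Cliques

variable {V : Type u} {G : SimpleGraph V}

theorem exists_maxClique {A s : Set V} (hs : s ⊆ A) (hc : G.IsClique s) :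
    ∃ w : MaxClique G A, s ⊆ w.1 := by
  obtain ⟨m, hsm, hm⟩ := zorn_subset_nonempty {s | s ⊆ A ∧ G.IsClique s}
    (fun c hc hchain hne => by
      refine ⟨⋃₀ c, ⟨Set.sUnion_subset fun t ht => (hc ht).1, ?_⟩,
        fun t ht => Set.subset_sUnion_of_mem ht⟩
      rintro x ⟨t, ht, hx⟩ y ⟨t', ht', hy⟩ hxy
      rcases hchain.total ht ht' with h | h
      · exact (hc ht').2 (h hx) hy hxy
      · exact (hc ht).2 hx (h hy) hxy) s ⟨hs, hc⟩
  exact ⟨⟨m, hm⟩, hsm⟩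

theorem exists_maxClique_mem {A : Set V} {v : V} (hv : v ∈ A) : ∃ w : MaxClique G A, v ∈ w.1 := by
  obtain ⟨w, hw⟩ := exists_maxClique (G := G) (Set.singleton_subset_iff.2 hv)
    (by simp [SimpleGraph.IsClique])
  exact ⟨w, hw rfl⟩

theorem MaxClique.subset {A : Set V} (w : MaxClique G A) : w.1 ⊆ A := w.2.prop.1

theorem MaxClique.isClique {A : Set V} (w : MaxClique G A) : G.IsClique w.1 := w.2.prop.2

theorem MaxClique.eq_of_subset {A : Set V} {w w' : MaxClique G A} (h : w.1 ⊆ w'.1) : w = w' :=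
  Subtype.ext (w.2.eq_of_subset w'.2.prop h)

theorem MaxClique.mem_of_adj {A : Set V} (w : MaxClique G A) {v : V} (hv : v ∈ A)
    (h : ∀ u ∈ w.1, u ≠ v → G.Adj v u) : v ∈ w.1 := by
  have hc : G.IsClique (insert v w.1) := by
    refine (SimpleGraph.isClique_insert).2 ⟨w.isClique, fun u hu huv => h u hu huv.symm⟩
  exact w.2.le_of_ge ⟨Set.insert_subset hv w.subset, hc⟩ (Set.subset_insert _ _)
    (Set.mem_insert _ _)

theorem mem_link_comm {A B : Set V} (h : A ⊆ link G B) : B ⊆ link G A :=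
  fun b hb _ ha => (h ha b hb).symm

theorem notMem_link_of_mem {A : Set V} {v : V} (hv : v ∈ A) : v ∉ link G A :=
  fun h => (h v hv).ne rfl

/-- A maximal clique of `A` is not contained in the link of a non-empty subset of `A`. -/
theorem MaxClique.exists_notMem_link {A F : Set V} (hFA : F ⊆ A) (hF : F.Nonempty)
    (w : MaxClique G A) : ∃ v ∈ w.1, v ∉ link G F := by
  by_contra! h
  obtain ⟨f, hf⟩ := hF
  exact notMem_link_of_mem hf (h f (w.mem_of_adj (hFA hf) fun u hu _ => h u hu f hf))

end Cliques

/-! ### Adjacency in augmented graphs. -/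

section AugGraph

variable {V : Type u} {G : SimpleGraph V} {A : Set V} {WA : SimpleGraph (MaxClique G A)}

theorem aug_adj_vert_vert {v w : V} : (augGraph G WA).Adj (.vert v) (.vert w) ↔
    v ≠ w ∧ (G.Adj v w ∨ ∃ x y : MaxClique G A, WA.Adj x y ∧ v ∈ x.1 ∧ w ∈ y.1) := by
  simp only [augGraph, SimpleGraph.fromRel_adj, ne_eq, AugVertex.vert.injEq]
  refine and_congr_right fun _ => ⟨?_, Or.inl⟩
  rintro (h | h | ⟨x, y, h, hx, hy⟩)
  · exact h
  · exact Or.inl h.symm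
  · exact Or.inr ⟨y, x, h.symm, hy, hx⟩

theorem aug_adj_vert_proj {v : V} {K : Set V} :
    (augGraph G WA).Adj (.vert v) (.proj K) ↔ v ∈ K := by
  simp [augGraph, SimpleGraph.fromRel_adj]

theorem aug_adj_proj_vert {v : V} {K : Set V} :
    (augGraph G WA).Adj (.proj K) (.vert v) ↔ v ∈ K := by
  rw [SimpleGraph.adj_comm, aug_adj_vert_proj]

theorem not_aug_adj_proj_proj {K K' : Set V} : ¬ (augGraph G WA).Adj (.proj K) (.proj K') := by
  simp [augGraph, SimpleGraph.fromRel_adj]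

theorem aug_adj_of_mem_clique {v w : V} {x : MaxClique G A} (hv : v ∈ x.1) (hw : w ∈ x.1) :
    v = w ∨ (augGraph G WA).Adj (.vert v) (.vert w) := by
  by_cases h : v = w
  · exact Or.inl h
  · exact Or.inr (aug_adj_vert_vert.2 ⟨h, Or.inl (x.isClique hv hw h)⟩)

theorem aug_adj_of_adj_clique {v w : V} {x y : MaxClique G A} (hxy : WA.Adj x y) (hv : v ∈ x.1)
    (hw : w ∈ y.1) : v = w ∨ (augGraph G WA).Adj (.vert v) (.vert w) := by
  by_cases h : v = w
  · exact Or.inl h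
  · exact Or.inr (aug_adj_vert_vert.2 ⟨h, Or.inr ⟨x, y, hxy, hv, hw⟩⟩)

end AugGraph

/-! ### Deleting a set whose neighbours are close to one vertex. -/

section ReachLE

variable {U : Type u} {H : SimpleGraph U} {S : Set U}

/-- `x` and `y` are joined by a path of length at most `k` in the subgraph induced on `S`. -/
def ReachLE (H : SimpleGraph U) (S : Set U) (x y : U) (k : ℕ) : Prop :=
  (H.induce S).spanningCoe.Reachable x y ∧ sd H S x y ≤ k

theorem ReachLE.trans {x y z : U} {k l : ℕ} (h : ReachLE H S x y k) (h' : ReachLE H S y z l) :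
    ReachLE H S x z (k + l) :=
  ⟨h.1.trans h'.1, (h.1.dist_triangle_left z).trans (Nat.add_le_add h.2 h'.2)⟩

theorem ReachLE.symm {x y : U} {k : ℕ} (h : ReachLE H S x y k) : ReachLE H S y x k :=
  ⟨h.1.symm, by rw [sd_comm]; exact h.2⟩

theorem ReachLE.mono {x y : U} {k l : ℕ} (h : ReachLE H S x y k) (hkl : k ≤ l) :
    ReachLE H S x y l :=
  ⟨h.1, h.2.trans hkl⟩

theorem reachLE_of_adj {x y : U} (hx : x ∈ S) (hy : y ∈ S) (h : x = y ∨ H.Adj x y) :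
    ReachLE H S x y 1 := by
  refine ⟨?_, sd_le_one hx hy h⟩
  rcases h with rfl | h
  · exact SimpleGraph.Reachable.refl _
  · exact (adj_induce_iff.2 ⟨hx, hy, h⟩).reachable

/-- Removing a set whose neighbours are close to each other outside of it. -/
theorem sd_diff_le_of_reachLE (hS : ConnOn H S) {A : Set U} {f : U} {c : ℕ}
    (h : ∀ s ∈ S \ A, ∀ a ∈ S ∩ A, H.Adj s a → ReachLE H (S \ A) s f c) {x y : U}
    (hx : x ∈ S \ A) (hy : y ∈ S \ A) : ReachLE H (S \ A) x y (sd H S x y + 2 * c) := by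
  -- Follow the path until just before it first meets A, then go to f. Using this from both ends of
  -- a geodesic costs c twice.
  have aux : ∀ (n : ℕ) (γ : ℕ → U), (∀ i ≤ n, γ i ∈ S) → (∀ i < n, H.Adj (γ i) (γ (i + 1))) →
      γ 0 ∉ A → γ n ∈ A → ReachLE H (S \ A) (γ 0) f (n + c) := by
    intro n γ hγ hadj h0 hn
    obtain ⟨i, hi, hiA, hiA'⟩ := exists_step (P := fun i => ∀ j ≤ i, γ j ∉ A) (n := n)
      (by intro j hj; rw [Nat.le_zero.1 hj]; exact h0) (fun e => e n le_rfl hn)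
    have hi1 : γ (i + 1) ∈ A := by
      by_contra e
      refine hiA' fun j hj => ?_
      rcases Nat.lt_or_ge i j with h1 | h1
      · rw [show j = i + 1 by omega]; exact e
      · exact hiA j h1
    have p1 : ReachLE H (S \ A) (γ 0) (γ i) i :=
      sd_le_of_path (fun j hj => ⟨hγ j (by omega), hiA j hj⟩) fun j hj => Or.inr (hadj j (by omega))
    exact (p1.trans (h _ ⟨hγ i hi.le, hiA i le_rfl⟩ _ ⟨hγ _ hi, hi1⟩ (hadj i hi))).mono (by omega)
  obtain ⟨γ, h0, h1, hγ, -, hadj⟩ := exists_geodesic hS hx.1 hy.1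
  by_cases hA : ∃ k ≤ sd H S x y, γ k ∈ A
  · obtain ⟨k, hk, hkA⟩ := hA
    have p1 := aux k γ (fun i _ => hγ i) (fun i hi => hadj i (by omega)) (by rw [h0]; exact hx.2) hkA
    have p2 := aux (sd H S x y - k) (fun i => γ (sd H S x y - i)) (fun i _ => hγ _)
      (fun i hi => by
        have := hadj (sd H S x y - (i + 1)) (by omega)
        rw [show sd H S x y - (i + 1) + 1 = sd H S x y - i by omega] at this
        exact this.symm) (by simp only [Nat.sub_zero, h1]; exact hy.2)
      (by simpa [Nat.sub_sub_self hk] using hkA)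
    simp only [Nat.sub_zero, h0, h1] at p1 p2
    exact (p1.trans p2.symm).mono (by omega)
  · push Not at hA
    have p : ReachLE H (S \ A) (γ 0) (γ (sd H S x y)) (sd H S x y) :=
      sd_le_of_path (fun j hj => ⟨hγ j, hA j hj⟩) fun j hj => Or.inr (hadj j hj)
    rw [h0, h1] at p
    exact p.mono (by omega)

/-- Distances do not decrease and grow by at most 2c, and two of them stand on the left of the
four-point condition. -/
theorem HypOn.diff {δ : ℕ} (hS : HypOn H S δ) {A : Set U} {f : U} {c : ℕ}
    (h : ∀ s ∈ S \ A, ∀ a ∈ S ∩ A, H.Adj s a → ReachLE H (S \ A) s f c) :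
    HypOn H (S \ A) (δ + 4 * c) := by
  have hc : ConnOn H (S \ A) := fun x hx y hy => (sd_diff_le_of_reachLE hS.conn h hx hy).1
  refine ⟨hc, fun x hx y hy z hz w hw => ?_⟩
  have e1 := (sd_diff_le_of_reachLE hS.conn h hx hz).2
  have e2 := (sd_diff_le_of_reachLE hS.conn h hy hw).2
  have e3 := hS.four_point x hx.1 y hy.1 z hz.1 w hw.1
  have f1 := sd_anti Set.sdiff_subset hc hx hy
  have f2 := sd_anti Set.sdiff_subset hc hz hw
  have f3 := sd_anti Set.sdiff_subset hc hy hz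
  have f4 := sd_anti Set.sdiff_subset hc hx hw
  omega

end ReachLE

/-! ### The rank of a domain. -/

section Rank

variable {V : Type u} {G : SimpleGraph V} {𝔉 : Set (Set V)} {n : ℕ}

/-- The maximal length of a chain of domains contained in `F`. -/
noncomputable def rank (𝔉 : Set (Set V)) (F : Set V) : ℕ :=
  sSup {k | ∃ c : Fin k → Set V, StrictMono c ∧ ∀ i, c i ∈ 𝔉 ∧ c i ⊆ F}

theorem IsFactorSystem.bddAbove_chains (h : IsFactorSystem n G 𝔉) (F : Set V) :
    BddAbove {k | ∃ c : Fin k → Set V, StrictMono c ∧ ∀ i, c i ∈ 𝔉 ∧ c i ⊆ F} := by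
  refine ⟨n, ?_⟩
  rintro k ⟨c, hc, hcF⟩
  exact (h.complexity k c hc fun i => (hcF i).1).le

theorem IsFactorSystem.exists_chain (h : IsFactorSystem n G 𝔉) (F : Set V) :
    ∃ c : Fin (rank 𝔉 F) → Set V, StrictMono c ∧ ∀ i, c i ∈ 𝔉 ∧ c i ⊆ F :=
  Nat.sSup_mem (s := {k | ∃ c : Fin k → Set V, StrictMono c ∧ ∀ i, c i ∈ 𝔉 ∧ c i ⊆ F})
    ⟨0, Fin.elim0, fun i => i.elim0, fun i => i.elim0⟩ (h.bddAbove_chains F)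

theorem IsFactorSystem.rank_lt (h : IsFactorSystem n G 𝔉) (F : Set V) : rank 𝔉 F < n := by
  obtain ⟨c, hc, hcF⟩ := h.exists_chain F
  exact h.complexity _ c hc fun i => (hcF i).1

theorem IsFactorSystem.rank_lt_rank (h : IsFactorSystem n G 𝔉) {F F' : Set V} (hF' : F' ∈ 𝔉)
    (hFF : F ⊂ F') : rank 𝔉 F < rank 𝔉 F' := by
  obtain ⟨c, hc, hcF⟩ := h.exists_chain F
  refine Nat.lt_of_succ_le (le_csSup (h.bddAbove_chains F') ⟨Fin.snoc c F', ?_, ?_⟩)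
  · intro i j hij
    induction j using Fin.lastCases with
    | last =>
      induction i using Fin.lastCases with
      | last => exact absurd hij (lt_irrefl _)
      | cast i => simpa using lt_of_le_of_lt (hcF i).2 hFF
    | cast j =>
      induction i using Fin.lastCases with
      | last => exact absurd hij (not_lt.2 (Fin.le_last _))
      | cast i => simpa using hc (by simpa using hij)
  · intro i
    induction i using Fin.lastCases with
    | last => simpa using hF'
    | cast i => simpa using ⟨(hcF i).1, (hcF i).2.trans hFF.1⟩

end Rank

/-! ### CHHF triples in terms of vertex distances. -/

section DiscreteCHHF

variable {V : Type u} {G : SimpleGraph V} {W : SimpleGraph (MaxClique G Set.univ)}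
  {𝔉 : Set (Set V)} {n δ K : ℕ}

/-- The conditions of a CHHF triple, in terms of distances of vertices. -/
structure IsDiscreteCHHF (G : SimpleGraph V) (W : SimpleGraph (MaxClique G Set.univ))
    (𝔉 : Set (Set V)) (n δ K : ℕ) : Prop where
  factorSystem : IsFactorSystem n G 𝔉
  hierarchy : HierarchyCondition G W 𝔉
  hyp : ∀ F ∈ 𝔉, HypOn (augGraph G W) (augVerts 𝔉 F) δ
  qi : ∀ F ∈ 𝔉, ∀ x ∈ augVerts 𝔉 F, ∀ y ∈ augVerts 𝔉 F,
    sd (augGraph G W) (augVerts 𝔉 F) x y ≤ K * sd (augGraph G W) (compVerts G 𝔉 F) x y + K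

section Vertices

theorem vert_mem_augVerts {F : Set V} {v : V} : AugVertex.vert v ∈ augVerts 𝔉 F ↔ v ∈ F := Iff.rfl

theorem proj_mem_augVerts {F L : Set V} :
    AugVertex.proj L ∈ augVerts 𝔉 F ↔ L ∈ 𝔉 ∧ L ⊂ F := Iff.rfl

/-- The vertices of `lk(F)` and the `b_L` with `L ⊆ lk(F)`. -/
def linkPart (G : SimpleGraph V) (F : Set V) : Set (AugVertex V) :=
  {a | match a with
    | .vert v => v ∈ link G F
    | .proj L => L ⊆ link G F}

theorem vert_mem_linkPart {F : Set V} {v : V} :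
    AugVertex.vert v ∈ linkPart G F ↔ v ∈ link G F := Iff.rfl

theorem proj_mem_linkPart {F L : Set V} :
    AugVertex.proj L ∈ linkPart G F ↔ L ⊆ link G F := Iff.rfl

theorem vert_mem_compVerts {F : Set V} {v : V} :
    AugVertex.vert v ∈ compVerts G 𝔉 F ↔ v ∉ link G F := by
  simp [compVerts, augVerts, projPart]

theorem proj_mem_compVerts {F L : Set V} :
    AugVertex.proj L ∈ compVerts G 𝔉 F ↔
      L ∈ 𝔉 ∧ L ≠ Set.univ ∧ ¬ L ⊆ link G F ∧ ¬ F ⊆ L := by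
  simp only [compVerts, augVerts, projPart, Set.mem_sdiff, Set.mem_ofPred_eq, Set.ssubset_univ_iff]
  tauto

theorem exists_mem_notMem {L M : Set V} (h : ¬ L ⊆ M) : ∃ v ∈ L, v ∉ M := Set.not_subset.1 h

theorem not_subset_link {F L : Set V} (hF : F.Nonempty) (h : F ⊆ L) : ¬ L ⊆ link G F := by
  obtain ⟨f, hf⟩ := hF
  exact fun h' => notMem_link_of_mem hf (h' (h hf))

theorem augVerts_subset_compVerts (hfs : IsFactorSystem n G 𝔉) (F : Set V) :
    augVerts 𝔉 F ⊆ compVerts G 𝔉 F := by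
  rintro (v | L) h
  · exact vert_mem_compVerts.2 (notMem_link_of_mem h)
  · obtain ⟨hL, hLF⟩ := proj_mem_augVerts.1 h
    refine proj_mem_compVerts.2 ⟨hL, ?_, ?_, hLF.2⟩
    · rintro rfl
      exact hLF.2 (Set.subset_univ _)
    · obtain ⟨v, hv⟩ := hfs.nonempty L hL
      exact fun h' => notMem_link_of_mem (hLF.1 hv) (h' hv)

theorem augVerts_mono {F L : Set V} (h : F ⊆ L) : augVerts 𝔉 F ⊆ augVerts 𝔉 L := by
  rintro (v | K) hv
  · exact h hv
  · exact ⟨hv.1, hv.2.trans_subset h⟩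

theorem compVerts_univ (hfs : IsFactorSystem n G 𝔉) : compVerts G 𝔉 Set.univ = augVerts 𝔉 Set.univ := by
  ext (v | L)
  · rw [vert_mem_compVerts, vert_mem_augVerts]
    simp [notMem_link_of_mem]
  · rw [proj_mem_compVerts, proj_mem_augVerts, Set.univ_subset_iff, Set.ssubset_univ_iff]
    constructor
    · tauto
    · rintro ⟨h1, h2⟩
      refine ⟨h1, h2, fun h3 => ?_, h2⟩
      obtain ⟨v, hv⟩ := hfs.nonempty L h1
      exact notMem_link_of_mem (Set.mem_univ v) (h3 hv)

end Vertices

/-! ### Connectedness of the clique graphs and of the graphs Y_F. -/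

section CliqueGraphs

/-- The `F`-graphs of a hierarchy are connected. -/
theorem preconnected_of_hierarchy (hfs : IsFactorSystem n G 𝔉)
    (hconn : ∀ F ∈ 𝔉, ConnOn (augGraph G W) (augVerts 𝔉 F))
    {Wf : ∀ F : Set V, SimpleGraph (MaxClique G F)}
    (hW : ∀ F ∈ 𝔉, ∀ F' ∈ 𝔉, F' ⊆ F →
      (augGraph G (Wf F)).induce (augVerts 𝔉 F') = (augGraph G W).induce (augVerts 𝔉 F') ∧
      ∀ x : MaxClique G (link G F' ∩ F), ∃ f : Wf F' →g Wf F,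
        ∀ w : MaxClique G F', x.1 ∪ w.1 ⊆ (f w).1) (r : ℕ) :
    ∀ F ∈ 𝔉, rank 𝔉 F = r → (Wf F).Preconnected := by
  induction r using Nat.strong_induction_on with
  | _ r ih =>
  intro F hF hr
  have ih' : ∀ F' ∈ 𝔉, F' ⊂ F → (Wf F').Preconnected := fun F' hF' hss =>
    ih _ (hr ▸ hfs.rank_lt_rank hF hss) F' hF' rfl
  -- By C_F F = CF, the extra edges of CF come from adjacent maximal cliques of F itself.
  have hadj : ∀ a ∈ augVerts 𝔉 F, ∀ b ∈ augVerts 𝔉 F, (augGraph G W).Adj a b →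
      (augGraph G (Wf F)).Adj a b := by
    intro a ha b hb hab
    have h : ((augGraph G W).induce (augVerts 𝔉 F)).Adj ⟨a, ha⟩ ⟨b, hb⟩ := hab
    rw [← (hW F hF F hF subset_rfl).1] at h
    exact h
  have star : ∀ (v : V) (x y : MaxClique G F), v ∈ x.1 → v ∈ y.1 → (Wf F).Reachable x y := by
    intro v x y hx hy
    have hvF := x.subset hx
    have sub : ∀ x : MaxClique G F, v ∈ x.1 → x.1 \ {v} ⊆ link G {v} ∩ F := by
      rintro x hx u ⟨hu, huv⟩
      refine ⟨?_, x.subset hu⟩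
      rintro w rfl
      exact x.isClique hx hu (Ne.symm huv)
    by_cases hne : (link G {v} ∩ F).Nonempty
    · have hF' : link G {v} ∩ F ∈ 𝔉 :=
        hfs.inter_mem _ (hfs.link_mem v (hne.mono Set.inter_subset_left)) _ hF hne
      have hss : link G {v} ∩ F ⊂ F :=
        ⟨Set.inter_subset_right, fun h => notMem_link_of_mem (Set.mem_singleton v) (h hvF).1⟩
      have hvl : v ∈ link G (link G {v} ∩ F) ∩ F := ⟨fun u hu => (hu.1 v rfl).symm, hvF⟩
      -- Images under the homomorphism for z contain v. By maximality every maximal clique of F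
      -- through v is such an image, so connectedness passes up from the smaller domain lk(v) ∩ F.
      obtain ⟨z, hz⟩ := exists_maxClique_mem (G := G) hvl
      obtain ⟨f, hf⟩ := (hW F hF _ hF' hss.1).2 z
      have ext : ∀ x : MaxClique G F, v ∈ x.1 → ∃ w, f w = x := by
        intro x hx
        obtain ⟨w, hw⟩ := exists_maxClique (G := G) (sub x hx)
          (x.isClique.subset Set.sdiff_subset)
        refine ⟨w, (MaxClique.eq_of_subset fun u hu => ?_).symm⟩
        by_cases huv : u = v
        · exact hf w (Or.inl (huv ▸ hz))
        · exact hf w (Or.inr (hw ⟨hu, huv⟩))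
      obtain ⟨wx, rfl⟩ := ext x hx
      obtain ⟨wy, rfl⟩ := ext y hy
      exact (ih' _ hF' hss wx wy).map f
    · have : x = y := by
        refine MaxClique.eq_of_subset fun u hu => ?_
        by_contra huy
        exact hne ⟨u, sub x hx ⟨hu, fun e => huy (e ▸ hy)⟩⟩
      rw [this]
  intro x y
  obtain ⟨u, hu, -⟩ := x.exists_notMem_link subset_rfl (hfs.nonempty F hF)
  obtain ⟨v, hv, -⟩ := y.exists_notMem_link subset_rfl (hfs.nonempty F hF)
  -- A path in CF is followed by the cliques meeting its vertices; a vertex b_L stands for all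
  -- cliques that meet L. These are joined to each other through the smaller domain L.
  let Q : AugVertex V → MaxClique G F → Prop := fun a z =>
    match a with
    | .vert v => v ∈ z.1
    | .proj L => ∃ v ∈ L, v ∈ z.1
  have step : ∀ a ∈ augVerts 𝔉 F, ∀ b ∈ augVerts 𝔉 F, (augGraph G W).Adj a b →
      (∀ z, Q a z → (Wf F).Reachable x z) → ∀ z, Q b z → (Wf F).Reachable x z := by
    intro a ha b hb hab hP z hz
    have hab' := hadj a ha b hb hab
    rcases a with v | L <;> rcases b with w | L'
    · obtain ⟨-, h | ⟨z₁, z₂, h, h1, h2⟩⟩ := aug_adj_vert_vert.1 hab'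
      · obtain ⟨c, hc⟩ := exists_maxClique (G := G) (A := F) (s := {v, w})
          (Set.pair_subset ha hb) (by
            rw [SimpleGraph.isClique_pair]; exact fun _ => h)
        exact (hP c (hc (by simp))).trans (star w c z (hc (by simp)) hz)
      · exact ((hP z₁ h1).trans h.reachable).trans (star w z₂ z h2 hz)
    · obtain ⟨hL', hss⟩ := proj_mem_augVerts.1 hb
      have hvL := aug_adj_vert_proj.1 hab
      obtain ⟨w, hwL, hwz⟩ := hz
      obtain ⟨c, -⟩ := exists_maxClique (G := G) (Set.empty_subset (link G L' ∩ F)) (by simp)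
      obtain ⟨f, hf⟩ := (hW F hF _ hL' hss.1).2 c
      obtain ⟨w₁, hw₁⟩ := exists_maxClique_mem (G := G) hvL
      obtain ⟨w₂, hw₂⟩ := exists_maxClique_mem (G := G) hwL
      exact ((hP (f w₁) (hf w₁ (Or.inr hw₁))).trans ((ih' _ hL' hss w₁ w₂).map f)).trans
        (star w _ z (hf w₂ (Or.inr hw₂)) hwz)
    · exact hP z ⟨w, aug_adj_proj_vert.1 hab, hz⟩
    · exact absurd hab not_aug_adj_proj_proj
  have hu' : AugVertex.vert u ∈ augVerts 𝔉 F := x.subset hu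
  have hv' : AugVertex.vert v ∈ augVerts 𝔉 F := y.subset hv
  obtain ⟨γ, h0, h1, hS, -, hγ⟩ := exists_geodesic (hconn F hF) hu' hv'
  have all : ∀ i ≤ sd (augGraph G W) (augVerts 𝔉 F) (.vert u) (.vert v),
      ∀ z, Q (γ i) z → (Wf F).Reachable x z := by
    intro i
    induction i with
    | zero =>
      intro _ z hz
      rw [h0] at hz
      exact star u x z hu hz
    | succ i ihi => exact fun hi => step _ (hS i) _ (hS (i + 1)) (hγ i hi) (ihi (by omega))
  refine all _ le_rfl y ?_
  rw [h1]
  exact hv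

namespace IsDiscreteCHHF

theorem conn_cliques (h : IsDiscreteCHHF G W 𝔉 n δ K) : ConnOn W Set.univ := by
  obtain ⟨Wf, hWf, hW⟩ := h.hierarchy
  have := preconnected_of_hierarchy h.factorSystem (fun F hF => (h.hyp F hF).conn) hW _
    Set.univ h.factorSystem.univ_mem rfl
  rw [hWf] at this
  intro x _ y _
  rw [SimpleGraph.spanningCoe_induce_univ]
  exact this x y

/-- Every maximal clique of X has a vertex outside lk(F), so a W-path lifts to such vertices, one
per clique. The extra 1 is for a move inside a clique. -/
theorem reachLE_of_cliques (h : IsDiscreteCHHF G W 𝔉 n δ K) {F : Set V} (hF : F.Nonempty)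
    {T : Set (AugVertex V)} (hT : ∀ v ∉ link G F, AugVertex.vert v ∈ T) (k : ℕ) :
    ∀ w w' : MaxClique G Set.univ, sd W Set.univ w w' = k → ∀ v ∈ w.1, ∀ v' ∈ w'.1,
      v ∉ link G F → v' ∉ link G F →
      ReachLE (augGraph G W) T (.vert v) (.vert v') (k + 1) := by
  induction k with
  | zero =>
    intro w w' hk v hv v' hv' hvF hvF'
    obtain rfl := eq_of_sd_eq_zero h.conn_cliques trivial trivial hk
    exact reachLE_of_adj (hT v hvF) (hT v' hvF')
      ((aug_adj_of_mem_clique hv hv').imp (congrArg _) id)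
  | succ k ih =>
    intro w w' hk v hv v' hv' hvF hvF'
    obtain ⟨m, -, h1, h2⟩ := exists_btw h.conn_cliques (x := w) (y := w') trivial trivial
      (k := k) (by omega)
    obtain ⟨u, hu, huF⟩ := m.exists_notMem_link (Set.subset_univ F) hF
    have hadj := (adj_of_sd_eq_one (show sd W Set.univ m w' = 1 by omega)).2.2
    exact (ih w m h1 v hv u hu hvF huF).trans (reachLE_of_adj (hT u huF) (hT v' hvF')
      ((aug_adj_of_adj_clique hadj hu hv').imp (congrArg _) id))

/-- Subgraphs of `CX` that contain the vertices outside `lk(F)` and avoid the link part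
are connected. -/
theorem connOn_of_subset (h : IsDiscreteCHHF G W 𝔉 n δ K) {F : Set V} (hF : F.Nonempty)
    {T : Set (AugVertex V)} (hT : ∀ v ∉ link G F, AugVertex.vert v ∈ T)
    (hT' : T ∩ linkPart G F = ∅) : ConnOn (augGraph G W) T := by
  have key : ∀ a ∈ T, ∃ v ∉ link G F, ReachLE (augGraph G W) T a (.vert v) 1 := by
    rintro (v | L) ha
    · have hv : v ∉ link G F := fun e => by
        have : AugVertex.vert v ∈ T ∩ linkPart G F := ⟨ha, e⟩
        rw [hT'] at this
        exact this
      exact ⟨v, hv, reachLE_of_adj ha ha (Or.inl rfl)⟩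
    · have hL : ¬ L ⊆ link G F := fun e => by
        have : AugVertex.proj L ∈ T ∩ linkPart G F := ⟨ha, e⟩
        rw [hT'] at this
        exact this
      obtain ⟨v, hv, hvF⟩ := exists_mem_notMem hL
      exact ⟨v, hvF, reachLE_of_adj ha (hT v hvF) (Or.inr (aug_adj_proj_vert.2 hv))⟩
  intro a ha b hb
  obtain ⟨v, hv, hav⟩ := key a ha
  obtain ⟨w, hw, hbw⟩ := key b hb
  obtain ⟨x, hx⟩ := exists_maxClique_mem (G := G) (Set.mem_univ v)
  obtain ⟨y, hy⟩ := exists_maxClique_mem (G := G) (Set.mem_univ w)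
  exact (hav.trans ((h.reachLE_of_cliques hF hT _ x y rfl v hx w hy hv hw).trans hbw.symm)).1

theorem conn_compVerts (h : IsDiscreteCHHF G W 𝔉 n δ K) {F : Set V} (hF : F.Nonempty) :
    ConnOn (augGraph G W) (compVerts G 𝔉 F) := by
  refine h.connOn_of_subset hF (fun v hv => vert_mem_compVerts.2 hv) ?_
  ext (v | L)
  · simp [vert_mem_compVerts, vert_mem_linkPart]
  · simp only [Set.mem_inter_iff, proj_mem_compVerts, proj_mem_linkPart, Set.mem_empty_iff_false]
    tauto

end IsDiscreteCHHF

end CliqueGraphs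

/-! ### Deleting the link part of F from CL. -/

section Trim

/-- In a domain that meets `lk(F)` without being contained in it there is an edge between
`lk(F)` and its complement. -/
theorem exists_adj_link (h : IsDiscreteCHHF G W 𝔉 n δ K) (F : Set V) (r : ℕ) :
    ∀ L ∈ 𝔉, rank 𝔉 L = r → (∃ v ∈ L, v ∈ link G F) → (∃ u ∈ L, u ∉ link G F) →
      ∃ v ∈ L, ∃ u ∈ L, v ∈ link G F ∧ u ∉ link G F ∧ (augGraph G W).Adj (.vert u) (.vert v) := by
  induction r using Nat.strong_induction_on with
  | _ r ih =>
  rintro L hL hr ⟨v, hv, hvF⟩ ⟨u, hu, huF⟩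
  have hv' : AugVertex.vert v ∈ augVerts 𝔉 L := hv
  have hu' : AugVertex.vert u ∈ augVerts 𝔉 L := hu
  obtain ⟨γ, h0, h1, hS, -, hγ⟩ := exists_geodesic (h.hyp L hL).conn hv' hu'
  obtain ⟨i, hi, hiA, hiA'⟩ := exists_step (P := fun i => γ i ∈ linkPart G F)
    (by rw [h0]; exact hvF) (by rw [h1]; exact huF)
  have hadj := hγ i hi
  have m1 := hS i
  have m2 := hS (i + 1)
  generalize γ i = a at *
  generalize γ (i + 1) = b at *
  rcases a with v | M <;> rcases b with w | M'
  · exact ⟨v, m1, w, m2, hiA, hiA', hadj.symm⟩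
  -- The domain M' meets both lk(F) and its complement and has smaller rank.
  · obtain ⟨hM', hss⟩ := proj_mem_augVerts.1 m2
    obtain ⟨a, ha, b, hb, h1, h2, h3⟩ := ih _ (hr ▸ h.factorSystem.rank_lt_rank hL hss) M' hM' rfl
      ⟨v, aug_adj_vert_proj.1 hadj, hiA⟩ (exists_mem_notMem hiA')
    exact ⟨a, hss.1 ha, b, hss.1 hb, h1, h2, h3⟩
  · exact absurd (hiA (aug_adj_proj_vert.1 hadj)) hiA'
  · exact absurd hadj not_aug_adj_proj_proj

variable {F L : Set V}

/-- If u is adjacent to v in X, then u and f lie in the domain lk(v) ∩ L, whose projection vertex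
joins them. If the edge comes from adjacent maximal cliques of L, the clique containing v has a
vertex w outside lk(F); it is adjacent to v, and u is adjacent or equal to w. -/
theorem reachLE_of_adj_link_vert (h : IsDiscreteCHHF G W 𝔉 n δ K) (hL : L ∈ 𝔉)
    (hFL : F ⊆ L) {f u v : V} (hf : f ∈ F) (hu : u ∈ L) (huF : u ∉ link G F) (hv : v ∈ L)
    (hvF : v ∈ link G F) (huv : (augGraph G W).Adj (.vert u) (.vert v)) :
    ReachLE (augGraph G W) (augVerts 𝔉 L \ linkPart G F) (.vert u) (.vert f) 3 := by
  have hFv : F ⊆ link G {v} ∩ L := fun f hf => ⟨by rintro w rfl; exact (hvF f hf).symm, hFL hf⟩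
  have hne : (link G {v} ∩ L).Nonempty := ⟨f, hFv hf⟩
  have hD : link G {v} ∩ L ∈ 𝔉 :=
    h.factorSystem.inter_mem _ (h.factorSystem.link_mem v (hne.mono Set.inter_subset_left)) _ hL hne
  have hss : link G {v} ∩ L ⊂ L :=
    ⟨Set.inter_subset_right, fun h => notMem_link_of_mem (Set.mem_singleton v) (h hv).1⟩
  have hbT : AugVertex.proj (link G {v} ∩ L) ∈ augVerts 𝔉 L \ linkPart G F :=
    ⟨⟨hD, hss⟩, not_subset_link ⟨f, hf⟩ hFv⟩
  have hfT : AugVertex.vert f ∈ augVerts 𝔉 L \ linkPart G F :=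
    ⟨hFL hf, notMem_link_of_mem hf⟩
  have direct : ∀ u ∈ L, u ∉ link G F → G.Adj v u →
      ReachLE (augGraph G W) (augVerts 𝔉 L \ linkPart G F) (.vert u) (.vert f) 2 := by
    intro u hu huF hvu
    have huT : AugVertex.vert u ∈ augVerts 𝔉 L \ linkPart G F := ⟨hu, huF⟩
    exact (reachLE_of_adj huT hbT (Or.inr (aug_adj_vert_proj.2
      ⟨by rintro w rfl; exact hvu, hu⟩))).trans
      (reachLE_of_adj hbT hfT (Or.inr (aug_adj_proj_vert.2 (hFv hf))))
  obtain ⟨Wf, -, hW⟩ := h.hierarchy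
  have hadj : (augGraph G (Wf L)).Adj (.vert u) (.vert v) := by
    have h : ((augGraph G W).induce (augVerts 𝔉 L)).Adj ⟨.vert u, hu⟩ ⟨.vert v, hv⟩ := huv
    rw [← (hW L hL L hL subset_rfl).1] at h
    exact h
  obtain ⟨-, hG | ⟨x, y, hxy, hux, hvy⟩⟩ := aug_adj_vert_vert.1 hadj
  · exact (direct u hu huF hG.symm).mono (by omega)
  · obtain ⟨w, hwy, hwF⟩ := y.exists_notMem_link hFL ⟨f, hf⟩
    have hwL := y.subset hwy
    have hvw : G.Adj v w := y.isClique hvy hwy (by rintro rfl; exact hwF hvF)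
    have huT : AugVertex.vert u ∈ augVerts 𝔉 L \ linkPart G F := ⟨hu, huF⟩
    have hwT : AugVertex.vert w ∈ augVerts 𝔉 L \ linkPart G F := ⟨hwL, hwF⟩
    have huw : AugVertex.vert u = AugVertex.vert w ∨
        (augGraph G W).Adj (.vert u) (.vert w) := by
      rcases aug_adj_of_adj_clique hxy hux hwy with e | e
      · exact Or.inl (congrArg _ e)
      · right
        have h : ((augGraph G (Wf L)).induce (augVerts 𝔉 L)).Adj ⟨.vert u, hu⟩ ⟨.vert w, hwL⟩ := e
        rw [(hW L hL L hL subset_rfl).1] at h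
        exact h
    exact ((reachLE_of_adj huT hwT huw).trans (direct w hwL hwF hvw)).mono (by omega)

/-- For a projection vertex b_M, an edge inside M leaving lk(F) reduces to the case of vertices, at
the cost of 1. -/
theorem reachLE_of_adj_link (h : IsDiscreteCHHF G W 𝔉 n δ K) (hL : L ∈ 𝔉) (hFL : F ⊆ L)
    {f : V} (hf : f ∈ F) : ∀ s ∈ augVerts 𝔉 L \ linkPart G F, ∀ a ∈ augVerts 𝔉 L ∩ linkPart G F,
      (augGraph G W).Adj s a →
      ReachLE (augGraph G W) (augVerts 𝔉 L \ linkPart G F) s (.vert f) 4 := by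
  rintro (u | M) ⟨hs, hsF⟩ (v | M') ⟨ha, haF⟩ hadj
  · exact (reachLE_of_adj_link_vert h hL hFL hf hs hsF ha haF hadj).mono (by omega)
  · exact absurd (haF (aug_adj_vert_proj.1 hadj)) hsF
  · obtain ⟨hM, hss⟩ := proj_mem_augVerts.1 hs
    obtain ⟨v, hv, u, hu, hvF, huF, huv⟩ := exists_adj_link h F _ M hM rfl
      ⟨v, aug_adj_proj_vert.1 hadj, haF⟩ (exists_mem_notMem hsF)
    have hs' : AugVertex.proj M ∈ augVerts 𝔉 L \ linkPart G F := ⟨hs, hsF⟩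
    have hu' : AugVertex.vert u ∈ augVerts 𝔉 L \ linkPart G F := ⟨hss.1 hu, huF⟩
    exact ((reachLE_of_adj hs' hu' (Or.inr (aug_adj_proj_vert.2 hu))).trans
      (reachLE_of_adj_link_vert h hL hFL hf (hss.1 hu) huF (hss.1 hv) hvF huv)).mono (by omega)
  · exact absurd hadj not_aug_adj_proj_proj

theorem hypOn_diff_linkPart (h : IsDiscreteCHHF G W 𝔉 n δ K) (hF : F.Nonempty) (hL : L ∈ 𝔉)
    (hFL : F ⊆ L) : HypOn (augGraph G W) (augVerts 𝔉 L \ linkPart G F) (δ + 16) := by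
  obtain ⟨f, hf⟩ := hF
  exact (h.hyp L hL).diff (reachLE_of_adj_link h hL hFL hf)

end Trim

end DiscreteCHHF

/-! ### From CX to Y_F, removing projection vertices by decreasing rank. -/

section Layers

variable {V : Type u} {G : SimpleGraph V} {W : SimpleGraph (MaxClique G Set.univ)}
  {𝔉 : Set (Set V)} {n δ K : ℕ} {F : Set V}

/-- The vertices of `Y_F` and the `b_L` for the domains `L ≠ X` containing `F` of rank less
than `k`. -/
def layer (G : SimpleGraph V) (𝔉 : Set (Set V)) (F : Set V) (k : ℕ) : Set (AugVertex V) :=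
  {a | a ∈ augVerts 𝔉 Set.univ \ linkPart G F ∧
    ∀ L, a = AugVertex.proj L → F ⊆ L → rank 𝔉 L < k}

theorem vert_mem_layer {k : ℕ} {v : V} : AugVertex.vert v ∈ layer G 𝔉 F k ↔ v ∉ link G F := by
  simp [layer, augVerts, linkPart]

theorem proj_mem_layer {k : ℕ} {L : Set V} : AugVertex.proj L ∈ layer G 𝔉 F k ↔
    L ∈ 𝔉 ∧ L ≠ Set.univ ∧ ¬ L ⊆ link G F ∧ (F ⊆ L → rank 𝔉 L < k) := by
  simp only [layer, Set.mem_ofPred_eq, Set.mem_sdiff, proj_mem_augVerts, proj_mem_linkPart,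
    Set.ssubset_univ_iff, AugVertex.proj.injEq]
  constructor
  · rintro ⟨⟨⟨h1, h2⟩, h3⟩, h4⟩
    exact ⟨h1, h2, h3, h4 L rfl⟩
  · rintro ⟨h1, h2, h3, h4⟩
    exact ⟨⟨⟨h1, h2⟩, h3⟩, by rintro _ rfl; exact h4⟩

/-- The `b_L` for the domains `L ≠ X` containing `F` of rank `k`. -/
def coneVerts (𝔉 : Set (Set V)) (F : Set V) (k : ℕ) : Set (AugVertex V) :=
  {a | ∃ L, a = AugVertex.proj L ∧ L ∈ 𝔉 ∧ L ≠ Set.univ ∧ F ⊆ L ∧ rank 𝔉 L = k}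

theorem layer_diff (k : ℕ) : layer G 𝔉 F (k + 1) \ coneVerts 𝔉 F k = layer G 𝔉 F k := by
  ext (v | L)
  · simp [vert_mem_layer, coneVerts]
  · simp only [Set.mem_sdiff, proj_mem_layer, coneVerts, Set.mem_ofPred_eq, AugVertex.proj.injEq]
    constructor
    · rintro ⟨⟨h1, h2, h3, h4⟩, h5⟩
      refine ⟨h1, h2, h3, fun h => lt_of_le_of_ne (Nat.lt_succ_iff.1 (h4 h)) fun e => ?_⟩
      exact h5 ⟨L, rfl, h1, h2, h, e⟩
    · rintro ⟨h1, h2, h3, h4⟩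
      refine ⟨⟨h1, h2, h3, fun h => (h4 h).trans (Nat.lt_succ_self k)⟩, ?_⟩
      rintro ⟨_, rfl, -, -, h, e⟩
      exact (h4 h).ne e

theorem layer_inter_linkPart (k : ℕ) : layer G 𝔉 F k ∩ linkPart G F = ∅ := by
  ext a
  simp only [layer, Set.mem_inter_iff, Set.mem_ofPred_eq, Set.mem_sdiff, Set.mem_empty_iff_false]
  tauto

theorem layer_of_le (h : IsFactorSystem n G 𝔉) {k : ℕ} (hk : n ≤ k) :
    layer G 𝔉 F k = augVerts 𝔉 Set.univ \ linkPart G F := by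
  ext a
  exact ⟨fun h => h.1, fun ha => ⟨ha, fun L _ _ => (h.rank_lt L).trans_le hk⟩⟩

/-- Domains properly containing F have larger rank, so b_F is the only vertex outside Y_F that this
layer can contain. -/
theorem layer_rank_diff (h : IsFactorSystem n G 𝔉) :
    layer G 𝔉 F (rank 𝔉 F + 1) \ {AugVertex.proj F} = compVerts G 𝔉 F := by
  ext (v | L)
  · simp [vert_mem_layer, vert_mem_compVerts]
  · simp only [Set.mem_sdiff, proj_mem_layer, proj_mem_compVerts, Set.mem_singleton_iff,
      AugVertex.proj.injEq]
    constructor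
    · rintro ⟨⟨h1, h2, h3, h4⟩, h5⟩
      refine ⟨h1, h2, h3, fun hFL => ?_⟩
      have := h.rank_lt_rank h1 (hFL.ssubset_of_ne (Ne.symm h5))
      have := h4 hFL
      omega
    · rintro ⟨h1, h2, h3, h4⟩
      exact ⟨⟨h1, h2, h3, fun h => absurd h h4⟩, fun e => h4 e.ge⟩

/-- The cone vertices of one layer, with the subgraphs they cone off. -/
theorem isConed_layer (h : IsDiscreteCHHF G W 𝔉 n δ K) (hF : F.Nonempty) {k δ' : ℕ}
    (hyp : HypOn (augGraph G W) (layer G 𝔉 F (k + 1)) δ') :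
    IsConed (augGraph G W) (layer G 𝔉 F (k + 1)) (coneVerts 𝔉 F k)
      (fun b => {a | ∃ L, b = AugVertex.proj L ∧ a ∈ augVerts 𝔉 L \ linkPart G F})
      (max δ' (δ + 16)) (K + 8) := by
  have hyp_mono : ∀ {S : Set (AugVertex V)} {d d' : ℕ}, d ≤ d' → HypOn (augGraph G W) S d →
      HypOn (augGraph G W) S d' := by
    intro S d d' hd h
    refine ⟨h.conn, fun x hx y hy z hz w hw => ?_⟩
    have := h.four_point x hx y hy z hz w hw
    omega
  have hC : ∀ L, {a | ∃ L', AugVertex.proj L = AugVertex.proj L' ∧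
      a ∈ augVerts 𝔉 L' \ linkPart G F} = augVerts 𝔉 L \ linkPart G F := by
    intro L
    ext a
    simp only [AugVertex.proj.injEq, Set.mem_ofPred_eq]
    exact ⟨by rintro ⟨_, rfl, h⟩; exact h, fun h => ⟨L, rfl, h⟩⟩
  have conn : ∀ T : Set (AugVertex V), (∀ v ∉ link G F, AugVertex.vert v ∈ T) →
      T ⊆ layer G 𝔉 F (k + 1) → ConnOn (augGraph G W) T := fun T hT hT' =>
    h.connOn_of_subset hF hT (Set.subset_empty_iff.1
      ((Set.inter_subset_inter_left _ hT').trans (layer_inter_linkPart (k + 1)).le))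
  have conn_diff : ∀ L, ConnOn (augGraph G W) (layer G 𝔉 F (k + 1) \ {AugVertex.proj L}) :=
    fun L => conn _ (fun v hv => ⟨vert_mem_layer.2 hv, by simp⟩) Set.sdiff_subset
  refine ⟨hyp_mono (le_max_left _ _) hyp, ?_, ?_, ?_, ?_, ?_, ?_, ?_, ?_⟩
  · rintro _ ⟨L, rfl, h1, h2, h3, h4⟩
    exact proj_mem_layer.2 ⟨h1, h2, not_subset_link hF h3, fun _ => by omega⟩
  · rintro _ ⟨L, rfl, -⟩ _ ⟨L', rfl, -⟩
    exact not_aug_adj_proj_proj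
  · rw [layer_diff]
    exact h.connOn_of_subset hF (fun v hv => vert_mem_layer.2 hv) (layer_inter_linkPart k)
  · rintro _ ⟨L, rfl, -⟩
    exact conn_diff L
  · rintro _ ⟨L, rfl, h1, h2, h3, h4⟩
    rw [hC, layer_diff]
    rintro a ⟨haL, haF⟩
    refine ⟨⟨augVerts_mono (Set.subset_univ L) haL, haF⟩, ?_⟩
    rintro M rfl hFM
    rw [← h4]
    exact h.factorSystem.rank_lt_rank h1 haL.2
  · rintro _ ⟨L, rfl, h1, h2, h3, h4⟩ (v | M) hu hadj
    · rw [hC]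
      exact ⟨vert_mem_augVerts.2 (aug_adj_vert_proj.1 hadj), vert_mem_layer.1 hu⟩
    · exact absurd hadj not_aug_adj_proj_proj
  · rintro _ ⟨L, rfl, h1, h2, h3, h4⟩
    rw [hC]
    exact hyp_mono (le_max_right _ _) (hypOn_diff_linkPart h hF h1 h3)
  · rintro _ ⟨L, rfl, h1, h2, h3, h4⟩
    rw [hC]
    intro x hx y hy
    obtain ⟨f, hf⟩ := hF
    have e1 := (sd_diff_le_of_reachLE (h.hyp L h1).conn (reachLE_of_adj_link h h1 h3 hf) hx hy).2
    have e2 := h.qi L h1 x hx.1 y hy.1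
    have hlink : link G L ⊆ link G F := fun v hv f hf => hv f (h3 hf)
    -- The reason for removing large ranks first: no projection vertex of a domain properly
    -- containing L is left, so the quasi-isometric embedding into Y_L applies. Trimming lk(F) from
    -- CL adds at most 8.
    have hsub : layer G 𝔉 F (k + 1) \ {AugVertex.proj L} ⊆ compVerts G 𝔉 L := by
      rintro (v | M) ⟨ha, haL⟩
      · exact vert_mem_compVerts.2 fun e => vert_mem_layer.1 ha (hlink e)
      · obtain ⟨m1, m2, m3, m4⟩ := proj_mem_layer.1 ha
        refine proj_mem_compVerts.2 ⟨m1, m2, fun e => m3 (e.trans hlink), fun e => ?_⟩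
        have hne : L ≠ M := fun e' => haL (by rw [e']; rfl)
        have := h.factorSystem.rank_lt_rank m1 (e.ssubset_of_ne hne)
        have := m4 (h3.trans e)
        omega
    have hmem : ∀ x ∈ augVerts 𝔉 L \ linkPart G F,
        x ∈ layer G 𝔉 F (k + 1) \ {AugVertex.proj L} := by
      rintro a ⟨haL, haF⟩
      refine ⟨⟨⟨augVerts_mono (Set.subset_univ L) haL, haF⟩, ?_⟩, ?_⟩
      · rintro M rfl hFM
        have := h.factorSystem.rank_lt_rank h1 haL.2
        omega
      · rintro rfl
        exact haL.2.ne rfl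
    have e3 := sd_anti hsub (conn_diff L) (hmem x hx) (hmem y hy)
    have e4 := Nat.mul_le_mul_left K e3
    rw [add_mul]
    omega

/-- The layers are uniformly hyperbolic. -/
theorem exists_hypOn_layer (n δ K j : ℕ) : ∃ δ', ∀ {V : Type u} {G : SimpleGraph V}
    {W : SimpleGraph (MaxClique G Set.univ)} {𝔉 : Set (Set V)}, IsDiscreteCHHF G W 𝔉 n δ K →
    ∀ F ∈ 𝔉, ∀ k, n ≤ k + j → HypOn (augGraph G W) (layer G 𝔉 F k) δ' := by
  induction j with
  | zero =>
    refine ⟨δ + 16, fun {V G W 𝔉} h F hF k hk => ?_⟩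
    rw [layer_of_le h.factorSystem (by omega)]
    exact hypOn_diff_linkPart h (h.factorSystem.nonempty F hF) h.factorSystem.univ_mem
      (Set.subset_univ F)
  | succ j ih =>
    obtain ⟨δ', hδ'⟩ := ih
    obtain ⟨δ'', hδ''⟩ := exists_hypOn_of_isConed.{u} (max δ' (δ + 16)) (K + 8)
    refine ⟨δ'', fun {V G W 𝔉} h F hF k hk => ?_⟩
    rw [← layer_diff]
    exact hδ'' (isConed_layer h (h.factorSystem.nonempty F hF)
      (hδ' h F hF (k + 1) (by omega)))

end Layers

/-! ### The closest-point projection via entry points. -/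

section Projection

variable {U : Type u} {H : SimpleGraph U} {S : Set U} {b : U}

/-- Almost closest points of the link of a cone vertex are close to entry points. -/
theorem HypOn.entry_close_of_almost_closest {δ σ : ℕ} (h : HypOn H S δ) (hb : b ∈ S)
    (hc : ConnOn H (S \ {b})) {x u a : U} (hx : x ∈ S \ {b}) (hu : IsEntry H S b x u)
    (ha : a ∈ S) (hab : H.Adj a b)
    (hle : sd H (S \ {b}) x a ≤ sd H (S \ {b}) x u + σ) :
    sd H (S \ {b}) a u ≤ 6 * δ + 2 * σ + 4 := by
  have haS : a ∈ S \ {b} := ⟨ha, fun e => hab.ne e⟩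
  have hux := hu.sd_le h.conn hb hx.1
  have anti : ∀ p ∈ S \ {b}, ∀ q ∈ S \ {b}, sd H S p q ≤ sd H (S \ {b}) p q :=
    fun p hp q hq => sd_anti Set.sdiff_subset hc hp hq
  have hab1 := sd_eq_one ha hb hab
  have t1 := sd_triangle hc haS hx u
  have c1 := sd_comm (H := H) (S := S \ {b}) a x
  have t2 := sd_triangle h.conn hx.1 ha b
  have a1 := anti x hx a haS
  by_cases hsmall : sd H (S \ {b}) x a ≤ δ + 1 + σ
  · omega
  -- A geodesic to a outside b is almost a geodesic towards b. Stopping δ + 1 + σ before a gives a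
  -- point satisfying the product condition with x, whose entry point is thus close to u.
  · obtain ⟨p, hp, p1, p2⟩ := exists_btw hc hx haS
      (k := sd H (S \ {b}) x a - (δ + 1 + σ)) (by omega)
    obtain ⟨w, hw⟩ := exists_isEntry h.conn hb hp.1 hp.2
    have hwp := hw.sd_le h.conn hb hp.1
    have a2 := anti x hx p hp
    have a3 := anti p hp a haS
    have t3 := sd_triangle h.conn hx.1 hp.1 b
    have t4 := sd_triangle h.conn hp.1 ha b
    have := h.entry_close_of_product hb hc hx.1 hp.1 (R := δ + 1) (by omega) (by omega) hu hw
    have t5 := sd_triangle hc haS hp u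
    have t6 := sd_triangle hc hp hw.mem_diff u
    have c2 := sd_comm (H := H) (S := S \ {b}) a p
    have c3 := sd_comm (H := H) (S := S \ {b}) w u
    omega

theorem HypOn.entry_lipschitz {δ : ℕ} (h : HypOn H S δ) (hb : b ∈ S)
    (hc : ConnOn H (S \ {b})) {x y : U} (hx : x ∈ S \ {b}) (hy : y ∈ S \ {b}) :
    sd H (S \ {b}) (entry H S b x) (entry H S b y) ≤ (36 * δ + 28) * sd H (S \ {b}) x y := by
  have he : ∀ x ∈ S \ {b}, IsEntry H S b x (entry H S b x) :=
    fun x hx => isEntry_entry h.conn hb hx.1 hx.2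
  refine lipschitz_of_adj (f := fun x y => sd H (S \ {b}) (entry H S b x) (entry H S b y)) hc
    ?_ (fun x _ => sd_self _) ?_ hx hy
  · exact fun x hx y hy z _ => sd_triangle hc (he x hx).mem_diff (he y hy).mem_diff _
  · intro x hx y hy hxy
    refine h.entry_close hb hc hx hy ?_ (he x hx) (he y hy)
    rw [sd_eq_one hx hy hxy, sd_eq_one hx.1 hy.1 hxy]

end Projection

section ClosestPoint

variable {V : Type u} {G : SimpleGraph V} {W : SimpleGraph (MaxClique G Set.univ)}
  {𝔉 : Set (Set V)} {n δ K : ℕ} {F : Set V}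

/-- `c` is, up to an error of `3`, a vertex of `CF` closest to `x` in `Y_F`. -/
def AlmostClosest (G : SimpleGraph V) (W : SimpleGraph (MaxClique G Set.univ))
    (𝔉 : Set (Set V)) (F : Set V) (x c : AugVertex V) : Prop :=
  c ∈ augVerts 𝔉 F ∧ ∀ a ∈ augVerts 𝔉 F,
    sd (augGraph G W) (compVerts G 𝔉 F) x c ≤ sd (augGraph G W) (compVerts G 𝔉 F) x a + 3

/-- The coarse closest point projection from `Y_F` to `CF` is coarsely Lipschitz. -/
theorem exists_almostClosest_lipschitz (n δ K : ℕ) : ∃ M, ∀ {V : Type u} {G : SimpleGraph V}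
    {W : SimpleGraph (MaxClique G Set.univ)} {𝔉 : Set (Set V)}, IsDiscreteCHHF G W 𝔉 n δ K →
    ∀ F ∈ 𝔉, ∀ x ∈ compVerts G 𝔉 F, ∀ x' ∈ compVerts G 𝔉 F, ∀ c c',
      AlmostClosest G W 𝔉 F x c → AlmostClosest G W 𝔉 F x' c' →
      sd (augGraph G W) (augVerts 𝔉 F) c c' ≤
        M * sd (augGraph G W) (compVerts G 𝔉 F) x x' + M := by
  -- With `j = n` the bound covers the layers of every rank.
  obtain ⟨δ', hδ'⟩ := exists_hypOn_layer.{u} n δ K n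
  refine ⟨K * (36 * δ' + 28) + K * (2 * (6 * δ' + 14)) + K + 6,
    fun {V G W 𝔉} h F hF x hx x' hx' c c' hxc hxc' => ?_⟩
  have hne := h.factorSystem.nonempty F hF
  have hconn := h.conn_compVerts hne
  have hsub := augVerts_subset_compVerts (G := G) h.factorSystem F
  by_cases hFu : F = Set.univ
  · subst hFu
    have hY := compVerts_univ (G := G) h.factorSystem
    unfold AlmostClosest at hxc hxc'
    rw [hY] at hxc hxc' hx hx' hconn ⊢
    have e1 := hxc.2 x hx
    have e2 := hxc'.2 x' hx'
    rw [sd_self] at e1 e2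
    have t1 := sd_triangle hconn hxc.1 hx c'
    have t2 := sd_triangle hconn hx hx' c'
    rw [sd_comm c x] at t1
    have : sd (augGraph G W) (augVerts 𝔉 Set.univ) x x' ≤
      (K * (36 * δ' + 28) + K * (2 * (6 * δ' + 14)) + K + 6) *
        sd (augGraph G W) (augVerts 𝔉 Set.univ) x x' := Nat.le_mul_of_pos_left _ (by omega)
    omega
  -- In this layer Y_F is the complement of b_F, and the neighbours of b_F are the vertices of F.
  · have hS := hδ' h F hF (rank 𝔉 F + 1) (by omega)
    have hdiff := layer_rank_diff (F := F) h.factorSystem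
    have hb : AugVertex.proj F ∈ layer G 𝔉 F (rank 𝔉 F + 1) :=
      proj_mem_layer.2 ⟨hF, hFu, not_subset_link hne subset_rfl, fun _ => by omega⟩
    rw [← hdiff] at hconn hx hx'
    have lip := hS.entry_lipschitz hb hconn hx hx'
    set e := entry (augGraph G W) (layer G 𝔉 F (rank 𝔉 F + 1)) (AugVertex.proj F) with he
    have hent : ∀ x ∈ layer G 𝔉 F (rank 𝔉 F + 1) \ {AugVertex.proj F},
        IsEntry (augGraph G W) (layer G 𝔉 F (rank 𝔉 F + 1)) (AugVertex.proj F) x (e x) :=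
      fun x hx => isEntry_entry hS.conn hb hx.1 hx.2
    have hemem : ∀ x ∈ layer G 𝔉 F (rank 𝔉 F + 1) \ {AugVertex.proj F},
        e x ∈ augVerts 𝔉 F := by
      intro x hx
      have := (hent x hx).2.1
      generalize e x = y at this
      rcases y with v | L
      · exact vert_mem_augVerts.2 (aug_adj_vert_proj.1 this)
      · exact absurd this not_aug_adj_proj_proj
    have close : ∀ x ∈ layer G 𝔉 F (rank 𝔉 F + 1) \ {AugVertex.proj F}, ∀ c,
        AlmostClosest G W 𝔉 F x c →
        sd (augGraph G W) (layer G 𝔉 F (rank 𝔉 F + 1) \ {AugVertex.proj F}) c (e x) ≤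
          6 * δ' + 13 := by
      rintro x hx c ⟨hc, hcl⟩
      have hcS : c ∈ layer G 𝔉 F (rank 𝔉 F + 1) \ {AugVertex.proj F} := by
        rw [hdiff]; exact hsub hc
      have hv : ∃ v ∈ F, c = .vert v ∨ (augGraph G W).Adj c (.vert v) := by
        rcases c with v | L
        · exact ⟨v, hc, Or.inl rfl⟩
        · obtain ⟨v, hv⟩ := h.factorSystem.nonempty L hc.1
          exact ⟨v, hc.2.1 hv, Or.inr (aug_adj_proj_vert.2 hv)⟩
      obtain ⟨v, hvF, hcv⟩ := hv
      have hvS : AugVertex.vert v ∈ layer G 𝔉 F (rank 𝔉 F + 1) \ {AugVertex.proj F} := by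
        rw [hdiff]; exact hsub hvF
      have e1 := sd_le_one hcS hvS hcv
      have e2 := hcl (e x) (hemem x hx)
      rw [← hdiff] at e2
      have e3 := sd_triangle hconn hx hcS (.vert v)
      -- The value 4 is the error 3 of an almost closest vertex plus 1 for passing from c to a
      -- vertex of F.
      have e4 := hS.entry_close_of_almost_closest hb hconn (σ := 4) hx (hent x hx) hvS.1
        (aug_adj_vert_proj.2 hvF) (by omega)
      have e5 := sd_triangle hconn hcS hvS (e x)
      omega
    have c1 := close x hx c hxc
    have c2 := close x' hx' c' hxc'
    have q := h.qi F hF c hxc.1 c' hxc'.1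
    rw [← hdiff] at q ⊢
    have hcS : c ∈ layer G 𝔉 F (rank 𝔉 F + 1) \ {AugVertex.proj F} := by
      rw [hdiff]; exact hsub hxc.1
    have t1 := sd_triangle hconn hcS (hent x hx).mem_diff c'
    have t2 := sd_triangle hconn (hent x hx).mem_diff (hent x' hx').mem_diff c'
    rw [sd_comm (e x') c'] at t2
    have hle : sd (augGraph G W) (layer G 𝔉 F (rank 𝔉 F + 1) \ {AugVertex.proj F}) c c' ≤
        (36 * δ' + 28) * sd (augGraph G W)
          (layer G 𝔉 F (rank 𝔉 F + 1) \ {AugVertex.proj F}) x x' + 2 * (6 * δ' + 14) := by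
      omega
    have hle' := Nat.mul_le_mul_left K hle
    generalize sd (augGraph G W) (layer G 𝔉 F (rank 𝔉 F + 1) \ {AugVertex.proj F}) x x' = d at *
    have e1 : K * ((36 * δ' + 28) * d + 2 * (6 * δ' + 14)) =
      K * (36 * δ' + 28) * d + K * (2 * (6 * δ' + 14)) := by ring
    have e2 : K * (36 * δ' + 28) * d ≤
      (K * (36 * δ' + 28) + K * (2 * (6 * δ' + 14)) + K + 6) * d :=
      Nat.mul_le_mul_right _ (by omega)
    omega

end ClosestPoint

/-! ### Back to realizations, and the bounds for π and ρ. -/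

section Assembly

variable {V : Type u} {G : SimpleGraph V} {W : SimpleGraph (MaxClique G Set.univ)}
  {𝔉 : Set (Set V)} {n : ℕ} {δ : ℝ} {F F' : Set V}

/-- The graph distance of unreachable vertices is 0 by convention, which a metric on the realization
forbids for distinct vertices. -/
theorem connOn_of_isMetric {U : Type u} {H : SimpleGraph U} {S : Set U}
    (h : IsMetric fun x y : realization H S => realizationDist H S x.1 y.1) : ConnOn H S := by
  intro u hu v hv
  by_contra hr
  have h0 : sd H S u v = 0 := SimpleGraph.dist_eq_zero_of_not_reachable hr
  have h1 := (h.eq_zero_iff ⟨_, vertexPoint_mem hu⟩ ⟨_, vertexPoint_mem hv⟩).1 (by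
    simp only [realizationDist_vertexPoint hu hv, h0, Nat.cast_zero])
  have h2 : vertexPoint u = vertexPoint v := congrArg Subtype.val h1
  have h3 := support_vertexPoint u
  rw [h2, support_vertexPoint, Set.singleton_eq_singleton_iff] at h3
  exact hr (h3 ▸ SimpleGraph.Reachable.refl _)

/-- `HypOn` counts the whole error of the four-point condition, hence 2δ. The lower quasi-isometry
bound solved for the distance in CF gives the factor δ and the summand δ². -/
theorem IsCHHF.isDiscrete (h : IsCHHF G W 𝔉 n δ) :
    IsDiscreteCHHF G W 𝔉 n ⌈2 * δ⌉₊ (⌈δ⌉₊ + ⌈δ ^ 2⌉₊) := by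
  refine ⟨h.factorSystem, h.hierarchy, fun F hF => ⟨?_, ?_⟩, ?_⟩
  · exact connOn_of_isMetric (h.hyperbolicity.hyperbolic F hF).isGeodesicSpace.isMetric
  · intro x hx y hy z hz w hw
    have := (h.hyperbolicity.hyperbolic F hF).four_point ⟨_, vertexPoint_mem hx⟩
      ⟨_, vertexPoint_mem hy⟩ ⟨_, vertexPoint_mem hz⟩ ⟨_, vertexPoint_mem hw⟩
    simp only [augDist, realizationDist_vertexPoint, hx, hy, hz, hw] at this
    have hδ := Nat.le_ceil (2 * δ)
    have h' := this.trans (add_le_add_right hδ _)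
    exact_mod_cast h'
  · intro F hF x hx y hy
    have hsub := augVerts_subset_compVerts (G := G) h.factorSystem F
    have := (h.hyperbolicity.qi_embedded F hF ⟨_, vertexPoint_mem hx⟩
      ⟨_, vertexPoint_mem hy⟩).1
    simp only [augDist, compDist, realizationDist_vertexPoint, hx, hy, hsub hx, hsub hy] at this
    have hpos := h.hyperbolicity.pos
    have h1 := Nat.le_ceil δ
    have h2 := Nat.le_ceil (δ ^ 2)
    rw [sub_le_iff_le_add, div_le_iff₀ hpos] at this
    have h3 : (0 : ℝ) ≤ sd (augGraph G W) (compVerts G 𝔉 F) x y := Nat.cast_nonneg _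
    have h4 : (0 : ℝ) ≤ (⌈δ ^ 2⌉₊ : ℝ) := Nat.cast_nonneg _
    have h5 : (0 : ℝ) ≤ (⌈δ⌉₊ : ℝ) := Nat.cast_nonneg _
    have h6 : (sd (augGraph G W) (augVerts 𝔉 F) x y : ℝ) ≤
        ((⌈δ⌉₊ : ℝ) + ⌈δ ^ 2⌉₊) * sd (augGraph G W) (compVerts G 𝔉 F) x y +
          ((⌈δ⌉₊ : ℝ) + ⌈δ ^ 2⌉₊) := by
      nlinarith [mul_le_mul_of_nonneg_right h1 h3, mul_nonneg h4 h3]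
    exact_mod_cast h6

theorem mem_realization_compVerts (hfs : IsFactorSystem n G 𝔉) (y : AugSpace G W 𝔉 F) :
    y.1 ∈ realization (augGraph G W) (compVerts G 𝔉 F) :=
  realization_mono (augVerts_subset_compVerts hfs F) y.2

theorem compDist_nonneg (hfs : IsFactorSystem n G 𝔉) {x : AugVertex V → ℝ}
    (hx : x ∈ realization (augGraph G W) (compVerts G 𝔉 F)) (y : AugSpace G W 𝔉 F) :
    0 ≤ compDist G W 𝔉 F x y.1 :=
  (isPoint_of_mem hx).dist_nonneg (isPoint_of_mem (mem_realization_compVerts hfs y))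

theorem closestPoint_nonempty (hF : F.Nonempty) (x : AugVertex V → ℝ) :
    (closestPoint G W 𝔉 F x).Nonempty := by
  obtain ⟨f, hf⟩ := hF
  have : Nonempty (AugSpace G W 𝔉 F) :=
    ⟨⟨_, vertexPoint_mem (vert_mem_augVerts.2 hf)⟩⟩
  obtain ⟨y, hy⟩ := exists_lt_of_ciInf_lt (lt_add_one (⨅ z : AugSpace G W 𝔉 F,
    compDist G W 𝔉 F x z.1))
  exact ⟨y, hy.le⟩

theorem vertexPoint_mem_closestPoint (hfs : IsFactorSystem n G 𝔉) {a : AugVertex V}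
    (ha : a ∈ augVerts 𝔉 F) :
    (⟨vertexPoint a, vertexPoint_mem ha⟩ : AugSpace G W 𝔉 F) ∈
      closestPoint G W 𝔉 F (vertexPoint a) := by
  have haY := augVerts_subset_compVerts (G := G) hfs F ha
  have h0 : 0 ≤ ⨅ z : AugSpace G W 𝔉 F, compDist G W 𝔉 F (vertexPoint a) z.1 :=
    Real.iInf_nonneg fun z => compDist_nonneg hfs (vertexPoint_mem haY) z
  change realizationDist _ _ _ _ ≤ _
  rw [realizationDist_vertexPoint haY haY, sd_self, Nat.cast_zero]
  linarith

/-- The error 3 is 1 from the definition of the projection and 2 from replacing a point by a vertex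
of its support. -/
theorem almostClosest_of_mem_closestPoint (hfs : IsFactorSystem n G 𝔉)
    (hconn : ConnOn (augGraph G W) (compVerts G 𝔉 F)) {a c : AugVertex V}
    (ha : a ∈ compVerts G 𝔉 F) {y : AugSpace G W 𝔉 F}
    (hy : y ∈ closestPoint G W 𝔉 F (vertexPoint a)) (hc : y.1 c ≠ 0) :
    AlmostClosest G W 𝔉 F a c := by
  refine ⟨(isPoint_of_mem y.2).mem c hc, fun c₀ hc₀ => ?_⟩
  have hpa := isPoint_of_mem (vertexPoint_mem (H := augGraph G W) ha)
  have h1 := hpa.sd_le_dist hconn (isPoint_of_mem (mem_realization_compVerts hfs y))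
    (a := a) (c := c) (by rw [vertexPoint_self]; norm_num) hc
  have h2 : (⨅ z : AugSpace G W 𝔉 F, compDist G W 𝔉 F (vertexPoint a) z.1) ≤
      compDist G W 𝔉 F (vertexPoint a) (vertexPoint c₀) :=
    ciInf_le (f := fun z : AugSpace G W 𝔉 F => compDist G W 𝔉 F (vertexPoint a) z.1)
      ⟨0, by rintro _ ⟨z, rfl⟩; exact compDist_nonneg hfs (vertexPoint_mem ha) z⟩
      ⟨vertexPoint c₀, vertexPoint_mem hc₀⟩
  have h3 : compDist G W 𝔉 F (vertexPoint a) (vertexPoint c₀) =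
      sd (augGraph G W) (compVerts G 𝔉 F) a c₀ :=
    realizationDist_vertexPoint ha (augVerts_subset_compVerts hfs F hc₀)
  have h4 : compDist G W 𝔉 F (vertexPoint a) y.1 ≤ _ := hy
  have h5 : (sd (augGraph G W) (compVerts G 𝔉 F) a c : ℝ) ≤
      sd (augGraph G W) (compVerts G 𝔉 F) a c₀ + 3 := by
    change (sd (augGraph G W) (compVerts G 𝔉 F) a c : ℝ) ≤
      compDist G W 𝔉 F (vertexPoint a) y.1 + 2 at h1
    linarith
  exact_mod_cast h5

theorem exists_closestPoint_lipschitz (n : ℕ) (δ : ℝ) : ∃ M : ℕ, ∀ {V : Type u} {G : SimpleGraph V}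
    {W : SimpleGraph (MaxClique G Set.univ)} {𝔉 : Set (Set V)}, IsCHHF G W 𝔉 n δ →
    ∀ F ∈ 𝔉, ∀ a ∈ compVerts G 𝔉 F, ∀ a' ∈ compVerts G 𝔉 F,
      ∀ y ∈ closestPoint G W 𝔉 F (vertexPoint a), ∀ y' ∈ closestPoint G W 𝔉 F (vertexPoint a'),
      augDist G W 𝔉 F y y' ≤ M * sd (augGraph G W) (compVerts G 𝔉 F) a a' + M + 2 := by
  obtain ⟨M, hM⟩ := exists_almostClosest_lipschitz.{u} n ⌈2 * δ⌉₊ (⌈δ⌉₊ + ⌈δ ^ 2⌉₊)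
  refine ⟨M, fun {V G W 𝔉} h F hF a ha a' ha' y hy y' hy' => ?_⟩
  have hd := h.isDiscrete
  have hconn := hd.conn_compVerts (h.factorSystem.nonempty F hF)
  have hpy := isPoint_of_mem y.2
  have hpy' := isPoint_of_mem y'.2
  obtain ⟨c, hc⟩ := hpy.nonempty
  obtain ⟨c', hc'⟩ := hpy'.nonempty
  have h1 := hM hd F hF a ha a' ha' c c'
    (almostClosest_of_mem_closestPoint h.factorSystem hconn ha hy hc)
    (almostClosest_of_mem_closestPoint h.factorSystem hconn ha' hy' hc')
  have h2 := hpy.dist_le_sd (hd.hyp F hF).conn hpy' hc hc'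
  have h3 : (sd (augGraph G W) (augVerts 𝔉 F) c c' : ℝ) ≤
      M * sd (augGraph G W) (compVerts G 𝔉 F) a a' + M := by exact_mod_cast h1
  unfold augDist
  linarith

/-- Vertices of lk(F) are adjacent to f, and so is b_L for F ⊆ L; for L ⊆ lk(F) one passes through a
vertex of L outside lk(F'). -/
theorem reachLE_projPart {f : V} (hf : f ∈ F) (hfF' : f ∉ link G F') {a : AugVertex V}
    (ha : a ∈ projPart G 𝔉 F ∩ compVerts G 𝔉 F') :
    ReachLE (augGraph G W) (compVerts G 𝔉 F') a (.vert f) 2 := by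
  have hfY : AugVertex.vert f ∈ compVerts G 𝔉 F' := vert_mem_compVerts.2 hfF'
  have vert : ∀ v ∈ link G F, v ∉ link G F' →
      ReachLE (augGraph G W) (compVerts G 𝔉 F') (.vert v) (.vert f) 1 := fun v hv hvF' =>
    reachLE_of_adj (vert_mem_compVerts.2 hvF') hfY
      (Or.inr (aug_adj_vert_vert.2 ⟨(hv f hf).ne', Or.inl (hv f hf).symm⟩))
  obtain ⟨haP, haY⟩ := ha
  rcases a with v | L
  · exact (vert v haP (vert_mem_compVerts.1 haY)).mono (by omega)
  · obtain ⟨-, hL | hL⟩ := haP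
    · obtain ⟨v, hv, hvF'⟩ := exists_mem_notMem (proj_mem_compVerts.1 haY).2.2.1
      exact (reachLE_of_adj haY (vert_mem_compVerts.2 hvF')
        (Or.inr (aug_adj_proj_vert.2 hv))).trans (vert v (hL hv) hvF')
    · exact (reachLE_of_adj haY hfY (Or.inr (aug_adj_proj_vert.2 (hL.1 hf)))).mono (by omega)

theorem proj_mem_projPart (hF : F ∈ 𝔉) (hlink : ¬ F ⊆ link G F') (hsub : ¬ F' ⊆ F) :
    AugVertex.proj F ∈ projPart G 𝔉 F ∩ compVerts G 𝔉 F' := by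
  have hne : F ≠ Set.univ := fun e => hsub (e ▸ Set.subset_univ _)
  exact ⟨⟨hF, Or.inr ⟨subset_rfl, hne⟩⟩, proj_mem_compVerts.2 ⟨hF, hne, hlink, hsub⟩⟩

theorem mem_cliqueProj_of_mem (hfs : IsFactorSystem n G 𝔉) {v : V} (hv : v ∈ F)
    {w : MaxClique G Set.univ} (hvw : v ∈ w.1) :
    (⟨vertexPoint (.vert v), vertexPoint_mem (vert_mem_augVerts.2 hv)⟩ : AugSpace G W 𝔉 F) ∈
      cliqueProj G W 𝔉 F w := by
  by_cases hF : F = Set.univ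
  · exact Or.inl ⟨hF, v, hvw, rfl⟩
  · refine Or.inr ⟨hF, Set.mem_iUnion₂.2 ⟨.vert v, ⟨⟨v, hvw, rfl⟩, ?_⟩, ?_⟩⟩
    · exact vert_mem_compVerts.2 (notMem_link_of_mem hv)
    · exact vertexPoint_mem_closestPoint hfs (vert_mem_augVerts.2 hv)

theorem cliqueProj_nonempty (hF : F.Nonempty) (w : MaxClique G Set.univ) :
    (cliqueProj G W 𝔉 F w).Nonempty := by
  obtain ⟨v, hvw, hv⟩ := w.exists_notMem_link (Set.subset_univ F) hF
  by_cases hFu : F = Set.univ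
  · exact ⟨⟨_, vertexPoint_mem (vert_mem_augVerts.2 (hFu ▸ Set.mem_univ v))⟩,
      Or.inl ⟨hFu, v, hvw, rfl⟩⟩
  · obtain ⟨y, hy⟩ := closestPoint_nonempty (G := G) (W := W) (𝔉 := 𝔉) hF
      (vertexPoint (AugVertex.vert v))
    exact ⟨y, Or.inr ⟨hFu, Set.mem_iUnion₂.2
      ⟨.vert v, ⟨⟨v, hvw, rfl⟩, vert_mem_compVerts.2 hv⟩, hy⟩⟩⟩

theorem cliqueProj_lipschitz (h : IsCHHF G W 𝔉 n δ) {M : ℕ}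
    (hM : ∀ F ∈ 𝔉, ∀ a ∈ compVerts G 𝔉 F, ∀ a' ∈ compVerts G 𝔉 F,
      ∀ y ∈ closestPoint G W 𝔉 F (vertexPoint a), ∀ y' ∈ closestPoint G W 𝔉 F (vertexPoint a'),
      augDist G W 𝔉 F y y' ≤ M * sd (augGraph G W) (compVerts G 𝔉 F) a a' + M + 2)
    (hF : F ∈ 𝔉) {w w' : MaxClique G Set.univ} {y y' : AugSpace G W 𝔉 F}
    (hy : y ∈ cliqueProj G W 𝔉 F w) (hy' : y' ∈ cliqueProj G W 𝔉 F w') :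
    augDist G W 𝔉 F y y' ≤ (M + 1) * sd W Set.univ w w' + 2 * M + 2 := by
  have hd := h.isDiscrete
  have hne := h.factorSystem.nonempty F hF
  have hw0 : (0 : ℝ) ≤ sd W Set.univ w w' := Nat.cast_nonneg _
  have hM0 : (0 : ℝ) ≤ M := Nat.cast_nonneg _
  have hMw := mul_nonneg hM0 hw0
  rcases hy with ⟨rfl, v, hv, hyv⟩ | ⟨hFu, hy⟩
  · rcases hy' with ⟨-, v', hv', hyv'⟩ | ⟨hFu, -⟩
    · have hmem : ∀ v : V, AugVertex.vert v ∈ augVerts 𝔉 Set.univ := fun v => Set.mem_univ v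
      have h1 := (hd.reachLE_of_cliques hne (T := augVerts 𝔉 Set.univ) (fun v _ => hmem v) _ w w'
        rfl v hv v' hv' (notMem_link_of_mem (Set.mem_univ v))
        (notMem_link_of_mem (Set.mem_univ v'))).2
      have h2 : augDist G W 𝔉 Set.univ y y' =
          sd (augGraph G W) (augVerts 𝔉 Set.univ) (.vert v) (.vert v') := by
        rw [augDist, hyv, hyv', realizationDist_vertexPoint (hmem v) (hmem v')]
      have h3 : (sd (augGraph G W) (augVerts 𝔉 Set.univ) (.vert v) (.vert v') : ℝ) ≤
          sd W Set.univ w w' + 1 := by exact_mod_cast h1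
      rw [h2]
      linarith
    · exact absurd rfl hFu
  · rcases hy' with ⟨hFu', -⟩ | ⟨-, hy'⟩
    · exact absurd hFu' hFu
    · obtain ⟨_, ⟨⟨v, hv, rfl⟩, hvY⟩, hy⟩ := Set.mem_iUnion₂.1 hy
      obtain ⟨_, ⟨⟨v', hv', rfl⟩, hvY'⟩, hy'⟩ := Set.mem_iUnion₂.1 hy'
      have h1 := (hd.reachLE_of_cliques hne (T := compVerts G 𝔉 F)
        (fun v hv => vert_mem_compVerts.2 hv) _ w w' rfl v hv v' hv' (vert_mem_compVerts.1 hvY)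
        (vert_mem_compVerts.1 hvY')).2
      have h2 := hM F hF _ hvY _ hvY' y hy y' hy'
      have h3 : (sd (augGraph G W) (compVerts G 𝔉 F) (.vert v) (.vert v') : ℝ) ≤
          sd W Set.univ w w' + 1 := by exact_mod_cast h1
      have h4 := mul_le_mul_of_nonneg_left h3 hM0
      linarith

theorem rel_bound (h : IsCHHF G W 𝔉 n δ) {M : ℕ}
    (hM : ∀ F ∈ 𝔉, ∀ a ∈ compVerts G 𝔉 F, ∀ a' ∈ compVerts G 𝔉 F,
      ∀ y ∈ closestPoint G W 𝔉 F (vertexPoint a), ∀ y' ∈ closestPoint G W 𝔉 F (vertexPoint a'),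
      augDist G W 𝔉 F y y' ≤ M * sd (augGraph G W) (compVerts G 𝔉 F) a a' + M + 2)
    (hF : F ∈ 𝔉) (hF' : F' ∈ 𝔉) (hlink : ¬ F ⊆ link G F') (hsub : ¬ F' ⊆ F) :
    (closestPointVerts G W 𝔉 F' (projPart G 𝔉 F ∩ compVerts G 𝔉 F')).Nonempty ∧
      DiamLE (augDist G W 𝔉 F')
        (closestPointVerts G W 𝔉 F' (projPart G 𝔉 F ∩ compVerts G 𝔉 F')) (5 * M + 2) := by
  constructor
  · obtain ⟨y, hy⟩ := closestPoint_nonempty (G := G) (W := W) (𝔉 := 𝔉)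
      (h.factorSystem.nonempty F' hF') (vertexPoint (AugVertex.proj F))
    exact ⟨y, Set.mem_iUnion₂.2 ⟨_, proj_mem_projPart hF hlink hsub, hy⟩⟩
  · intro y hy y' hy'
    obtain ⟨a, ha, hy⟩ := Set.mem_iUnion₂.1 hy
    obtain ⟨a', ha', hy'⟩ := Set.mem_iUnion₂.1 hy'
    obtain ⟨f, hf, hfF'⟩ := exists_mem_notMem hlink
    have h1 := ((reachLE_projPart (W := W) hf hfF' ha).trans
      (reachLE_projPart (W := W) hf hfF' ha').symm).2
    have h2 := hM F' hF' a ha.2 a' ha'.2 y hy y' hy'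
    have h3 : (sd (augGraph G W) (compVerts G 𝔉 F') a a' : ℝ) ≤ 4 := by exact_mod_cast h1
    have h4 := mul_le_mul_of_nonneg_left h3 (Nat.cast_nonneg (α := ℝ) M)
    linarith

theorem not_subset_link_of_subset (hfs : IsFactorSystem n G 𝔉) (hF : F ∈ 𝔉) (h : F ⊆ F') :
    ¬ F ⊆ link G F' := by
  obtain ⟨f, hf⟩ := hfs.nonempty F hF
  exact fun h' => notMem_link_of_mem (h hf) (h' hf)

end Assembly

end CHHF

theorem lemma3p17 (n : ℕ) (δ : ℝ) :
    ∃ E : ℝ, ∀ (V : Type*) (G : SimpleGraph V) (W : SimpleGraph (CHHF.MaxClique G Set.univ))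
      (𝔉 : Set (Set V)),
      CHHF.IsCHHF G W 𝔉 n δ → CHHF.IsProtoHierarchy E (CHHF.protoData G W 𝔉) := by
  obtain ⟨M, hM⟩ := CHHF.exists_closestPoint_lipschitz n δ
  -- The sets ρ need 5M + 2, the projections 4M + 4; the error 3 between points and nearby vertices
  -- is covered as well.
  refine ⟨5 * M + 4, fun V G W 𝔉 h => ?_⟩
  replace hM := @hM V G W 𝔉 h
  have hd := h.isDiscrete
  have hfs := h.factorSystem
  have hM0 : (0 : ℝ) ≤ M := Nat.cast_nonneg _
  have hne : ∀ F : 𝔉, F.1.Nonempty := fun F => hfs.nonempty F.1 F.2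
  have rel_nest : ∀ F F' : 𝔉, (CHHF.protoData G W 𝔉).pnest F F' → _ := fun F F' hFF =>
    CHHF.rel_bound h hM F.2 F'.2 (CHHF.not_subset_link_of_subset hfs F.2 hFF.1)
      fun e => hFF.2 (Subtype.ext (hFF.1.antisymm e))
  have lip : ∀ (F : 𝔉) (p q : ↥(CHHF.realization W Set.univ)),
      ∀ a ∈ (CHHF.protoData G W 𝔉).proj F p, ∀ b ∈ (CHHF.protoData G W 𝔉).proj F q,
      CHHF.augDist G W 𝔉 F.1 a b ≤
        (M + 1) * CHHF.realizationDist W Set.univ p.1 q.1 + 4 * M + 4 := by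
    intro F p q a ha b hb
    obtain ⟨w, hw, ha⟩ := Set.mem_iUnion₂.1 ha
    obtain ⟨w', hw', hb⟩ := Set.mem_iUnion₂.1 hb
    have h1 := CHHF.cliqueProj_lipschitz h hM F.2 ha hb
    have h2 := (CHHF.isPoint_of_mem p.2).sd_le_dist hd.conn_cliques
      (CHHF.isPoint_of_mem q.2) hw hw'
    have h3 := mul_le_mul_of_nonneg_left h2 (add_nonneg hM0 zero_le_one)
    linarith
  have dist_self : ∀ p : ↥(CHHF.realization W Set.univ),
      CHHF.realizationDist W Set.univ p.1 p.1 = 0 := fun p =>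
    ((CHHF.isMetric_realization hd.conn_cliques).eq_zero_iff p p).2 rfl
  refine
    { E_pos := by linarith
      quasiGeodesic := CHHF.isQuasiGeodesicSpace_realization hd.conn_cliques
      geodesic := fun F => (h.hyperbolicity.hyperbolic F.1 F.2).isGeodesicSpace
      proj_nonempty := ?_
      proj_diam := ?_
      proj_lipschitz := ?_
      proj_coarsely_onto := ?_
      nest_refl := fun F => Set.Subset.refl F.1
      nest_trans := fun _ _ _ => Set.Subset.trans
      nest_antisymm := fun _ _ h1 h2 => Subtype.ext (Set.Subset.antisymm h1 h2)
      maximal := ?_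
      rel_nest_nonempty := fun F F' hFF => (rel_nest F F' hFF).1
      rel_nest_diam := ?_
      relMap_nonempty := ?_
      orth_symm := fun _ _ => CHHF.mem_link_comm
      orth_irrefl := fun F => CHHF.not_subset_link (hne F) subset_rfl
      orth_of_nest := fun _ _ _ h1 h2 v hv u hu => h2 hv u (h1 hu)
      orth_not_comparable := ?_
      rel_trans := ?_ }
  · intro F p
    obtain ⟨w, hw⟩ := (CHHF.isPoint_of_mem p.2).nonempty
    obtain ⟨y, hy⟩ := CHHF.cliqueProj_nonempty (W := W) (𝔉 := 𝔉) (hne F) w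
    exact ⟨y, Set.mem_iUnion₂.2 ⟨w, hw, hy⟩⟩
  · intro F p a ha b hb
    have := lip F p p a ha b hb
    rw [dist_self, mul_zero] at this
    change CHHF.augDist G W 𝔉 F.1 a b ≤ _
    linarith
  · intro F p q a ha b hb
    have h1 := lip F p q a ha b hb
    have h2 := (CHHF.isPoint_of_mem p.2).dist_nonneg (CHHF.isPoint_of_mem q.2)
    change CHHF.augDist G W 𝔉 F.1 a b ≤
      (5 * M + 4) * CHHF.realizationDist W Set.univ p.1 q.1 + (5 * M + 4)
    have h3 := mul_nonneg hM0 h2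
    linarith
  · intro F y
    have hpy := CHHF.isPoint_of_mem y.2
    obtain ⟨c, hc⟩ := hpy.nonempty
    have hcF := hpy.mem c hc
    have hv : ∃ v ∈ F.1, c = .vert v ∨ (CHHF.augGraph G W).Adj c (.vert v) := by
      rcases c with v | L
      · exact ⟨v, hcF, Or.inl rfl⟩
      · obtain ⟨v, hv⟩ := hfs.nonempty L hcF.1
        exact ⟨v, hcF.2.1 hv, Or.inr (CHHF.aug_adj_proj_vert.2 hv)⟩
    obtain ⟨v, hvF, hcv⟩ := hv
    obtain ⟨w, hw⟩ := CHHF.exists_maxClique_mem (G := G) (Set.mem_univ v)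
    have hvm : CHHF.AugVertex.vert v ∈ CHHF.augVerts 𝔉 F.1 := hvF
    refine ⟨⟨CHHF.vertexPoint (.vert v), CHHF.vertexPoint_mem hvm⟩,
      Set.mem_iUnion.2 ⟨⟨CHHF.vertexPoint w, CHHF.vertexPoint_mem (Set.mem_univ w)⟩,
        Set.mem_iUnion₂.2 ⟨w, ?_, CHHF.mem_cliqueProj_of_mem hfs hvF hw⟩⟩, ?_⟩
    · rw [CHHF.support_vertexPoint]; rfl
    · have h1 := hpy.dist_le_sd (hd.hyp F.1 F.2).conn
        (CHHF.isPoint_of_mem (CHHF.vertexPoint_mem hvm)) (c := .vert v) hc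
        (by rw [CHHF.vertexPoint_self]; norm_num)
      have h2 : (CHHF.sd (CHHF.augGraph G W) (CHHF.augVerts 𝔉 F.1) c (.vert v) : ℝ) ≤ 1 := by
        exact_mod_cast CHHF.sd_le_one hcF hvm hcv
      change CHHF.realizationDist _ _ _ _ ≤ _
      linarith
  · refine Or.inr ⟨⟨Set.univ, hfs.univ_mem⟩, fun F hF => ?_, fun F hF => ?_⟩
    · exact Subtype.ext (Set.univ_subset_iff.1 hF)
    · exact (hF ⟨Set.univ, hfs.univ_mem⟩ (Set.subset_univ F.1)).symm
  · intro F F' hFF y hy y' hy'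
    have := (rel_nest F F' hFF).2 y hy y' hy'
    change CHHF.augDist G W 𝔉 F'.1 y y' ≤ _
    linarith
  · intro F F' hFF x hx
    obtain ⟨y, hy⟩ := CHHF.closestPoint_nonempty (G := G) (W := W) (𝔉 := 𝔉) (hne F) x.1
    refine ⟨y, ?_, hy⟩
    have hpx := CHHF.isPoint_of_mem x.2
    -- Away from ρ^F_F' the edge carrying x lies in Y_F. An endpoint in PF would project to itself,
    -- hence lie in ρ^F_F', and it is within 3 of x.
    have near : ∀ u v, u ∈ CHHF.augVerts 𝔉 F'.1 → x.1 v ≠ 0 →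
        (v = u ∨ (CHHF.augGraph G W).Adj v u) → u ∈ CHHF.compVerts G 𝔉 F.1 := by
      intro u v hu hv huv
      by_contra hcon
      have huY := CHHF.augVerts_subset_compVerts (G := G) hfs F'.1 hu
      have huP : u ∈ CHHF.projPart G 𝔉 F.1 ∩ CHHF.compVerts G 𝔉 F'.1 := by
        refine ⟨?_, huY⟩
        by_contra hnP
        exact hcon ⟨CHHF.augVerts_mono (Set.subset_univ _) hu, hnP⟩
      refine hx ⟨⟨CHHF.vertexPoint u, CHHF.vertexPoint_mem hu⟩,
        Set.mem_iUnion₂.2 ⟨u, huP, CHHF.vertexPoint_mem_closestPoint hfs hu⟩, ?_⟩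
      have h1 := hpx.dist_le_sd (hd.hyp F'.1 F'.2).conn
        (CHHF.isPoint_of_mem (CHHF.vertexPoint_mem hu)) (c := u) hv
        (by rw [CHHF.vertexPoint_self]; norm_num)
      have h2 : (CHHF.sd (CHHF.augGraph G W) (CHHF.augVerts 𝔉 F'.1) v u : ℝ) ≤ 1 := by
        exact_mod_cast CHHF.sd_le_one (hpx.mem v hv) hu huv
      change CHHF.realizationDist _ _ _ _ ≤ _
      linarith
    obtain ⟨u, hu, v, hv, huv, t, ht, hxt⟩ := x.2
    -- If x is a vertex, one endpoint of the chosen edge may lie outside its support, but it is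
    -- adjacent or equal to a vertex in it.
    have hsupp : ∃ w, x.1 w ≠ 0 ∧ (w = u ∨ w = v) := by
      obtain ⟨w, hw⟩ := hpx.nonempty
      refine ⟨w, hw, ?_⟩
      by_contra! hcon
      refine hw ?_
      rw [hxt]
      simp [CHHF.vertexPoint_of_ne hcon.1, CHHF.vertexPoint_of_ne hcon.2]
    obtain ⟨w, hw, hwuv⟩ := hsupp
    refine ⟨u, near u w hu hw ?_, v, near v w hv hw ?_, huv, t, ht, hxt⟩
    · rcases hwuv with rfl | rfl
      · exact Or.inl rfl
      · exact huv.imp Eq.symm SimpleGraph.Adj.symm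
    · rcases hwuv with rfl | rfl
      · exact huv
      · exact Or.inl rfl
  · intro F F' hFF
    refine ⟨fun e => ?_, fun e => ?_⟩
    · exact CHHF.not_subset_link_of_subset hfs F.2 e (CHHF.mem_link_comm hFF)
    · exact CHHF.not_subset_link_of_subset hfs F'.2 e hFF
  · rintro F F' ⟨h1, h2, h3⟩
    have b1 := CHHF.rel_bound h hM F.2 F'.2 (fun e => h1 (CHHF.mem_link_comm e)) h3
    have b2 := CHHF.rel_bound h hM F'.2 F.2 h1 h2
    refine ⟨⟨b1.1, fun y hy y' hy' => ?_⟩, ⟨b2.1, fun y hy y' hy' => ?_⟩⟩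
    · have := b1.2 y hy y' hy'
      change CHHF.augDist G W 𝔉 F'.1 y y' ≤ _
      linarith
    · have := b2.2 y hy y' hy'
      change CHHF.augDist G W 𝔉 F.1 y y' ≤ _
      linarith
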